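/- **Setting.** Let $M>0$, $|a|=M$. The extremal Kerr exterior is $\mathcal M=\mathbb R_v\times[M,\infty)_r\times\mathbb S^2$ with the Kerr metric in ingoing Kerr coordinates $(v,r,\theta,\phi)$, future event horizon $\mathcal H^+=\{r=M\}$, $T=\partial_v$, $Z=\partial_\phi$. Put $\Delta=(r-M)^2$, $\Sigma=r^2+a^2\cos^2\theta$, $\kappa=r-ia\cos\theta$ and consider the algebraically special frame $$e_3=-\partial_r,\qquad e_4=\tfrac1\Sigma\big(2(r^2+a^2)T+\Delta\,\partial_r+2aZ\big),$$ $$e_1=\tfrac1\Sigma\big(a^2\sin\theta\cos\theta\,T+r\,\partial_\theta+\tfrac{a\cos\theta}{\sin\theta}Z\big),\qquad e_2=\tfrac1\Sigma\big(ar\sin\theta\,T-a\cos\theta\,\partial_\theta+\tfrac{r}{\sin\theta}Z\big).$$ Let $F$ be a real two-form, smooth up to and including $\mathcal H^+$, solving the Maxwell equations $dF=0$, $d\star F=0$ on $\mathcal M$ (or only on the part of $\mathcal M$ where $(v,r)$ lies in an open set $W$). Put $\rho=\frac12F(e_3,e_4)$, $\sigma=F(e_1,e_2)$, $\underline\alpha(e_A)=F(e_A,e_3)$,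 $$\hat\rho=(r^2-a^2\cos^2\theta)\rho-2ar\cos\theta\,\sigma,\qquad \hat\sigma=2ar\cos\theta\,\rho+(r^2-a^2\cos^2\theta)\sigma,\qquad \Upsilon^{[0]}=-\hat\rho+i\hat\sigma,$$ $$\Delta^{-1}\alpha^{[-1]}=\frac{\kappa^2}{\sqrt2\,\Sigma}\big(\underline\alpha(e_1)-i\underline\alpha(e_2)\big),\qquad \tilde\varphi_0^{[-1]}=\sqrt{r^2+a^2}\,\Delta^{-1}\alpha^{[-1]},\qquad \Phi^{[-1]}=\frac{r^2+a^2}{\Delta}\,\Sigma\, e_4\Big(\frac{\Delta}{r^2+a^2}\tilde\varphi_0^{[-1]}\Big),$$ the last one extended smoothly to $\mathcal H^+$. Assume axisymmetry in the form $Z\alpha^{[-1]}=0$. Write $\Upsilon_0=\frac1{\sqrt{4\pi}}\int\Upsilon^{[0]}d\Omega$, and, for $L\ge1$, $f_L=\int f\,S^{[-1]}_{0,L}\,d\Omega$ for functions $f$ (in particular $\tilde\varphi_{0,L}$, $\Phi_L$ and $(e_4\Phi)_L$), the integrals being over the spheres of constant $(v,r)$ with $d\Omega=\sin\theta\,d\theta\,d\phi$.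 Here $S^{[-1]}_{0,L}=\frac1{\sqrt{L(L+1)}}\,\partial_\theta\big(\sqrt{\tfrac{2L+1}{4\pi}}\,P_L(\cos\theta)\big)$ are the normalised $m=0$ spin-weighted spherical harmonics. **Theorem.** All the derivatives of spherical means and mode components below exist, and the following hold along $\mathcal H^+$. 1. *(Pointwise.)* $$e_3\Upsilon^{[0]}=\frac1M\Big(\partial_\theta-\frac{2ia\sin\theta}{M-ia\cos\theta}+\cot\theta\Big)\big((M-ia\cos\theta)\tilde\varphi_0\big)+\frac{(M\cos\theta+ia)\sin\theta}{4M^2}\,\Phi .$$ 2. *(Spherical mean.)* $$e_3\Upsilon_0=-\frac{1}{2\sqrt{30}\,M}\Big(\frac{ia}{M}\sqrt5\,\Phi_1+\Phi_2\Big)+\frac{2ia}{M}\sqrt{\tfrac23}\;\tilde\varphi_{0,1}.$$ 3. *(Teukolsky equation on $\mathcal H^+$.)* With $\mathring{\triangle}^{[-1]}=-\frac1{\sin\theta}\partial_\theta(\sin\theta\,\partial_\theta)-\frac1{\sin^2\theta}Z^2+\frac{2i\cos\theta}{\sin^2\theta}Z+\cot^2\theta$, $$(\mathring{\triangle}^{[-1]}+1)\tilde\varphi_0=-e_3\Phi+\tfrac1{16}\sin^2\theta(1+\cos^2\theta)\,e_4\Phi+\frac{ia\cos\theta}{2M^2}\Phi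 .$$ 4. *(Its modes.)* For every $L\ge1$, with $3j$-symbols (the sum has finitely many non-zero terms), $$\tilde\varphi_{0,L}=-\frac{e_3\Phi_L}{L(L+1)}+\frac{(e_4\Phi)_L}{20L(L+1)}+\frac12\sum_{L'\ge1}\frac{\sqrt{(2L+1)(2L'+1)}}{L(L+1)}\Big\{\tfrac1{35}W_4\,(e_4\Phi)_{L'}+\tfrac1{14}W_2\,(e_4\Phi)_{L'}-\frac{ia}{M^2}W_1\,\Phi_{L'}\Big\},$$ where $W_J=\begin{pmatrix}L&L'&J\\0&0&0\end{pmatrix}\begin{pmatrix}L&L'&J\\-1&1&0\end{pmatrix}$. 5. Hence $e_3\Upsilon_0$ is determined by $\Phi^{[-1]}$ alone: $$e_3\Upsilon_0=-\frac{ia}{2\sqrt6M^2}\Phi_1-\frac{3}{2\sqrt{30}M}\Phi_2+\frac{2ia}{\sqrt6M}\Big(-e_3\Phi_1+\tfrac15T\Phi_1-\tfrac{\sqrt{14}}{70}T\Phi_3\Big).$$ 6. *(Aretakis-type conservation law for the spin $-1$ Teukolsky field.)* The charge $$H=-4M^2e_3\tilde\varphi_{0,1}+4M\tilde\varphi_{0,1}+\frac{2ia}{\sqrt5}\tilde\varphi_{0,2}+\tfrac15\Phi_1-\tfrac{\sqrt{14}}{70}\Phi_3$$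 is constant along $\mathcal H^+$ (along every horizon interval $[v_1,v_2]\times\{M\}\subset W$). 7. *(Induced conservation law for the middle Maxwell components.)* The charge $$K=e_3e_3\Upsilon_0-\frac{1}{2M}e_3\Upsilon_0-\frac{2ia}{\sqrt6M}\Big[\frac{3\tilde\varphi_{0,1}}{2M}+\frac{3ia\,\tilde\varphi_{0,2}}{2\sqrt5M^2}-\frac{e_3\Phi_1}{4M}+\frac{ia}{4\sqrt5M^2}\Big(e_3\Phi_2+\frac{\Phi_2}{M}\Big)+\frac{\Phi_1}{10M^2}-\frac{\sqrt{14}\,\Phi_3}{140M^2}\Big]$$ satisfies $K=-\frac{ia}{\sqrt6M^3}H$, and is therefore also constant along $\mathcal H^+$. -/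

import Mathlib

open Real Set

noncomputable section

namespace KerrMaxwell

/-! ### The extremal Kerr exterior

The exterior of extremal Kerr (`a ^ 2 = M ^ 2`, so `r₊ = r₋ = M`) is `ℝ × [M, ∞) × 𝕊²`. It is realised as the
subset `{(v, x) : M ≤ |x|}` of `ℝ × ℝ³ = (Fin 4 → ℝ)`, and `q = (v, r, θ, φ) : Fin 4 → ℝ` are the (ingoing)
Kerr coordinates on it, which are regular at the future event horizon `r = M`.
The future event horizon is part of the manifold (it is its boundary). -/

/-- The point with Kerr coordinates `q = (v, r, θ, φ)`. -/
def pt (q : Fin 4 → ℝ) : Fin 4 → ℝ :=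
  ![q 0, q 1 * sin (q 2) * cos (q 3), q 1 * sin (q 2) * sin (q 3), q 1 * cos (q 2)]

/-- The coordinate vector fields `∂_v, ∂_r, ∂_θ, ∂_φ` at the point `pt q`. -/
def coordVec (q : Fin 4 → ℝ) : Fin 4 → (Fin 4 → ℝ) :=
  ![![1, 0, 0, 0],
    ![0, sin (q 2) * cos (q 3), sin (q 2) * sin (q 3), cos (q 2)],
    ![0, q 1 * cos (q 2) * cos (q 3), q 1 * cos (q 2) * sin (q 3), - (q 1 * sin (q 2))],
    ![0, - (q 1 * sin (q 2) * sin (q 3)), q 1 * sin (q 2) * cos (q 3), 0]]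

/-- The area radius-like coordinate `r = |x|` of a point `(v, x)`. -/
def radius (p : Fin 4 → ℝ) : ℝ := √(p 1 ^ 2 + p 2 ^ 2 + p 3 ^ 2)

/-- The part of the exterior `{M ≤ r}` whose coordinates `(v, r)` lie in `W`. For `W` open this is a relatively
open, spherically symmetric piece of the exterior; `W = univ` gives the whole exterior. -/
def region (M : ℝ) (W : Set (ℝ × ℝ)) : Set (Fin 4 → ℝ) :=
  {p | M ≤ radius p ∧ (p 0, radius p) ∈ W}

/-- The same piece in Kerr coordinates, away from the axis. -/
def chart (M : ℝ) (W : Set (ℝ × ℝ)) : Set (Fin 4 → ℝ) :=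
  {q | M ≤ q 1 ∧ (q 0, q 1) ∈ W ∧ q 2 ∈ Ioo 0 π}

/-- The part of the future event horizon `r = M` in `region M W`, in Kerr coordinates, away from the axis. -/
def horizon (M : ℝ) (W : Set (ℝ × ℝ)) : Set (Fin 4 → ℝ) :=
  {q | q 1 = M ∧ (q 0, M) ∈ W ∧ q 2 ∈ Ioo 0 π}

section Derivatives

variable {E : Type*} [NormedAddCommGroup E] [NormedSpace ℝ E]

/-- The partial derivative `∂_i f` in Kerr coordinates, on the exterior `{M ≤ r}` (so `∂_r` is one-sided at the
horizon, and every other derivative is two-sided). -/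
def pd (M : ℝ) (i : Fin 4) (f : (Fin 4 → ℝ) → E) (q : Fin 4 → ℝ) : E :=
  derivWithin (fun s => f (Function.update q i s)) {s | M ≤ Function.update q i s 1} (q i)

/-- The partial derivative `∂_i f` exists at `q`, in the sense of `pd`. -/
def HasPd (M : ℝ) (i : Fin 4) (f : (Fin 4 → ℝ) → E) (q : Fin 4 → ℝ) : Prop :=
  DifferentiableWithinAt ℝ (fun s => f (Function.update q i s)) {s | M ≤ Function.update q i s 1} (q i)

/-- The derivative of `f` along the vector field `X` (given by its components in Kerr coordinates). -/
def along (M : ℝ) (X : (Fin 4 → ℝ) → (Fin 4 → ℝ)) (f : (Fin 4 → ℝ) → E) (q : Fin 4 → ℝ) : E :=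
  ∑ i, X q i • pd M i f q

end Derivatives

/-! ### The Kerr metric and the algebraically special frame -/

/-- `Σ = r² + a² cos² θ`. -/
def Sig (a : ℝ) (q : Fin 4 → ℝ) : ℝ := q 1 ^ 2 + a ^ 2 * cos (q 2) ^ 2

/-- `Δ = r² - 2 M r + a²`. -/
def Del (M a : ℝ) (q : Fin 4 → ℝ) : ℝ := q 1 ^ 2 - 2 * M * q 1 + a ^ 2

/-- `κ = r - i a cos θ`. -/
def kap (a : ℝ) (q : Fin 4 → ℝ) : ℂ := (q 1 : ℂ) - Complex.I * a * cos (q 2)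

/-- The Kerr metric in Kerr coordinates `(v, r, θ, φ)`. -/
def metric (M a : ℝ) (q : Fin 4 → ℝ) : Matrix (Fin 4) (Fin 4) ℝ :=
  !![-(1 - 2 * M * q 1 / Sig a q), 1, 0, -(2 * a * M * q 1 / Sig a q * sin (q 2) ^ 2);
     1, 0, 0, -(a * sin (q 2) ^ 2);
     0, 0, Sig a q, 0;
     -(2 * a * M * q 1 / Sig a q * sin (q 2) ^ 2), -(a * sin (q 2) ^ 2), 0,
       ((q 1 ^ 2 + a ^ 2) ^ 2 - Del M a q * a ^ 2 * sin (q 2) ^ 2) / Sig a q * sin (q 2) ^ 2]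

/-- `e₁ = (a² sin θ cos θ / Σ) ∂_t + (r / Σ) ∂_θ + (a cos θ / (Σ sin θ)) ∂_φ`. -/
def e1 (a : ℝ) (q : Fin 4 → ℝ) : Fin 4 → ℝ :=
  ![a ^ 2 * sin (q 2) * cos (q 2) / Sig a q, 0, q 1 / Sig a q, a * cos (q 2) / (Sig a q * sin (q 2))]

/-- `e₂ = (a r sin θ / Σ) ∂_t - (a cos θ / Σ) ∂_θ + (r / (Σ sin θ)) ∂_φ`. -/
def e2 (a : ℝ) (q : Fin 4 → ℝ) : Fin 4 → ℝ :=
  ![a * q 1 * sin (q 2) / Sig a q, 0, -(a * cos (q 2) / Sig a q), q 1 / (Sig a q * sin (q 2))]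

/-- The null vector field `e₃`. In Boyer-Lindquist coordinates
`e₃ = ((r² + a²) / Δ) ∂_t - ∂_r + (a / Δ) ∂_φ`, which in Kerr coordinates (`dv = dt + ((r² + a²) / Δ) dr`,
`dφ = dφ_BL + (a / Δ) dr`) is `- ∂_r`; it is transversal to the horizon. -/
def e3 (_q : Fin 4 → ℝ) : Fin 4 → ℝ := ![0, -1, 0, 0]

/-- The null vector field `e₄`. In Boyer-Lindquist coordinates
`e₄ = ((r² + a²) / Σ) ∂_t + (Δ / Σ) ∂_r + (a / Σ) ∂_φ`. -/
def e4 (M a : ℝ) (q : Fin 4 → ℝ) : Fin 4 → ℝ :=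
  ![2 * (q 1 ^ 2 + a ^ 2) / Sig a q, Del M a q / Sig a q, 0, 2 * a / Sig a q]

/-! ### Maxwell fields -/

/-- Two-forms on (subsets of) `ℝ × ℝ³`. -/
abbrev TwoForm : Type := (Fin 4 → ℝ) → (Fin 4 → ℝ) [⋀^Fin 2]→L[ℝ] ℝ

/-- `F (X, Y)` at `pt q`, for vectors `X`, `Y` given by their components in Kerr coordinates. -/
def evalOn (F : TwoForm) (q X Y : Fin 4 → ℝ) : ℝ :=
  F (pt q) ![∑ i, X i • coordVec q i, ∑ i, Y i • coordVec q i]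

/-- The components `F_{ij}` in Kerr coordinates. -/
def lower (F : TwoForm) (i j : Fin 4) (q : Fin 4 → ℝ) : ℝ :=
  F (pt q) ![coordVec q i, coordVec q j]

/-- The components `F^{ij} = g^{ik} g^{jl} F_{kl}` in Kerr coordinates. -/
def upper (M a : ℝ) (F : TwoForm) (i j : Fin 4) (q : Fin 4 → ℝ) : ℝ :=
  ∑ k, ∑ l, (metric M a q)⁻¹ i k * (metric M a q)⁻¹ j l * lower F k l q

/-- `F` is a smooth (up to and including the horizon) solution of the source-free Maxwell equations `dF = 0`,
`d ⋆ F = 0` on `region M W`. In Kerr coordinates, which cover the complement of the axis, the equations read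
`∂_i F_{jk} + ∂_j F_{ki} + ∂_k F_{ij} = 0` and `∂_j (√|det g| F^{ij}) = 0`; on the axis they hold by continuity. -/
structure IsMaxwellField (M a : ℝ) (W : Set (ℝ × ℝ)) (F : TwoForm) : Prop where
  smooth : ContDiffOn ℝ (⊤ : ℕ∞) F (region M W)
  closed : ∀ q ∈ chart M W, ∀ i j k : Fin 4,
    pd M i (lower F j k) q + pd M j (lower F k i) q + pd M k (lower F i j) q = 0
  coclosed : ∀ q ∈ chart M W, ∀ i : Fin 4,
    ∑ j, pd M j (fun p => √|(metric M a p).det| * upper M a F i j p) q = 0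

/-! ### Maxwell components -/

/-- `ρ = ½ F(e₃, e₄)`. -/
def rho (M a : ℝ) (F : TwoForm) (q : Fin 4 → ℝ) : ℝ := evalOn F q (e3 q) (e4 M a q) / 2

/-- `σ = ½ ε^{AB} F(e_A, e_B) = F(e₁, e₂)`. -/
def sigma (a : ℝ) (F : TwoForm) (q : Fin 4 → ℝ) : ℝ := evalOn F q (e1 a q) (e2 a q)

/-- `ρ̂ = (r² - a² cos² θ) ρ - 2 a r cos θ σ`. -/
def rhoHat (M a : ℝ) (F : TwoForm) (q : Fin 4 → ℝ) : ℝ :=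
  (q 1 ^ 2 - a ^ 2 * cos (q 2) ^ 2) * rho M a F q - 2 * a * q 1 * cos (q 2) * sigma a F q

/-- `σ̂ = 2 a r cos θ ρ + (r² - a² cos² θ) σ`. -/
def sigmaHat (M a : ℝ) (F : TwoForm) (q : Fin 4 → ℝ) : ℝ :=
  2 * a * q 1 * cos (q 2) * rho M a F q + (q 1 ^ 2 - a ^ 2 * cos (q 2) ^ 2) * sigma a F q

/-- `Υ^{[0]} = - ρ̂ + i σ̂`. -/
def Ups (M a : ℝ) (F : TwoForm) (q : Fin 4 → ℝ) : ℂ :=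
  -(rhoHat M a F q : ℂ) + Complex.I * sigmaHat M a F q

/-- The smooth spin `-1` Teukolsky field
`Δ⁻¹ α^{[-1]} = (κ² / (√2 Σ)) (α̲(e₁) - i α̲(e₂))`, where `α̲(e_A) = F(e_A, e₃)`. -/
def alphaNeg (a : ℝ) (F : TwoForm) (q : Fin 4 → ℝ) : ℂ :=
  kap a q ^ 2 / ((√2 * Sig a q : ℝ) : ℂ) *
    ((evalOn F q (e1 a q) (e3 q) : ℂ) - Complex.I * evalOn F q (e2 a q) (e3 q))

/-- `φ̃₀^{[-1]} = √(r² + a²) Δ⁻¹ α^{[-1]}`. -/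
def phi0 (a : ℝ) (F : TwoForm) (q : Fin 4 → ℝ) : ℂ :=
  ((√(q 1 ^ 2 + a ^ 2) : ℝ) : ℂ) * alphaNeg a F q

/-- The smooth extension up to the horizon of the operator
`f ↦ ((r² + a²) / Δ) Σ e₄ (Δ / (r² + a²) f)`; see `transform_eq`. -/
def transform (M a : ℝ) (f : (Fin 4 → ℝ) → ℂ) (q : Fin 4 → ℝ) : ℂ :=
  (Sig a q : ℂ) * along M (e4 M a) f q +
    ((2 * (q 1 - M) - 2 * q 1 * Del M a q / (q 1 ^ 2 + a ^ 2) : ℝ) : ℂ) * f q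

/-- `Φ^{[-1]} = ((r² + a²) / Δ) Σ e₄ (φ₀^{[-1]})`, with
`φ₀^{[-1]} = α^{[-1]} / √(r² + a²) = (Δ / (r² + a²)) φ̃₀^{[-1]}`, extended smoothly to the horizon. -/
def Phi (M a : ℝ) (F : TwoForm) : (Fin 4 → ℝ) → ℂ := transform M a (phi0 a F)

/-- Away from the horizon, `transform` is `f ↦ ((r² + a²) / Δ) Σ e₄ (Δ / (r² + a²) f)`. -/
theorem transform_eq {M a : ℝ} {f : (Fin 4 → ℝ) → ℂ} {q : Fin 4 → ℝ} (hM : 0 < M) (hq : M ≤ q 1)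
    (hD : Del M a q ≠ 0) (hS : Sig a q ≠ 0) (hf : HasPd M 1 f q) :
    transform M a f q =
      (((q 1 ^ 2 + a ^ 2) / Del M a q * Sig a q : ℝ) : ℂ) *
        along M (e4 M a) (fun p => ((Del M a p / (p 1 ^ 2 + a ^ 2) : ℝ) : ℂ) * f p) q := by
  have hR : q 1 ^ 2 + a ^ 2 ≠ 0 := by nlinarith [sq_nonneg a, mul_pos hM hM]
  have hconst : ∀ i : Fin 4, i ≠ 1 →
      pd M i (fun p => ((Del M a p / (p 1 ^ 2 + a ^ 2) : ℝ) : ℂ) * f p) q =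
        ((Del M a q / (q 1 ^ 2 + a ^ 2) : ℝ) : ℂ) * pd M i f q := by
    intro i hi
    simp only [pd, Del, Function.update_of_ne hi.symm]
    rw [derivWithin_const_mul_field]
  have hd : HasDerivAt (fun s : ℝ => (s ^ 2 - 2 * M * s + a ^ 2) / (s ^ 2 + a ^ 2))
      (((2 * q 1 - 2 * M) * (q 1 ^ 2 + a ^ 2) - Del M a q * (2 * q 1)) / (q 1 ^ 2 + a ^ 2) ^ 2) (q 1) := by
    have h1 : HasDerivAt (fun s : ℝ => s ^ 2 - 2 * M * s + a ^ 2) (2 * q 1 - 2 * M) (q 1) := by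
      simpa using (((hasDerivAt_pow 2 (q 1)).sub ((hasDerivAt_id (q 1)).const_mul (2 * M))).add_const (a ^ 2))
    have h2 : HasDerivAt (fun s : ℝ => s ^ 2 + a ^ 2) (2 * q 1) (q 1) := by
      simpa using ((hasDerivAt_pow 2 (q 1)).add_const (a ^ 2))
    exact h1.div h2 hR
  have hset : {s : ℝ | M ≤ Function.update q 1 s 1} = Ici M := by ext s; simp
  have hr : pd M 1 (fun p => ((Del M a p / (p 1 ^ 2 + a ^ 2) : ℝ) : ℂ) * f p) q =
      (((((2 * q 1 - 2 * M) * (q 1 ^ 2 + a ^ 2) - Del M a q * (2 * q 1)) / (q 1 ^ 2 + a ^ 2) ^ 2 : ℝ)) : ℂ) * f q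
        + ((Del M a q / (q 1 ^ 2 + a ^ 2) : ℝ) : ℂ) * pd M 1 f q := by
    have hf' := hf.hasDerivWithinAt
    have hc := (hd.ofReal_comp.hasDerivWithinAt (s := {s : ℝ | M ≤ Function.update q 1 s 1})).mul hf'
    have hu : UniqueDiffWithinAt ℝ {s : ℝ | M ≤ Function.update q 1 s 1} (q 1) := by
      rw [hset]; exact uniqueDiffOn_Ici M _ hq
    have := hc.derivWithin hu
    simp only [Function.update_eq_self] at this
    simp only [pd, Del, Function.update_self]
    exact this
  simp only [along, transform, Fin.sum_univ_four, hr, hconst 0 (by decide), hconst 2 (by decide),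
    hconst 3 (by decide)]
  simp only [e4, Matrix.cons_val, Complex.real_smul]
  have hD' : (Del M a q : ℂ) ≠ 0 := by exact_mod_cast hD
  have hS' : (Sig a q : ℂ) ≠ 0 := by exact_mod_cast hS
  have hR' : ((q 1 : ℂ) ^ 2 + (a : ℂ) ^ 2) ≠ 0 := by exact_mod_cast hR
  push_cast
  field_simp
  ring

/-! ### Spheres, spin-weighted harmonics and modes -/

/-- `∫ f dΩ` over the sphere of the given `(v, r)`, as a function on the exterior. -/
def sphereInt (f : (Fin 4 → ℝ) → ℂ) (q : Fin 4 → ℝ) : ℂ :=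
  ∫ φ in (0 : ℝ)..(2 * π), ∫ θ in (0 : ℝ)..π, f ![q 0, q 1, θ, φ] * (sin θ : ℂ)

/-- The Legendre polynomial `P_L`. -/
def legendre (L : ℕ) : Polynomial ℝ :=
  Polynomial.C (1 / (2 ^ L * (L.factorial : ℝ))) *
    Polynomial.derivative^[L] ((Polynomial.X ^ 2 - 1) ^ L)

/-- The zonal spherical harmonic `S_{0,L}^{[0]} = √((2 L + 1) / (4 π)) P_L(cos θ)`. -/
def harm (L : ℕ) (θ : ℝ) : ℝ := √((2 * L + 1) / (4 * π)) * (legendre L).eval (cos θ)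

/-- The `m = 0` spin `-1` spherical harmonic `S_{0,L}^{[-1]}`, `L ≥ 1`: it is normalised in `L²(dΩ)`, and
`-(∂_θ + cot θ) S_{0,L}^{[-1]} = √(L (L + 1)) S_{0,L}^{[0]}`. -/
def harmNeg (L : ℕ) (θ : ℝ) : ℝ := deriv (harm L) θ / √(L * (L + 1))

/-- The normalised spherical mean `(1 / √(4 π)) ∫ f dΩ`. -/
def mean (f : (Fin 4 → ℝ) → ℂ) (q : Fin 4 → ℝ) : ℂ := ((1 / √(4 * π) : ℝ) : ℂ) * sphereInt f q

/-- The mode component `f_L = ∫ f S_{0,L}^{[-1]} dΩ`. -/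
def mode (L : ℕ) (f : (Fin 4 → ℝ) → ℂ) : (Fin 4 → ℝ) → ℂ :=
  sphereInt (fun p => f p * (harmNeg L (p 2) : ℂ))

/-- The operator `△̊^{[-1]} + 1`, with `△̊^{[-1]}` the spin `-1` spherical Laplacian. -/
def lapNegAddOne (M : ℝ) (f : (Fin 4 → ℝ) → ℂ) (q : Fin 4 → ℝ) : ℂ :=
  -(1 / (sin (q 2) : ℂ)) * pd M 2 (fun p => (sin (p 2) : ℂ) * pd M 2 f p) q
    - 1 / (sin (q 2) : ℂ) ^ 2 * pd M 3 (pd M 3 f) q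
    + 2 * Complex.I * (cos (q 2) : ℂ) / (sin (q 2) : ℂ) ^ 2 * pd M 3 f q
    + ((cos (q 2) : ℂ) / (sin (q 2) : ℂ)) ^ 2 * f q + f q

/-! ### Wigner 3j-symbols (integer spins), through the Racah formula -/

/-- The factorial of a nonnegative integer, as a real number. -/
def fac (z : ℤ) : ℝ := (z.toNat.factorial : ℝ)

/-- The summand of the Racah formula; it is zero unless all the factorials are of nonnegative integers. -/
def racahTerm (j₁ j₂ j₃ m₁ m₂ t : ℤ) : ℝ :=
  if 0 ≤ t ∧ 0 ≤ j₃ - j₂ + t + m₁ ∧ 0 ≤ j₃ - j₁ + t - m₂ ∧ 0 ≤ j₁ + j₂ - j₃ - t ∧ 0 ≤ j₁ - t - m₁ ∧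
      0 ≤ j₂ - t + m₂ then
    (-1) ^ t / (fac t * fac (j₃ - j₂ + t + m₁) * fac (j₃ - j₁ + t - m₂) * fac (j₁ + j₂ - j₃ - t) *
      fac (j₁ - t - m₁) * fac (j₂ - t + m₂))
  else 0

/-- The 3j-symbol with upper row `j₁ j₂ j₃` and lower row `m₁ m₂ m₃`. -/
def threeJ (j₁ j₂ j₃ : ℕ) (m₁ m₂ m₃ : ℤ) : ℝ :=
  if m₁ + m₂ + m₃ = 0 ∧ |m₁| ≤ j₁ ∧ |m₂| ≤ j₂ ∧ |m₃| ≤ j₃ ∧ j₃ ≤ j₁ + j₂ ∧ j₁ ≤ j₂ + j₃ ∧ j₂ ≤ j₁ + j₃ then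
    (-1) ^ ((j₁ : ℤ) - j₂ - m₃) *
      √(fac (j₁ + j₂ - j₃) * fac (j₁ - j₂ + j₃) * fac (-j₁ + j₂ + j₃) / fac (j₁ + j₂ + j₃ + 1)) *
      √(fac (j₁ + m₁) * fac (j₁ - m₁) * fac (j₂ + m₂) * fac (j₂ - m₂) * fac (j₃ + m₃) * fac (j₃ - m₃)) *
      ∑ t ∈ Finset.range (j₁ + j₂ + 1), racahTerm j₁ j₂ j₃ m₁ m₂ t
  else 0

/-- The product of 3j-symbols with upper row `L L' J` and lower rows `0 0 0` and `-1 +1 0`. -/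
def threeJProd (L L' J : ℕ) : ℝ := threeJ L L' J 0 0 0 * threeJ L L' J (-1) 1 0

/-! ### The horizon charges -/

/-- The charge of the spin `-1` Teukolsky field on the horizon sphere through `q`:
`- 4 M² e₃(φ̃_{0,1}) + 4 M φ̃_{0,1} + (2 i a / √5) φ̃_{0,2} + Φ_1 / 5 - (√14 / 70) Φ_3`. -/
def teukolskyCharge (M a : ℝ) (F : TwoForm) (q : Fin 4 → ℝ) : ℂ :=
  -4 * (M : ℂ) ^ 2 * along M e3 (mode 1 (phi0 a F)) q + 4 * M * mode 1 (phi0 a F) q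
    + 2 * Complex.I * a / (√5 : ℝ) * mode 2 (phi0 a F) q
    + 1 / 5 * mode 1 (Phi M a F) q - (√14 : ℝ) / 70 * mode 3 (Phi M a F) q

/-- The charge of the middle Maxwell components on the horizon sphere through `q`: the second transversal derivative
`e₃ e₃ Υ₀` of the spherical mean `Υ₀` of `Υ^{[0]}`, corrected by
`- (1 / (2 M)) e₃ Υ₀ - (2 i a / (√6 M)) [ (3 / (2 M)) φ̃_{0,1} + (3 i a / (2 √5 M²)) φ̃_{0,2} - (1 / (4 M)) e₃ Φ_1
 + (i a / (4 √5 M²)) (e₃ Φ_2 + Φ_2 / M) + (1 / (10 M²)) Φ_1 - (√14 / (140 M²)) Φ_3 ]`. -/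
def middleCharge (M a : ℝ) (F : TwoForm) (q : Fin 4 → ℝ) : ℂ :=
  along M e3 (along M e3 (mean (Ups M a F))) q - 1 / (2 * M) * along M e3 (mean (Ups M a F)) q
    - 2 * Complex.I * a / ((√6 : ℝ) * M) *
      (3 / (2 * M) * mode 1 (phi0 a F) q
        + 3 * Complex.I * a / (2 * (√5 : ℝ) * (M : ℂ) ^ 2) * mode 2 (phi0 a F) q
        - 1 / (4 * M) * along M e3 (mode 1 (Phi M a F)) q
        + Complex.I * a / (4 * (√5 : ℝ) * (M : ℂ) ^ 2) *
          (along M e3 (mode 2 (Phi M a F)) q + 1 / M * mode 2 (Phi M a F) q)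
        + 1 / (10 * (M : ℂ) ^ 2) * mode 1 (Phi M a F) q
        - (√14 : ℝ) / (140 * (M : ℂ) ^ 2) * mode 3 (Phi M a F) q)

end KerrMaxwell

end

open KerrMaxwell

/-! Write ψ = √2 Δ⁻¹α (`core`). In null components Maxwell's equations contain two complex
first-order equations coupling Υ to ψ. One expresses ∂_r Υ through ∂_θ ψ, Tψ and ψ
(`pd_one_upsReg_eq_transversal`); the other expresses (∂_θ - i(a sin θ T + Z / sin θ))Υ through Tψ,
Δ∂_r ψ and ψ (`pd_two_upsReg_eq`). Multiplying by κ/κ̄, that is passing from Σ(-ρ + iσ) to Υ,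
removes every undifferentiated middle component from both. On the horizon Φ = 4M² T φ̃₀, and the
first equation becomes the pointwise formula.

Differentiating the second equation in r and eliminating ∂_r Υ with the first gives a second-order
equation for ψ alone. In the extremal case Δ and ∂_r Δ both vanish at r = M, so ∂_r²ψ drops out
(`core_teukolsky`); regrouping the T-derivatives into Φ gives the Teukolsky equation on the horizon
(`phiReg_teukolsky`).

Integrating the first equation over a sphere and integrating by parts in θ leaves only the moments
of ψ against sin θ and sin θ cos θ, that is the modes L = 1, 2 (`moment_pd_one_upsReg`). This holds
at every radius, so it can be differentiated again in r. Pairing the Teukolsky equation with a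
harmonic replaces the spherical operator by L(L+1) (`moment_zonal_laplacian`), while multiplication
by cos θ and by sin²θ(1 + cos²θ) becomes a banded matrix in L.

The conservation law is a coincidence of two constants. On the horizon ∂_r Φ is a T-derivative plus
2φ̃₀ (`pd_one_PhiReg_horizon`), and the eigenvalue L(L+1) at L = 1 is also 2. The undifferentiated
φ̃₀ therefore cancels from the L = 1 equation, and what is left is T of a charge
(`hasPartial_momentCharge`). The charge K is proportional to H by algebra alone, once e₃e₃Υ₀ is
written in moments (`middleCharge_eq`).

For the 3j form of the mode equation, Racah's sum is reindexed so that its length depends only on J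
and L' - L. Its value is then an explicit rational function of L for each J ≤ 4, and these values
are matched with the coefficients obtained from the three-term recurrence of P_L' (`transfer_one`,
`transfer_two`, `transfer_four`, `quartic_mul_zonal`). -/

noncomputable section

namespace KerrMaxwell

open Function (update)
open scoped ContDiff

/-! ### Calculus in Kerr coordinates -/

/-- The part of the exterior with `(v, r) ∈ W`, in Kerr coordinates, with unrestricted angles. -/
def dom (M : ℝ) (W : Set (ℝ × ℝ)) : Set (Fin 4 → ℝ) := {q | M ≤ q 1 ∧ (q 0, q 1) ∈ W}

/-- Smoothness up to and including the horizon, and across the axis. -/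
def Smooth {E : Type*} [NormedAddCommGroup E] [NormedSpace ℝ E] (M : ℝ) (W : Set (ℝ × ℝ))
    (f : (Fin 4 → ℝ) → E) : Prop := ContDiffOn ℝ ∞ f (dom M W)

/-- `f` has the partial derivative `f'` in the `i`-th coordinate at `q`, in the sense of `pd`. -/
def HasPartial {E : Type*} [NormedAddCommGroup E] [NormedSpace ℝ E] (M : ℝ) (i : Fin 4)
    (f : (Fin 4 → ℝ) → E) (f' : E) (q : Fin 4 → ℝ) : Prop :=
  HasDerivWithinAt (fun s => f (update q i s)) f' {s | M ≤ update q i s 1} (q i)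

set_option linter.unusedSectionVars false

variable {E : Type*} [NormedAddCommGroup E] [NormedSpace ℝ E] {M : ℝ} {W : Set (ℝ × ℝ)}
  {i j : Fin 4} {q : Fin 4 → ℝ}

theorem chart_subset_dom : chart M W ⊆ dom M W := fun _ h => ⟨h.1, h.2.1⟩

theorem horizon_subset_chart : horizon M W ⊆ chart M W := by
  rintro q ⟨h1, h2, h3⟩
  exact ⟨h1.ge, by rwa [h1], h3⟩

theorem slice_one : {s : ℝ | M ≤ update q 1 s 1} = Ici M := by ext s; simp

theorem slice_of_ne (hi : i ≠ 1) (hq : M ≤ q 1) : {s : ℝ | M ≤ update q i s 1} = univ := by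
  ext s; simp [Function.update_of_ne hi.symm, hq]

theorem uniqueDiffOn_slice (hq : M ≤ q 1) : UniqueDiffOn ℝ {s : ℝ | M ≤ update q i s 1} := by
  by_cases hi : i = 1
  · subst hi; rw [slice_one]; exact uniqueDiffOn_Ici M
  · rw [slice_of_ne hi hq]; exact uniqueDiffOn_univ

theorem mem_slice (hq : M ≤ q 1) : q i ∈ {s : ℝ | M ≤ update q i s 1} := by simpa using hq

theorem HasPartial.pd_eq {f : (Fin 4 → ℝ) → E} {f' : E} (h : HasPartial M i f f' q) (hq : M ≤ q 1) :
    pd M i f q = f' :=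
  HasDerivWithinAt.derivWithin h (uniqueDiffOn_slice hq _ (mem_slice hq))

theorem HasPartial.hasPd {f : (Fin 4 → ℝ) → E} {f' : E} (h : HasPartial M i f f' q) : HasPd M i f q :=
  HasDerivWithinAt.differentiableWithinAt h

theorem HasPd.hasPartial {f : (Fin 4 → ℝ) → E} (h : HasPd M i f q) : HasPartial M i f (pd M i f q) q :=
  DifferentiableWithinAt.hasDerivWithinAt h

theorem isOpen_coords (hW : IsOpen W) : IsOpen {q : Fin 4 → ℝ | (q 0, q 1) ∈ W} :=
  hW.preimage (by fun_prop)

theorem dom_eq : dom M W = {q | M ≤ q 1} ∩ {q | (q 0, q 1) ∈ W} := rfl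

theorem interior_halfSpace : interior {q : Fin 4 → ℝ | M ≤ q 1} = {q | M < q 1} := by
  have := (isOpenMap_eval (X := fun _ : Fin 4 => ℝ) 1).preimage_interior_eq_interior_preimage
    (continuous_apply 1) (Ici M)
  rw [interior_Ici] at this
  exact this.symm

theorem convex_halfSpace : Convex ℝ {q : Fin 4 → ℝ | M ≤ q 1} :=
  (convex_Ici M).linear_preimage (LinearMap.proj (R := ℝ) (φ := fun _ : Fin 4 => ℝ) 1)

theorem interior_halfSpace_nonempty : (interior {q : Fin 4 → ℝ | M ≤ q 1}).Nonempty := by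
  rw [interior_halfSpace]; exact ⟨fun _ => M + 1, by simp⟩

theorem uniqueDiffOn_dom (hW : IsOpen W) : UniqueDiffOn ℝ (dom M W) := by
  rw [dom_eq]
  exact (uniqueDiffOn_convex convex_halfSpace interior_halfSpace_nonempty).inter (isOpen_coords hW)

/-- Second derivatives within a set are symmetric at points in the closure of its interior; this is
what makes partial derivatives commute on the horizon, a boundary of `dom`. -/
theorem dom_subset_closure_interior (hW : IsOpen W) : dom M W ⊆ closure (interior (dom M W)) := by
  intro q hq
  rw [dom_eq, interior_inter, (isOpen_coords hW).interior_eq]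
  have h : q ∈ closure (interior {q : Fin 4 → ℝ | M ≤ q 1}) := by
    rw [convex_halfSpace.closure_interior_eq_closure_of_nonempty_interior interior_halfSpace_nonempty]
    exact subset_closure hq.1
  exact mem_closure_inter_open_of h hq.2 (isOpen_coords hW)
where
  mem_closure_inter_open_of {A B : Set (Fin 4 → ℝ)} {q : Fin 4 → ℝ} (h : q ∈ closure A) (hB : q ∈ B)
      (ho : IsOpen B) : q ∈ closure (A ∩ B) := by
    have := ho.inter_closure (s := B) (t := A) ⟨hB, h⟩
    rwa [inter_comm] at this

/-- Since `W` is open, the only constraint that can be active along a coordinate line is M ≤ r,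
which is the one built into `pd`. -/
theorem slice_mem_dom (hW : IsOpen W) (hq : q ∈ dom M W) :
    {s | update q i s ∈ dom M W} ∈ nhdsWithin (q i) {s : ℝ | M ≤ update q i s 1} := by
  have hc : Continuous (fun s : ℝ => update q i s) := continuous_const.update i continuous_id
  have ho : {s : ℝ | ((update q i s) 0, (update q i s) 1) ∈ W} ∈ nhds (q i) :=
    ((isOpen_coords hW).preimage hc).mem_nhds (by simpa using hq.2)
  filter_upwards [mem_nhdsWithin_of_mem_nhds ho, self_mem_nhdsWithin] with s h1 h2 using ⟨h2, h1⟩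

theorem slice_mem_chart (hW : IsOpen W) (hq : q ∈ chart M W) :
    {s | update q i s ∈ chart M W} ∈ nhdsWithin (q i) {s : ℝ | M ≤ update q i s 1} := by
  have hc : Continuous (fun s : ℝ => update q i s) := continuous_const.update i continuous_id
  have ho : {s : ℝ | (update q i s) 2 ∈ Ioo 0 π} ∈ nhds (q i) :=
    ((isOpen_Ioo.preimage (continuous_apply 2)).preimage hc).mem_nhds (by simpa using hq.2.2)
  filter_upwards [mem_nhdsWithin_of_mem_nhds ho, slice_mem_dom hW (chart_subset_dom hq)] with s h1 h2
    using ⟨h2.1, h2.2, h1⟩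

/-- Chain rule along the coordinate line. It identifies `pd`, one-sided or not, with a directional
value of the Fréchet derivative within `dom`, so that smoothness passes from f to `pd M i f`. -/
theorem Smooth.hasPartial_fderivWithin {f : (Fin 4 → ℝ) → E} (hf : Smooth M W f) (hW : IsOpen W)
    (hq : q ∈ dom M W) : HasPartial M i f (fderivWithin ℝ f (dom M W) q (Pi.single i 1)) q := by
  have h1 : HasFDerivWithinAt f (fderivWithin ℝ f (dom M W) q) (dom M W) (update q i (q i)) := by
    rw [Function.update_eq_self]
    exact ((hf q hq).differentiableWithinAt (by simp)).hasFDerivWithinAt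
  have h2 := (hasDerivAt_update q i (q i)).hasDerivWithinAt (s := {s | update q i s ∈ dom M W})
  exact (h1.comp_hasDerivWithinAt (q i) h2 (fun s hs => hs)).mono_of_mem_nhdsWithin (slice_mem_dom hW hq)

theorem Smooth.pd_eq_fderivWithin {f : (Fin 4 → ℝ) → E} (hf : Smooth M W f) (hW : IsOpen W)
    (hq : q ∈ dom M W) : pd M i f q = fderivWithin ℝ f (dom M W) q (Pi.single i 1) :=
  (hf.hasPartial_fderivWithin hW hq).pd_eq hq.1

theorem Smooth.hasPartial {f : (Fin 4 → ℝ) → E} (hf : Smooth M W f) (hW : IsOpen W)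
    (hq : q ∈ dom M W) : HasPartial M i f (pd M i f q) q :=
  (hf.hasPartial_fderivWithin hW hq).hasPd.hasPartial

theorem Smooth.pd {f : (Fin 4 → ℝ) → E} (hf : Smooth M W f) (hW : IsOpen W) (i : Fin 4) :
    Smooth M W (pd M i f) := by
  have h : ContDiffOn ℝ ∞ (fun q => fderivWithin ℝ f (dom M W) q (Pi.single i 1)) (dom M W) :=
    (ContDiffOn.fderivWithin hf (uniqueDiffOn_dom hW) (by simp)).clm_apply contDiffOn_const
  exact h.congr fun q hq => hf.pd_eq_fderivWithin hW hq

theorem eventuallyEq_of_eqOn_chart {f g : (Fin 4 → ℝ) → E} (hW : IsOpen W) (h : EqOn f g (chart M W))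
    (hq : q ∈ chart M W) (i : Fin 4) : (fun s => f (update q i s)) =ᶠ[nhdsWithin (q i)
      {s : ℝ | M ≤ update q i s 1}] fun s => g (update q i s) := by
  filter_upwards [slice_mem_chart hW hq] with s hs using h hs

/-- Being off the axis is an open condition, so an identity known only there can be differentiated
there. This is how expressions with 1 / sin θ are exchanged for versions that are smooth across the
axis. -/
theorem pd_congr {f g : (Fin 4 → ℝ) → E} (hW : IsOpen W) (h : EqOn f g (chart M W)) (i : Fin 4) :
    EqOn (KerrMaxwell.pd M i f) (KerrMaxwell.pd M i g) (chart M W) := fun q hq =>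
  (eventuallyEq_of_eqOn_chart hW h hq i).derivWithin_eq (by simpa using h hq)

theorem eventuallyEq_of_eqOn_dom {f g : (Fin 4 → ℝ) → E} (hW : IsOpen W) (h : EqOn f g (dom M W))
    (hq : q ∈ dom M W) (i : Fin 4) : (fun s => f (update q i s)) =ᶠ[nhdsWithin (q i)
      {s : ℝ | M ≤ update q i s 1}] fun s => g (update q i s) := by
  filter_upwards [slice_mem_dom hW hq] with s hs using h hs

theorem hasPartial_congr_dom {f g : (Fin 4 → ℝ) → E} {f' : E} (hW : IsOpen W) (h : EqOn f g (dom M W))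
    (hq : q ∈ dom M W) (hg : HasPartial M i g f' q) : HasPartial M i f f' q :=
  HasDerivWithinAt.congr_of_eventuallyEq hg (eventuallyEq_of_eqOn_dom hW h hq i) (by simpa using h hq)

theorem hasPartial_congr {f g : (Fin 4 → ℝ) → E} {f' : E} (hW : IsOpen W) (h : EqOn f g (chart M W))
    (hq : q ∈ chart M W) (hg : HasPartial M i g f' q) : HasPartial M i f f' q :=
  HasDerivWithinAt.congr_of_eventuallyEq hg (eventuallyEq_of_eqOn_chart hW h hq i) (by simpa using h hq)

theorem along_congr {f g : (Fin 4 → ℝ) → E} (hW : IsOpen W) (h : EqOn f g (chart M W))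
    (X : (Fin 4 → ℝ) → Fin 4 → ℝ) : EqOn (along M X f) (along M X g) (chart M W) := fun q hq => by
  simp only [along, pd_congr hW h _ hq]

theorem two_le_infty : (2 : ℕ∞ω) ≤ ∞ := by
  exact WithTop.coe_le_coe.mpr (le_top : (2 : ℕ∞) ≤ ⊤)

theorem pd_comm {f : (Fin 4 → ℝ) → E} (hf : Smooth M W f) (hW : IsOpen W) (hq : q ∈ dom M W)
    (i j : Fin 4) : KerrMaxwell.pd M i (KerrMaxwell.pd M j f) q
      = KerrMaxwell.pd M j (KerrMaxwell.pd M i f) q := by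
  have key : ∀ i j : Fin 4, KerrMaxwell.pd M i (KerrMaxwell.pd M j f) q
      = fderivWithin ℝ (fderivWithin ℝ f (dom M W)) (dom M W) q (Pi.single i 1) (Pi.single j 1) := by
    intro i j
    rw [(hf.pd hW j).pd_eq_fderivWithin hW hq]
    have e : fderivWithin ℝ (KerrMaxwell.pd M j f) (dom M W) q
        = fderivWithin ℝ (fun q => fderivWithin ℝ f (dom M W) q (Pi.single j 1)) (dom M W) q :=
      fderivWithin_congr (fun q hq => hf.pd_eq_fderivWithin hW hq) (hf.pd_eq_fderivWithin hW hq)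
    have hd : DifferentiableWithinAt ℝ (fderivWithin ℝ f (dom M W)) (dom M W) q :=
      (ContDiffOn.fderivWithin hf (uniqueDiffOn_dom hW) (m := 1) (by rw [one_add_one_eq_two]; exact two_le_infty) q hq).differentiableWithinAt
        (by simp)
    rw [e, fderivWithin_clm_apply (uniqueDiffOn_dom hW q hq) hd (by fun_prop)]
    simp
  rw [key, key]
  have hs : minSmoothness ℝ 2 ≤ ∞ := by simpa using two_le_infty
  exact ((hf q hq).isSymmSndFDerivWithinAt hs (uniqueDiffOn_dom hW)
    (dom_subset_closure_interior hW hq) hq).eq _ _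

end KerrMaxwell
end

noncomputable section

namespace KerrMaxwell

open Function (update)
open scoped ContDiff

set_option linter.unusedSectionVars false

/-! ### Rules for partial derivatives in Kerr coordinates. -/

section Rules

variable {E : Type*} [NormedAddCommGroup E] [NormedSpace ℝ E] {𝔸 : Type*} [NormedRing 𝔸] [NormedAlgebra ℝ 𝔸]
  {M : ℝ} {W : Set (ℝ × ℝ)} {i j : Fin 4} {q : Fin 4 → ℝ}

theorem HasPartial.congr_deriv {f : (Fin 4 → ℝ) → E} {f' f'' : E} (h : HasPartial M i f f' q) (e : f' = f'') :
    HasPartial M i f f'' q := e ▸ h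

theorem HasPartial.add {f g : (Fin 4 → ℝ) → E} {f' g' : E} (hf : HasPartial M i f f' q)
    (hg : HasPartial M i g g' q) : HasPartial M i (fun p => f p + g p) (f' + g') q :=
  HasDerivWithinAt.add hf hg

theorem HasPartial.sub {f g : (Fin 4 → ℝ) → E} {f' g' : E} (hf : HasPartial M i f f' q)
    (hg : HasPartial M i g g' q) : HasPartial M i (fun p => f p - g p) (f' - g') q :=
  HasDerivWithinAt.sub hf hg

theorem HasPartial.neg {f : (Fin 4 → ℝ) → E} {f' : E} (hf : HasPartial M i f f' q) :
    HasPartial M i (fun p => -f p) (-f') q :=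
  HasDerivWithinAt.neg hf

theorem HasPartial.mul {f g : (Fin 4 → ℝ) → 𝔸} {f' g' : 𝔸} (hf : HasPartial M i f f' q)
    (hg : HasPartial M i g g' q) : HasPartial M i (fun p => f p * g p) (f' * g q + f q * g') q := by
  have := HasDerivWithinAt.mul hf hg
  simp only [Function.update_eq_self] at this
  exact this

theorem HasPartial.const_mul {g : (Fin 4 → ℝ) → 𝔸} {g' : 𝔸} (c : 𝔸)
    (hg : HasPartial M i g g' q) : HasPartial M i (fun p => c * g p) (c * g') q :=
  HasDerivWithinAt.const_mul c hg

theorem hasPartial_const (c : E) : HasPartial M i (fun _ => c) 0 q :=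
  hasDerivWithinAt_const _ _ _

theorem HasPartial.ofReal {f : (Fin 4 → ℝ) → ℝ} {f' : ℝ} (hf : HasPartial M i f f' q) :
    HasPartial M i (fun p => (f p : ℂ)) (f' : ℂ) q := by
  have := Complex.ofRealCLM.hasFDerivAt.comp_hasDerivWithinAt (q i) hf
  exact this

theorem hasPartial_coord_self {g : ℝ → E} {g' : E} (hg : HasDerivAt g g' (q i)) :
    HasPartial M i (fun p => g (p i)) g' q := by
  have : (fun s => g (update q i s i)) = g := by funext s; simp
  unfold HasPartial
  rw [this]
  exact hg.hasDerivWithinAt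

theorem hasPartial_coord_of_ne (g : ℝ → E) (h : i ≠ j) : HasPartial M i (fun p => g (p j)) 0 q := by
  have : (fun s => g (update q i s j)) = fun _ => g (q j) := by
    funext s; simp [Function.update_of_ne h.symm]
  unfold HasPartial
  rw [this]
  exact hasDerivWithinAt_const _ _ _

/-- A smooth function off the axis has all partial derivatives there. -/
theorem hasPd_of_contDiffOn_chart {f : (Fin 4 → ℝ) → E} (hf : ContDiffOn ℝ ∞ f (chart M W)) (hW : IsOpen W)
    (hq : q ∈ chart M W) : HasPd M i f q := by
  have h1 : HasFDerivWithinAt f (fderivWithin ℝ f (chart M W) q) (chart M W) (update q i (q i)) := by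
    rw [Function.update_eq_self]
    exact ((hf q hq).differentiableWithinAt (by simp)).hasFDerivWithinAt
  have h2 := (hasDerivAt_update q i (q i)).hasDerivWithinAt (s := {s | update q i s ∈ chart M W})
  exact ((h1.comp_hasDerivWithinAt (q i) h2 (fun s hs => hs)).mono_of_mem_nhdsWithin
    (slice_mem_chart hW hq)).differentiableWithinAt

end Rules

variable {M a : ℝ} {W : Set (ℝ × ℝ)} {F : TwoForm} {q : Fin 4 → ℝ}

/-! ### The components of the two-form -/

theorem lower_self (F : TwoForm) (i : Fin 4) (q : Fin 4 → ℝ) : lower F i i q = 0 :=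
  (F (pt q)).map_eq_zero_of_eq _ (i := 0) (j := 1) rfl (by decide)

theorem lower_swap (F : TwoForm) (i j : Fin 4) (q : Fin 4 → ℝ) : lower F j i q = -lower F i j q := by
  have h := (F (pt q)).toAlternatingMap.map_swap ![coordVec q i, coordVec q j] (i := 0) (j := 1) (by decide)
  have e : (![coordVec q i, coordVec q j] ∘ ⇑(Equiv.swap (0 : Fin 2) 1)) = ![coordVec q j, coordVec q i] := by
    funext k; fin_cases k <;> simp
  rw [e] at h
  exact h

/-- The vector `∂_φ / sin θ`, which is regular on the axis. -/
def azimuthVec (q : Fin 4 → ℝ) : Fin 4 → ℝ := ![0, -(q 1 * sin (q 3)), q 1 * cos (q 3), 0]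

/-- The frame `∂_v, ∂_r, ∂_θ, ∂_φ / sin θ`, which is smooth in the coordinates across the axis. -/
def regularVec (q : Fin 4 → ℝ) (i : Fin 4) : Fin 4 → ℝ := if i = 3 then azimuthVec q else coordVec q i

theorem coordVec_three (q : Fin 4 → ℝ) : coordVec q 3 = sin (q 2) • azimuthVec q := by
  ext k; fin_cases k <;> simp [coordVec, azimuthVec] <;> ring

/-- The components of `F` in the frame `regularVec`. -/
def regular (F : TwoForm) (i j : Fin 4) (q : Fin 4 → ℝ) : ℝ := F (pt q) ![regularVec q i, regularVec q j]

theorem map_vec_smul_right (f : (Fin 4 → ℝ) [⋀^Fin 2]→L[ℝ] ℝ) (x y : Fin 4 → ℝ) (c : ℝ) :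
    f ![x, c • y] = c * f ![x, y] := by
  have e : ∀ z, update ![x, y] 1 z = ![x, z] := by
    intro z; funext k; fin_cases k <;> rfl
  have h := f.map_update_smul ![x, y] 1 c y
  rwa [e, e] at h

theorem regularVec_three (q : Fin 4 → ℝ) : regularVec q 3 = azimuthVec q := if_pos rfl

theorem regularVec_of_ne {i : Fin 4} (h : i ≠ 3) (q : Fin 4 → ℝ) : regularVec q i = coordVec q i := if_neg h

/-- The zero of F(·, ∂_φ) on the axis is the explicit factor sin θ, so F_{iφ} / sin θ extends
smoothly to the poles, where boundary terms will have to be evaluated. -/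
theorem lower_three (F : TwoForm) {i : Fin 4} (hi : i ≠ 3) (q : Fin 4 → ℝ) :
    lower F i 3 q = sin (q 2) * regular F i 3 q := by
  rw [lower, coordVec_three, map_vec_smul_right, regular, regularVec_of_ne hi, regularVec_three]

theorem radius_pt (h : 0 ≤ q 1) : radius (pt q) = q 1 := by
  have : (q 1 * sin (q 2) * cos (q 3)) ^ 2 + (q 1 * sin (q 2) * sin (q 3)) ^ 2 + (q 1 * cos (q 2)) ^ 2
      = q 1 ^ 2 := by
    linear_combination (q 1 ^ 2 * sin (q 2) ^ 2) * sin_sq_add_cos_sq (q 3) + q 1 ^ 2 * sin_sq_add_cos_sq (q 2)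
  simp [radius, pt, this, Real.sqrt_sq h]

theorem mapsTo_pt (hM : 0 < M) : MapsTo pt (dom M W) (region M W) := by
  intro q hq
  have h := radius_pt (q := q) (hM.le.trans hq.1)
  refine ⟨h ▸ hq.1, ?_⟩
  rw [h]
  simpa [pt] using hq.2

theorem contDiff_pt : ContDiff ℝ ∞ pt := by
  rw [contDiff_pi]
  simp only [Fin.forall_fin_succ, Fin.forall_fin_zero, pt, Matrix.cons_val_zero, Matrix.cons_val_succ,
    and_true]
  refine ⟨?_, ?_, ?_, ?_⟩ <;> fun_prop

theorem contDiff_coordVec (i : Fin 4) : ContDiff ℝ ∞ fun q => coordVec q i := by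
  rw [contDiff_pi]
  revert i
  simp only [Fin.forall_fin_succ, Fin.forall_fin_zero, coordVec, Matrix.cons_val_zero, Matrix.cons_val_succ,
    and_true]
  refine ⟨⟨?_, ?_, ?_, ?_⟩, ⟨?_, ?_, ?_, ?_⟩, ⟨?_, ?_, ?_, ?_⟩, ⟨?_, ?_, ?_, ?_⟩⟩ <;> fun_prop

theorem contDiff_azimuthVec : ContDiff ℝ ∞ azimuthVec := by
  rw [contDiff_pi]
  simp only [Fin.forall_fin_succ, Fin.forall_fin_zero, azimuthVec, Matrix.cons_val_zero, Matrix.cons_val_succ,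
    and_true]
  refine ⟨?_, ?_, ?_, ?_⟩ <;> fun_prop

theorem contDiff_regularVec (i : Fin 4) : ContDiff ℝ ∞ fun q => regularVec q i := by
  by_cases h : i = 3
  · subst h; exact contDiff_azimuthVec
  · simpa only [regularVec_of_ne h] using contDiff_coordVec i

/-- Expansion on constant basis vectors: smoothness of q ↦ F(X q, Y q) then reduces to that of
scalar coefficients. -/
theorem twoForm_apply_eq_sum (f : (Fin 4 → ℝ) [⋀^Fin 2]→L[ℝ] ℝ) (v : Fin 2 → Fin 4 → ℝ) :
    f v = ∑ r : Fin 2 → Fin 4, (∏ k, v k (r k)) * f fun k => Pi.single (r k) 1 := by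
  have hv : v = fun k => ∑ l, v k l • (Pi.single l 1 : Fin 4 → ℝ) := by
    funext k; exact (pi_eq_sum_univ' (v k)).trans (by simp [Pi.single])
  conv_lhs => rw [hv]
  have h := f.toAlternatingMap.toMultilinearMap.map_sum (fun k l => v k l • (Pi.single l 1 : Fin 4 → ℝ))
  refine h.trans (Finset.sum_congr rfl fun r _ => ?_)
  exact f.toAlternatingMap.toMultilinearMap.map_smul_univ _ _

theorem smooth_twoForm_apply (hM : 0 < M) (hF : ContDiffOn ℝ ∞ F (region M W))
    {X Y : (Fin 4 → ℝ) → Fin 4 → ℝ} (hX : ContDiff ℝ ∞ X) (hY : ContDiff ℝ ∞ Y) :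
    Smooth M W fun q => F (pt q) ![X q, Y q] := by
  have h1 : ContDiffOn ℝ ∞ (fun q => F (pt q)) (dom M W) := hF.comp contDiff_pt.contDiffOn (mapsTo_pt hM)
  have h2 : ∀ v : Fin 2 → Fin 4 → ℝ, ContDiffOn ℝ ∞ (fun q => F (pt q) v) (dom M W) := fun v =>
    (ContinuousAlternatingMap.apply ℝ (Fin 4 → ℝ) ℝ v).contDiff.comp_contDiffOn h1
  have h3 : Smooth M W fun q => ∑ r : Fin 2 → Fin 4, (X q (r 0) * Y q (r 1)) *
      F (pt q) fun k => Pi.single (r k) 1 := by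
    refine ContDiffOn.sum fun r _ => ContDiffOn.mul (ContDiffOn.mul ?_ ?_) (h2 _)
    · exact (contDiff_pi.1 hX (r 0)).contDiffOn
    · exact (contDiff_pi.1 hY (r 1)).contDiffOn
  refine h3.congr fun q _ => ?_
  rw [twoForm_apply_eq_sum]
  simp only [Fin.prod_univ_two, Matrix.cons_val_zero, Matrix.cons_val_one]

theorem smooth_regular (hM : 0 < M) (hF : ContDiffOn ℝ ∞ F (region M W)) (i j : Fin 4) :
    Smooth M W (regular F i j) :=
  smooth_twoForm_apply hM hF (contDiff_regularVec i) (contDiff_regularVec j)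

theorem smooth_lower (hM : 0 < M) (hF : ContDiffOn ℝ ∞ F (region M W)) (i j : Fin 4) :
    Smooth M W (lower F i j) :=
  smooth_twoForm_apply hM hF (contDiff_coordVec i) (contDiff_coordVec j)

end KerrMaxwell
end

noncomputable section

namespace KerrMaxwell

open Function (update)
open scoped ContDiff

variable {M a : ℝ} {W : Set (ℝ × ℝ)} {F : TwoForm} {q : Fin 4 → ℝ}

/-! ### The inverse metric and the dual form -/

theorem Sig_pos (hM : 0 < M) (hq : M ≤ q 1) : 0 < Sig a q := by
  have : 0 < q 1 ^ 2 := pow_pos (hM.trans_le hq) 2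
  have : 0 ≤ a ^ 2 * cos (q 2) ^ 2 := by positivity
  unfold Sig; linarith

theorem Sig_eq (a : ℝ) (q : Fin 4 → ℝ) : Sig a q = q 1 ^ 2 + a ^ 2 - a ^ 2 * sin (q 2) ^ 2 := by
  rw [Sig, cos_sq']; ring

/-- The inverse metric. -/
def metricInv (M a : ℝ) (q : Fin 4 → ℝ) : Matrix (Fin 4) (Fin 4) ℝ :=
  !![a ^ 2 * sin (q 2) ^ 2 / Sig a q, (q 1 ^ 2 + a ^ 2) / Sig a q, 0, a / Sig a q;
     (q 1 ^ 2 + a ^ 2) / Sig a q, Del M a q / Sig a q, 0, a / Sig a q;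
     0, 0, 1 / Sig a q, 0;
     a / Sig a q, a / Sig a q, 0, 1 / (Sig a q * sin (q 2) ^ 2)]

theorem metric_inv (hS : Sig a q ≠ 0) (hs : sin (q 2) ≠ 0) : (metric M a q)⁻¹ = metricInv M a q := by
  refine Matrix.inv_eq_right_inv ?_
  have hS' := hS
  ext i j
  rw [Matrix.mul_apply, Fin.sum_univ_four]
  fin_cases i <;> fin_cases j <;>
    simp [metric, metricInv] <;> field_simp <;>
    simp only [Del, Sig_eq] <;> ring

theorem det_metric (hS : Sig a q ≠ 0) : (metric M a q).det = -(Sig a q * sin (q 2)) ^ 2 := by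
  simp [metric, Matrix.det_succ_row_zero, Fin.sum_univ_succ, Fin.succAbove]
  field_simp
  simp only [Del, Sig_eq]
  ring

theorem sqrt_abs_det_metric (hS : 0 < Sig a q) (hs : 0 < sin (q 2)) :
    √|(metric M a q).det| = Sig a q * sin (q 2) := by
  rw [det_metric hS.ne', abs_neg, abs_of_nonneg (sq_nonneg _), Real.sqrt_sq (by positivity)]

/-- The contravariant density `√|det g| F^{ij}`. -/
def dens (M a : ℝ) (F : TwoForm) (i j : Fin 4) (q : Fin 4 → ℝ) : ℝ :=
  √|(metric M a q).det| * upper M a F i j q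

theorem upper_swap (i j : Fin 4) : upper M a F j i q = -upper M a F i j q := by
  unfold upper
  rw [Finset.sum_comm, ← Finset.sum_neg_distrib]
  refine Finset.sum_congr rfl fun k _ => ?_
  rw [← Finset.sum_neg_distrib]
  refine Finset.sum_congr rfl fun l _ => ?_
  rw [lower_swap F k l]; ring

theorem upper_eq (hS : Sig a q ≠ 0) (hs : sin (q 2) ≠ 0) (i j : Fin 4) :
    upper M a F i j q =
      (metricInv M a q i 0 * metricInv M a q j 1 - metricInv M a q i 1 * metricInv M a q j 0) * lower F 0 1 q
      + (metricInv M a q i 0 * metricInv M a q j 2 - metricInv M a q i 2 * metricInv M a q j 0) * lower F 0 2 q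
      + (metricInv M a q i 0 * metricInv M a q j 3 - metricInv M a q i 3 * metricInv M a q j 0) * lower F 0 3 q
      + (metricInv M a q i 1 * metricInv M a q j 2 - metricInv M a q i 2 * metricInv M a q j 1) * lower F 1 2 q
      + (metricInv M a q i 1 * metricInv M a q j 3 - metricInv M a q i 3 * metricInv M a q j 1) * lower F 1 3 q
      + (metricInv M a q i 2 * metricInv M a q j 3 - metricInv M a q i 3 * metricInv M a q j 2) * lower F 2 3 q
      := by
  unfold upper
  rw [metric_inv hS hs]
  simp only [Fin.sum_univ_four, lower_self]
  rw [lower_swap F 0 1, lower_swap F 0 2, lower_swap F 0 3, lower_swap F 1 2, lower_swap F 1 3, lower_swap F 2 3]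
  ring

end KerrMaxwell
end

noncomputable section

namespace KerrMaxwell

open Function (update)
open scoped ContDiff

variable {M a : ℝ} {W : Set (ℝ × ℝ)} {F : TwoForm} {q : Fin 4 → ℝ}

/-! ### The Maxwell equations in null components -/

/-- `-Σ ρ = -(r² + a²) F_{vr} + a F_{rφ}`. -/
def elec (a : ℝ) (F : TwoForm) (q : Fin 4 → ℝ) : ℝ :=
  -(q 1 ^ 2 + a ^ 2) * lower F 0 1 q + a * lower F 1 3 q

/-- `Σ σ = -a sin θ F_{vθ} + F_{θφ} / sin θ`. -/
def magn (a : ℝ) (F : TwoForm) (q : Fin 4 → ℝ) : ℝ :=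
  -(a * sin (q 2)) * lower F 0 2 q + lower F 2 3 q / sin (q 2)

/-- `a sin θ F_{vr} - F_{rφ} / sin θ`. -/
def axial (a : ℝ) (F : TwoForm) (q : Fin 4 → ℝ) : ℝ :=
  a * sin (q 2) * lower F 0 1 q - lower F 1 3 q / sin (q 2)

/-- The split isolates a sin²θ times a φ-density, here and in `dens_zero_two`, so that subtracting a
sin²θ times the φ-component of d⋆F = 0 from its v-component leaves no derivative of those densities.
-/
theorem dens_zero_one (hS : 0 < Sig a q) (hs : 0 < sin (q 2)) : dens M a F 0 1 q =
    sin (q 2) * elec a F q - a * sin (q 2) ^ 2 * dens M a F 1 3 q := by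
  have hS' := hS.ne'
  have hs' := hs.ne'
  simp only [dens, elec, sqrt_abs_det_metric hS hs, upper_eq hS' hs', metricInv, Matrix.of_apply, Matrix.cons_val]
  field_simp
  simp only [Sig_eq]
  ring

theorem dens_zero_two (hS : 0 < Sig a q) (hs : 0 < sin (q 2)) : dens M a F 0 2 q =
    sin (q 2) * lower F 1 2 q - a * sin (q 2) ^ 2 * dens M a F 2 3 q := by
  have hS' := hS.ne'
  have hs' := hs.ne'
  simp only [dens, sqrt_abs_det_metric hS hs, upper_eq hS' hs', metricInv, Matrix.of_apply, Matrix.cons_val]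
  field_simp
  simp only [Sig_eq]
  ring

theorem dens_zero_three (hS : 0 < Sig a q) (hs : 0 < sin (q 2)) : dens M a F 0 3 q = -axial a F q := by
  have hS' := hS.ne'
  have hs' := hs.ne'
  simp only [dens, axial, sqrt_abs_det_metric hS hs, upper_eq hS' hs', metricInv, Matrix.of_apply, Matrix.cons_val]
  field_simp
  simp only [Sig_eq]
  ring

theorem dens_one_three (hS : 0 < Sig a q) (hs : 0 < sin (q 2)) : dens M a F 1 3 q =
    lower F 0 3 q / sin (q 2) - (Del M a q * axial a F q + a * sin (q 2) * elec a F q) / Sig a q := by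
  have hS' := hS.ne'
  have hs' := hs.ne'
  simp only [dens, axial, elec, sqrt_abs_det_metric hS hs, upper_eq hS' hs', metricInv, Matrix.of_apply,
    Matrix.cons_val]
  field_simp
  simp only [Sig_eq]
  ring

theorem dens_two_three (hS : 0 < Sig a q) (hs : 0 < sin (q 2)) : dens M a F 2 3 q =
    (magn a F q - a * sin (q 2) * lower F 1 2 q) / Sig a q := by
  have hS' := hS.ne'
  have hs' := hs.ne'
  simp only [dens, magn, sqrt_abs_det_metric hS hs, upper_eq hS' hs', metricInv, Matrix.of_apply, Matrix.cons_val]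
  field_simp
  simp only [Sig_eq]
  ring

theorem dens_one_two (hS : 0 < Sig a q) (hs : 0 < sin (q 2)) : dens M a F 1 2 q =
    sin (q 2) / Sig a q * (Sig a q * lower F 0 2 q - a * sin (q 2) * magn a F q + Del M a q * lower F 1 2 q) := by
  have hS' := hS.ne'
  have hs' := hs.ne'
  simp only [dens, magn, sqrt_abs_det_metric hS hs, upper_eq hS' hs', metricInv, Matrix.of_apply, Matrix.cons_val]
  field_simp
  simp only [Sig_eq]
  ring

theorem dens_swap (i j : Fin 4) (q : Fin 4 → ℝ) : dens M a F j i q = -dens M a F i j q := by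
  rw [dens, dens, upper_swap]; ring

theorem sin_pos_of_mem_chart (hq : q ∈ chart M W) : 0 < sin (q 2) := sin_pos_of_mem_Ioo hq.2.2

theorem contDiffOn_sin : ContDiffOn ℝ ∞ (fun q : Fin 4 → ℝ => sin (q 2)) (chart M W) := by
  fun_prop

theorem contDiff_Sig : ContDiff ℝ ∞ (Sig a) := by unfold Sig; fun_prop

theorem contDiff_Del : ContDiff ℝ ∞ (Del M a) := by unfold Del; fun_prop

theorem contDiffOn_lower (hM : 0 < M) (hF : IsMaxwellField M a W F) (i j : Fin 4) :
    ContDiffOn ℝ ∞ (lower F i j) (chart M W) :=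
  ContDiffOn.mono (smooth_lower hM hF.smooth i j) chart_subset_dom

theorem contDiffOn_elec (hM : 0 < M) (hF : IsMaxwellField M a W F) :
    ContDiffOn ℝ ∞ (elec a F) (chart M W) := by
  have h := contDiffOn_lower hM hF
  have h01 := h 0 1
  have h13 := h 1 3
  unfold elec
  fun_prop

theorem contDiffOn_magn (hM : 0 < M) (hF : IsMaxwellField M a W F) :
    ContDiffOn ℝ ∞ (magn a F) (chart M W) := by
  have h02 := contDiffOn_lower hM hF 0 2
  have h23 : ContDiffOn ℝ ∞ (fun q => lower F 2 3 q / sin (q 2)) (chart M W) :=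
    (contDiffOn_lower hM hF 2 3).div contDiffOn_sin fun q hq => (sin_pos_of_mem_chart hq).ne'
  unfold magn
  fun_prop

theorem contDiffOn_axial (hM : 0 < M) (hF : IsMaxwellField M a W F) :
    ContDiffOn ℝ ∞ (axial a F) (chart M W) := by
  have h01 := contDiffOn_lower hM hF 0 1
  have h13 : ContDiffOn ℝ ∞ (fun q => lower F 1 3 q / sin (q 2)) (chart M W) :=
    (contDiffOn_lower hM hF 1 3).div contDiffOn_sin fun q hq => (sin_pos_of_mem_chart hq).ne'
  unfold axial
  fun_prop

theorem contDiffOn_dens_one_three (hM : 0 < M) (hF : IsMaxwellField M a W F) :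
    ContDiffOn ℝ ∞ (dens M a F 1 3) (chart M W) := by
  have h : ContDiffOn ℝ ∞ (fun q => lower F 0 3 q / sin (q 2)
      - (Del M a q * axial a F q + a * sin (q 2) * elec a F q) / Sig a q) (chart M W) := by
    refine ContDiffOn.sub ((contDiffOn_lower hM hF 0 3).div contDiffOn_sin
      fun q hq => (sin_pos_of_mem_chart hq).ne') (ContDiffOn.div ?_ contDiff_Sig.contDiffOn
      fun q hq => (Sig_pos hM hq.1).ne')
    have h1 := contDiffOn_axial hM hF
    have h2 := contDiffOn_elec hM hF
    have h3 := (contDiff_Del (M := M) (a := a)).contDiffOn (s := chart M W)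
    fun_prop
  exact h.congr fun q hq => dens_one_three (Sig_pos hM hq.1) (sin_pos_of_mem_chart hq)

theorem contDiffOn_dens_two_three (hM : 0 < M) (hF : IsMaxwellField M a W F) :
    ContDiffOn ℝ ∞ (dens M a F 2 3) (chart M W) := by
  have h : ContDiffOn ℝ ∞ (fun q => (magn a F q - a * sin (q 2) * lower F 1 2 q) / Sig a q) (chart M W) := by
    refine ContDiffOn.div ?_ contDiff_Sig.contDiffOn fun q hq => (Sig_pos hM hq.1).ne'
    have h1 := contDiffOn_magn hM hF
    have h2 := contDiffOn_lower hM hF 1 2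
    fun_prop
  exact h.congr fun q hq => dens_two_three (Sig_pos hM hq.1) (sin_pos_of_mem_chart hq)

end KerrMaxwell
end

/-! ### The four real Maxwell equations for the null components. -/

noncomputable section

namespace KerrMaxwell

open Function (update)
open scoped ContDiff

variable {M a : ℝ} {W : Set (ℝ × ℝ)} {F : TwoForm} {q : Fin 4 → ℝ}

theorem pd_lower_swap (i j k : Fin 4) (q : Fin 4 → ℝ) :
    pd M k (lower F j i) q = -pd M k (lower F i j) q := by
  have : lower F j i = fun p => -lower F i j p := by funext p; exact lower_swap F i j p
  rw [this]
  simp only [pd]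
  exact derivWithin.fun_neg

theorem pd_dens_swap (i j k : Fin 4) (q : Fin 4 → ℝ) :
    pd M k (dens M a F j i) q = -pd M k (dens M a F i j) q := by
  have : dens M a F j i = fun p => -dens M a F i j p := by funext p; exact dens_swap i j p
  rw [this]
  simp only [pd]
  exact derivWithin.fun_neg

theorem pd_dens_self (i k : Fin 4) (q : Fin 4 → ℝ) : pd M k (dens M a F i i) q = 0 := by
  have := pd_dens_swap (M := M) (a := a) (F := F) i i k q
  linarith

theorem hasPartial_sin : HasPartial M 2 (fun p => sin (p 2)) (cos (q 2)) q :=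
  hasPartial_coord_self (hasDerivAt_sin (q 2))

theorem hasPartial_cos : HasPartial M 2 (fun p => cos (p 2)) (-sin (q 2)) q :=
  hasPartial_coord_self (hasDerivAt_cos (q 2))

theorem hasPartial_theta_of_ne {E : Type*} [NormedAddCommGroup E] [NormedSpace ℝ E] {k : Fin 4} (g : ℝ → E)
    (hk : k ≠ 2) : HasPartial M k (fun p => g (p 2)) 0 q :=
  hasPartial_coord_of_ne g hk

theorem hasPartial_Del : HasPartial M 1 (Del M a) (2 * q 1 - 2 * M) q := by
  have h : HasDerivAt (fun r : ℝ => r ^ 2 - 2 * M * r + a ^ 2) (2 * q 1 - 2 * M) (q 1) := by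
    simpa using (((hasDerivAt_pow 2 (q 1)).sub ((hasDerivAt_id (q 1)).const_mul (2 * M))).add_const (a ^ 2))
  exact hasPartial_coord_self h

theorem hasPartial_Sig_one : HasPartial M 1 (Sig a) (2 * q 1) q := by
  have h : HasDerivAt (fun r : ℝ => r ^ 2) (2 * q 1) (q 1) := by simpa using hasDerivAt_pow 2 (q 1)
  have h2 : HasPartial M 1 (fun p => p 1 ^ 2) (2 * q 1) q := hasPartial_coord_self h
  have h3 : HasPartial M 1 (fun p => a ^ 2 * cos (p 2) ^ 2) 0 q :=
    hasPartial_theta_of_ne (fun t => a ^ 2 * cos t ^ 2) (by decide)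
  exact (h2.add h3).congr_deriv (by ring)

theorem hasPartial_Sig_two : HasPartial M 2 (Sig a) (-(2 * a ^ 2 * cos (q 2) * sin (q 2))) q := by
  have h2 : HasPartial M 2 (fun p => p 1 ^ 2) 0 q := hasPartial_coord_of_ne (fun t : ℝ => t ^ 2) (by decide)
  have h3 : HasPartial M 2 (fun p => a ^ 2 * cos (p 2) ^ 2) (a ^ 2 * (2 * cos (q 2) * -sin (q 2))) q :=
    hasPartial_coord_self (g := fun t => a ^ 2 * cos t ^ 2)
      (by simpa using ((hasDerivAt_cos (q 2)).pow 2).const_mul (a ^ 2))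
  exact (h2.add h3).congr_deriv (by ring)

theorem hasPartial_Sig_of_ne {k : Fin 4} (h1 : k ≠ 1) (h2 : k ≠ 2) : HasPartial M k (Sig a) 0 q := by
  have h2 : HasPartial M k (fun p => p 1 ^ 2) 0 q := hasPartial_coord_of_ne (fun t : ℝ => t ^ 2) h1
  have h3 : HasPartial M k (fun p => a ^ 2 * cos (p 2) ^ 2) 0 q :=
    hasPartial_theta_of_ne (fun t => a ^ 2 * cos t ^ 2) ‹_›
  exact (h2.add h3).congr_deriv (by ring)

theorem sum_pd_dens (hF : IsMaxwellField M a W F) (hq : q ∈ chart M W) (i : Fin 4) : pd M 0 (dens M a F i 0) q + pd M 1 (dens M a F i 1) q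
    + pd M 2 (dens M a F i 2) q + pd M 3 (dens M a F i 3) q = 0 := by
  have h := hF.coclosed q hq i
  rw [Fin.sum_univ_four] at h
  exact h

section Real

variable (hM : 0 < M) (hW : IsOpen W) (hF : IsMaxwellField M a W F) (hq : q ∈ chart M W)
include hM hW hF hq

theorem hasPartial_lower (i j k : Fin 4) : HasPartial M k (lower F i j) (pd M k (lower F i j) q) q :=
  (hasPd_of_contDiffOn_chart (contDiffOn_lower hM hF i j) hW hq).hasPartial

theorem hasPartial_elec (k : Fin 4) : HasPartial M k (elec a F) (pd M k (elec a F) q) q :=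
  (hasPd_of_contDiffOn_chart (contDiffOn_elec hM hF) hW hq).hasPartial

theorem hasPartial_magn (k : Fin 4) : HasPartial M k (magn a F) (pd M k (magn a F) q) q :=
  (hasPd_of_contDiffOn_chart (contDiffOn_magn hM hF) hW hq).hasPartial

theorem hasPartial_axial (k : Fin 4) : HasPartial M k (axial a F) (pd M k (axial a F) q) q :=
  (hasPd_of_contDiffOn_chart (contDiffOn_axial hM hF) hW hq).hasPartial

theorem hasPartial_dens_one_three (k : Fin 4) :
    HasPartial M k (dens M a F 1 3) (pd M k (dens M a F 1 3) q) q :=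
  (hasPd_of_contDiffOn_chart (contDiffOn_dens_one_three hM hF) hW hq).hasPartial

theorem hasPartial_dens_two_three (k : Fin 4) :
    HasPartial M k (dens M a F 2 3) (pd M k (dens M a F 2 3) q) q :=
  (hasPd_of_contDiffOn_chart (contDiffOn_dens_two_three hM hF) hW hq).hasPartial

theorem pd_dens_zero_one : pd M 1 (dens M a F 0 1) q =
    sin (q 2) * pd M 1 (elec a F) q - a * sin (q 2) ^ 2 * pd M 1 (dens M a F 1 3) q := by
  have hs : HasPartial M 1 (fun p => sin (p 2)) 0 q := hasPartial_theta_of_ne _ (by decide)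
  have hs2 : HasPartial M 1 (fun p => a * sin (p 2) ^ 2) 0 q :=
    hasPartial_theta_of_ne (fun t => a * sin t ^ 2) (by decide)
  have h := (hs.mul (hasPartial_elec hM hW hF hq 1)).sub (hs2.mul (hasPartial_dens_one_three hM hW hF hq 1))
  have := (hasPartial_congr hW (fun p hp => dens_zero_one (Sig_pos hM hp.1) (sin_pos_of_mem_chart hp)) hq h).pd_eq
    hq.1
  rw [this]; ring

theorem pd_two_dens_zero_two : pd M 2 (dens M a F 0 2) q =
    cos (q 2) * lower F 1 2 q + sin (q 2) * pd M 2 (lower F 1 2) q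
      - 2 * a * sin (q 2) * cos (q 2) * dens M a F 2 3 q
      - a * sin (q 2) ^ 2 * pd M 2 (dens M a F 2 3) q := by
  have hs : HasPartial M 2 (fun p => sin (p 2)) (cos (q 2)) q := hasPartial_sin
  have hs2 : HasPartial M 2 (fun p => a * sin (p 2) ^ 2) (a * (2 * sin (q 2) * cos (q 2))) q :=
    hasPartial_coord_self (g := fun t => a * sin t ^ 2)
      (by simpa using ((hasDerivAt_sin (q 2)).pow 2).const_mul a)
  have h := (hs.mul (hasPartial_lower hM hW hF hq 1 2 2)).sub (hs2.mul (hasPartial_dens_two_three hM hW hF hq 2))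
  have := (hasPartial_congr hW (fun p hp => dens_zero_two (Sig_pos hM hp.1) (sin_pos_of_mem_chart hp)) hq h).pd_eq
    hq.1
  rw [this]; ring

theorem pd_zero_dens_zero_two : pd M 0 (dens M a F 0 2) q =
    sin (q 2) * pd M 0 (lower F 1 2) q - a * sin (q 2) ^ 2 * pd M 0 (dens M a F 2 3) q := by
  have hs : HasPartial M 0 (fun p => sin (p 2)) 0 q := hasPartial_theta_of_ne _ (by decide)
  have hs2 : HasPartial M 0 (fun p => a * sin (p 2) ^ 2) 0 q :=
    hasPartial_theta_of_ne (fun t => a * sin t ^ 2) (by decide)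
  have h := (hs.mul (hasPartial_lower hM hW hF hq 1 2 0)).sub (hs2.mul (hasPartial_dens_two_three hM hW hF hq 0))
  have := (hasPartial_congr hW (fun p hp => dens_zero_two (Sig_pos hM hp.1) (sin_pos_of_mem_chart hp)) hq h).pd_eq
    hq.1
  rw [this]; ring

theorem pd_dens_zero_three (k : Fin 4) : pd M k (dens M a F 0 3) q = -pd M k (axial a F) q :=
  (hasPartial_congr hW (fun _ hp => dens_zero_three (Sig_pos hM hp.1) (sin_pos_of_mem_chart hp)) hq
    (hasPartial_axial hM hW hF hq k).neg).pd_eq hq.1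

/-- The product with Σ is differentiated instead of the quotient; Σ is constant in the coordinates v
and φ. -/
theorem Sig_mul_pd_dens_two_three {k : Fin 4} (h1 : k ≠ 1) (h2 : k ≠ 2) :
    Sig a q * pd M k (dens M a F 2 3) q = pd M k (magn a F) q - a * sin (q 2) * pd M k (lower F 1 2) q := by
  have hs : HasPartial M k (fun p => a * sin (p 2)) 0 q := hasPartial_theta_of_ne (fun t => a * sin t) h2
  have hl := (hasPartial_Sig_of_ne (a := a) h1 h2).mul (hasPartial_dens_two_three hM hW hF hq k)
  have hr := (hasPartial_magn hM hW hF hq k).sub (hs.mul (hasPartial_lower hM hW hF hq 1 2 k))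
  have e : EqOn (fun p => Sig a p * dens M a F 2 3 p) (fun p => magn a F p - a * sin (p 2) * lower F 1 2 p)
      (chart M W) := fun p hp => by
    have hS := Sig_pos (a := a) hM hp.1
    have := hS.ne'
    simp only [dens_two_three hS (sin_pos_of_mem_chart hp)]
    field_simp
  have := (hl.pd_eq hq.1).symm.trans ((hasPartial_congr hW e hq hr).pd_eq hq.1)
  linarith

theorem Sig_mul_pd_two_dens_two_three :
    Sig a q * pd M 2 (dens M a F 2 3) q = pd M 2 (magn a F) q - a * cos (q 2) * lower F 1 2 q
      - a * sin (q 2) * pd M 2 (lower F 1 2) q + 2 * a ^ 2 * cos (q 2) * sin (q 2) * dens M a F 2 3 q := by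
  have hs : HasPartial M 2 (fun p => a * sin (p 2)) (a * cos (q 2)) q := hasPartial_sin.const_mul a
  have hl := (hasPartial_Sig_two (a := a)).mul (hasPartial_dens_two_three hM hW hF hq 2)
  have hr := (hasPartial_magn hM hW hF hq 2).sub (hs.mul (hasPartial_lower hM hW hF hq 1 2 2))
  have e : EqOn (fun p => Sig a p * dens M a F 2 3 p) (fun p => magn a F p - a * sin (p 2) * lower F 1 2 p)
      (chart M W) := fun p hp => by
    have hS := Sig_pos (a := a) hM hp.1
    have := hS.ne'
    simp only [dens_two_three hS (sin_pos_of_mem_chart hp)]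
    field_simp
  have := (hl.pd_eq hq.1).symm.trans ((hasPartial_congr hW e hq hr).pd_eq hq.1)
  linarith

theorem hasPartial_sin_inv_mul {k : Fin 4} (hk : k ≠ 2) (i j : Fin 4) :
    HasPartial M k (fun p => lower F i j p / sin (p 2)) (pd M k (lower F i j) q / sin (q 2)) q := by
  have h := (hasPartial_lower hM hW hF hq i j k).mul
    (hasPartial_theta_of_ne (M := M) (q := q) (fun t => (sin t)⁻¹) hk)
  simpa only [mul_zero, add_zero, div_eq_mul_inv] using h

theorem pd_magn {k : Fin 4} (hk : k ≠ 2) : pd M k (magn a F) q =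
    -(a * sin (q 2)) * pd M k (lower F 0 2) q + pd M k (lower F 2 3) q / sin (q 2) := by
  have h := ((hasPartial_theta_of_ne (M := M) (q := q) (fun t => -(a * sin t)) hk).mul
    (hasPartial_lower hM hW hF hq 0 2 k)).add (hasPartial_sin_inv_mul hM hW hF hq hk 2 3)
  exact (h.congr_deriv (by ring)).pd_eq hq.1

theorem pd_axial {k : Fin 4} (hk : k ≠ 2) : pd M k (axial a F) q =
    a * sin (q 2) * pd M k (lower F 0 1) q - pd M k (lower F 1 3) q / sin (q 2) := by
  have h := ((hasPartial_theta_of_ne (M := M) (q := q) (fun t => a * sin t) hk).mul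
    (hasPartial_lower hM hW hF hq 0 1 k)).sub (hasPartial_sin_inv_mul hM hW hF hq hk 1 3)
  exact (h.congr_deriv (by ring)).pd_eq hq.1

theorem pd_elec {k : Fin 4} (hk : k ≠ 1) : pd M k (elec a F) q =
    -(q 1 ^ 2 + a ^ 2) * pd M k (lower F 0 1) q + a * pd M k (lower F 1 3) q := by
  have h := ((hasPartial_coord_of_ne (M := M) (q := q) (fun t : ℝ => -(t ^ 2 + a ^ 2)) hk).mul
    (hasPartial_lower hM hW hF hq 0 1 k)).add ((hasPartial_lower hM hW hF hq 1 3 k).const_mul a)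
  exact (h.congr_deriv (by ring)).pd_eq hq.1

theorem sin_mul_pd_axial : sin (q 2) * pd M 2 (axial a F) q =
    2 * a * sin (q 2) * cos (q 2) * lower F 0 1 q + a * sin (q 2) ^ 2 * pd M 2 (lower F 0 1) q
      - pd M 2 (lower F 1 3) q - cos (q 2) * axial a F q := by
  have hl := (hasPartial_sin (M := M) (q := q)).mul (hasPartial_axial hM hW hF hq 2)
  have hs2 : HasPartial M 2 (fun p => a * sin (p 2) ^ 2) (a * (2 * sin (q 2) * cos (q 2))) q :=
    hasPartial_coord_self (g := fun t => a * sin t ^ 2)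
      (by simpa using ((hasDerivAt_sin (q 2)).pow 2).const_mul a)
  have hr := (hs2.mul (hasPartial_lower hM hW hF hq 0 1 2)).sub (hasPartial_lower hM hW hF hq 1 3 2)
  have e : EqOn (fun p => sin (p 2) * axial a F p) (fun p => a * sin (p 2) ^ 2 * lower F 0 1 p - lower F 1 3 p)
      (chart M W) := fun p hp => by
    have := (sin_pos_of_mem_chart hp).ne'
    simp only [axial]
    field_simp
  have := (hl.pd_eq hq.1).symm.trans ((hasPartial_congr hW e hq hr).pd_eq hq.1)
  linarith

theorem Sig_mul_pd_dens_one_two : 2 * q 1 * dens M a F 1 2 q + Sig a q * pd M 1 (dens M a F 1 2) q =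
    sin (q 2) * (2 * q 1 * lower F 0 2 q + Sig a q * pd M 1 (lower F 0 2) q
      - a * sin (q 2) * pd M 1 (magn a F) q + (2 * q 1 - 2 * M) * lower F 1 2 q
      + Del M a q * pd M 1 (lower F 1 2) q) := by
  have hr := (hasPartial_theta_of_ne (M := M) (q := q) sin (by decide : (1 : Fin 4) ≠ 2)).mul
    ((((hasPartial_Sig_one (a := a)).mul (hasPartial_lower hM hW hF hq 0 2 1)).sub
    ((hasPartial_theta_of_ne (M := M) (q := q) (fun t => a * sin t) (by decide : (1 : Fin 4) ≠ 2)).mul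
      (hasPartial_magn hM hW hF hq 1))).add ((hasPartial_Del (a := a)).mul (hasPartial_lower hM hW hF hq 1 2 1)))
  have e : EqOn (dens M a F 1 2) (fun p => (Sig a p)⁻¹ * (sin (p 2) * (Sig a p * lower F 0 2 p
      - a * sin (p 2) * magn a F p + Del M a p * lower F 1 2 p))) (chart M W) := fun p hp => by
    simp only [dens_one_two (Sig_pos hM hp.1) (sin_pos_of_mem_chart hp)]
    ring
  have hS := (Sig_pos (a := a) hM hq.1).ne'
  have hi : HasPartial M 1 (fun p => (Sig a p)⁻¹) (-(2 * q 1) / Sig a q ^ 2) q := by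
    have := HasDerivWithinAt.inv (hasPartial_Sig_one (a := a) (M := M) (q := q)) (by simpa using hS)
    simp only [Function.update_eq_self] at this
    exact this
  rw [e hq, (hasPartial_congr hW e hq (hi.mul hr)).pd_eq hq.1]
  field_simp
  ring

theorem Sig_mul_pd_dens_one_three : 2 * q 1 * dens M a F 1 3 q + Sig a q * pd M 1 (dens M a F 1 3) q =
    2 * q 1 * (lower F 0 3 q / sin (q 2)) + Sig a q * (pd M 1 (lower F 0 3) q / sin (q 2))
      - (2 * q 1 - 2 * M) * axial a F q - Del M a q * pd M 1 (axial a F) q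
      - a * sin (q 2) * pd M 1 (elec a F) q := by
  have hl := (hasPartial_Sig_one (a := a)).mul (hasPartial_dens_one_three hM hW hF hq 1)
  have hr := (((hasPartial_Sig_one (a := a)).mul
    (hasPartial_sin_inv_mul hM hW hF hq (by decide : (1 : Fin 4) ≠ 2) 0 3)).sub
    ((hasPartial_Del (a := a)).mul (hasPartial_axial hM hW hF hq 1))).sub
    ((hasPartial_theta_of_ne (M := M) (q := q) (fun t => a * sin t) (by decide : (1 : Fin 4) ≠ 2)).mul
      (hasPartial_elec hM hW hF hq 1))
  have e : EqOn (fun p => Sig a p * dens M a F 1 3 p) (fun p => Sig a p * (lower F 0 3 p / sin (p 2))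
      - Del M a p * axial a F p - a * sin (p 2) * elec a F p) (chart M W) := fun p hp => by
    have hS := Sig_pos (a := a) hM hp.1
    have := hS.ne'
    simp only [dens_one_three hS (sin_pos_of_mem_chart hp)]
    field_simp
    ring
  have := (hl.pd_eq hq.1).symm.trans ((hasPartial_congr hW e hq hr).pd_eq hq.1)
  linarith

theorem coclosed_three : pd M 0 (axial a F) q - pd M 1 (dens M a F 1 3) q - pd M 2 (dens M a F 2 3) q = 0 := by
  have h := sum_pd_dens hF hq 3
  rw [pd_dens_swap 0 3, pd_dens_swap 1 3, pd_dens_swap 2 3, pd_dens_self, pd_dens_zero_three hM hW hF hq] at h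
  linarith

/-- The v-component of d⋆F = 0 minus a sin²θ times the φ-component. This is the real part of the
equation for ∂_r Υ. -/
theorem sin_mul_pd_elec : sin (q 2) * pd M 1 (elec a F) q =
    -(cos (q 2) * lower F 1 2 q + sin (q 2) * pd M 2 (lower F 1 2) q)
      - 2 * a * sin (q 2) * cos (q 2) / Sig a q * (a * sin (q 2) * lower F 1 2 q - magn a F q)
      + (pd M 3 (axial a F) q + a * sin (q 2) ^ 2 * pd M 0 (axial a F) q) := by
  have h0 := sum_pd_dens hF hq 0
  have h3 := coclosed_three hM hW hF hq
  rw [pd_dens_self, pd_dens_zero_one hM hW hF hq, pd_two_dens_zero_two hM hW hF hq,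
    pd_dens_zero_three hM hW hF hq, dens_two_three (Sig_pos hM hq.1) (sin_pos_of_mem_chart hq)] at h0
  have hS := (Sig_pos (a := a) hM hq.1).ne'
  field_simp at h0 ⊢
  linear_combination h0 - Sig a q * a * sin (q 2) ^ 2 * h3

/-- The imaginary part of the same equation, now from dF = 0: the (r, θ, φ) identity plus a sin²θ
times the (r, θ, v) one. -/
theorem sin_mul_pd_magn : sin (q 2) * pd M 1 (magn a F) q =
    -(cos (q 2) * axial a F q + sin (q 2) * pd M 2 (axial a F) q)
      - 2 * a * sin (q 2) * cos (q 2) / Sig a q * (elec a F q + a * sin (q 2) * axial a F q)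
      - (pd M 3 (lower F 1 2) q + a * sin (q 2) ^ 2 * pd M 0 (lower F 1 2) q) := by
  have h1 := hF.closed q hq 1 2 3
  have h2 := hF.closed q hq 1 2 0
  rw [pd_lower_swap 1 3] at h1
  rw [pd_lower_swap 0 2] at h2
  have hs := (sin_pos_of_mem_chart hq).ne'
  have hS := (Sig_pos (a := a) hM hq.1).ne'
  -- This combination is a multiple of F_{vr}; it matches the F_{vr} term produced when the factor
  -- sin²θ is differentiated in sin θ · `axial`.
  have e : elec a F q + a * sin (q 2) * axial a F q = -(Sig a q * lower F 0 1 q) := by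
    simp only [elec, axial]
    field_simp
    rw [Sig_eq]; ring
  rw [sin_mul_pd_axial hM hW hF hq, pd_magn hM hW hF hq (by decide), e]
  field_simp
  linear_combination h1 + a * sin (q 2) ^ 2 * h2

/-- The θ-component of d⋆F = 0 multiplied by Σ, with the radial derivatives of F_{vθ} and F_{θφ}
removed by the (v, r, θ) and (r, θ, φ) components of dF = 0. This is the real part of the second
complex equation. -/
theorem pd_two_elec : pd M 2 (elec a F) q + (a * sin (q 2) * pd M 0 (magn a F) q + pd M 3 (magn a F) q / sin (q 2)) =
    2 * ((q 1 ^ 2 + a ^ 2) * pd M 0 (lower F 1 2) q + a * pd M 3 (lower F 1 2) q)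
      + (2 * q 1 - 2 * M) * lower F 1 2 q + Del M a q * pd M 1 (lower F 1 2) q
      - 2 * q 1 / Sig a q * (Del M a q * lower F 1 2 q - a * sin (q 2) * magn a F q) := by
  have h1 := hF.closed q hq 1 2 3
  have h2 := hF.closed q hq 0 1 2
  rw [pd_lower_swap 1 3] at h1
  rw [pd_lower_swap 0 2] at h2
  have h3 := sum_pd_dens hF hq 2
  rw [pd_dens_swap 0 2, pd_dens_swap 1 2, pd_dens_self, pd_zero_dens_zero_two hM hW hF hq] at h3
  have h4 := Sig_mul_pd_dens_one_two hM hW hF hq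
  have h5 := Sig_mul_pd_dens_two_three hM hW hF hq (k := 0) (by decide) (by decide)
  have h6 := Sig_mul_pd_dens_two_three hM hW hF hq (k := 3) (by decide) (by decide)
  have hs := (sin_pos_of_mem_chart hq).ne'
  have hS := (Sig_pos (a := a) hM hq.1).ne'
  have hSig := Sig_eq a q
  have hd : dens M a F 1 2 q = sin (q 2) * lower F 0 2 q
      + sin (q 2) / Sig a q * (Del M a q * lower F 1 2 q - a * sin (q 2) * magn a F q) := by
    rw [dens_one_two (Sig_pos hM hq.1) (sin_pos_of_mem_chart hq)]
    field_simp
    ring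
  have hQ : sin (q 2) * pd M 1 (magn a F) q
      = -(a * sin (q 2) ^ 2) * pd M 1 (lower F 0 2) q + pd M 1 (lower F 2 3) q := by
    rw [pd_magn hM hW hF hq (by decide)]
    field_simp
  have hz : sin (q 2) * (pd M 3 (magn a F) q / sin (q 2)) = pd M 3 (magn a F) q := by
    field_simp
  rw [pd_elec hM hW hF hq (by decide)]
  rw [hd] at h4
  refine mul_left_cancel₀ hs ?_
  linear_combination -sin (q 2) * (q 1 ^ 2 + a ^ 2) * h2 - sin (q 2) * a * h1 + Sig a q * h3
    - a * sin (q 2) ^ 2 * h5 - h6 + h4 - a * sin (q 2) * hQ + hz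
    + sin (q 2) * (pd M 0 (lower F 1 2) q + pd M 1 (lower F 0 2) q) * hSig

/-- The imaginary part of the second complex equation: the (v, r, φ) component of dF = 0 and the
φ-component of d⋆F = 0, with `sin_mul_pd_elec` removing ∂_r of `elec`. -/
theorem pd_two_magn : pd M 2 (magn a F) q - (a * sin (q 2) * pd M 0 (elec a F) q + pd M 3 (elec a F) q / sin (q 2)) =
    2 * ((q 1 ^ 2 + a ^ 2) * pd M 0 (axial a F) q + a * pd M 3 (axial a F) q)
      + (2 * q 1 - 2 * M) * axial a F q + Del M a q * pd M 1 (axial a F) q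
      - 2 * q 1 / Sig a q * (Del M a q * axial a F q + a * sin (q 2) * elec a F q) := by
  have h1 := hF.closed q hq 0 1 3
  rw [pd_lower_swap 0 3] at h1
  have h2 := sin_mul_pd_elec hM hW hF hq
  have h3 := coclosed_three hM hW hF hq
  have h4 := Sig_mul_pd_dens_one_three hM hW hF hq
  have h5 := Sig_mul_pd_two_dens_two_three hM hW hF hq
  rw [dens_one_three (Sig_pos hM hq.1) (sin_pos_of_mem_chart hq)] at h4
  rw [dens_two_three (Sig_pos hM hq.1) (sin_pos_of_mem_chart hq)] at h5
  have hs := (sin_pos_of_mem_chart hq).ne'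
  have hS := (Sig_pos (a := a) hM hq.1).ne'
  have hSig := Sig_eq a q
  -- In both combinations F_{vr} or F_{rφ} drops out and the other acquires the factor r² + a² - a²
  -- sin²θ = Σ.
  have e0 : a * sin (q 2) * pd M 0 (elec a F) q + (q 1 ^ 2 + a ^ 2) * pd M 0 (axial a F) q
      = -(Sig a q * pd M 0 (lower F 1 3) q / sin (q 2)) := by
    rw [pd_elec hM hW hF hq (by decide), pd_axial hM hW hF hq (by decide)]
    field_simp
    rw [hSig]; ring
  have e3 : pd M 3 (elec a F) q / sin (q 2) + a * pd M 3 (axial a F) q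
      = -(Sig a q * pd M 3 (lower F 0 1) q / sin (q 2)) := by
    rw [pd_elec hM hW hF hq (by decide), pd_axial hM hW hF hq (by decide)]
    field_simp
    rw [hSig]; ring
  linear_combination -h5 - Sig a q * h3 - h4 + a * h2 - e0 - e3 + Sig a q / sin (q 2) * h1
    + pd M 0 (axial a F) q * hSig

end Real

end KerrMaxwell
end

noncomputable section

namespace KerrMaxwell

open Function (update)
open scoped ContDiff

variable {M a : ℝ} {W : Set (ℝ × ℝ)} {F : TwoForm} {q : Fin 4 → ℝ}

/-! ### The complex Maxwell components, regular on the axis -/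

/-- `κ̄ = r + i a cos θ`. -/
def kapBar (a : ℝ) (q : Fin 4 → ℝ) : ℂ := (q 1 : ℂ) + Complex.I * a * cos (q 2)

theorem kap_mul_kapBar (a : ℝ) (q : Fin 4 → ℝ) : kap a q * kapBar a q = (Sig a q : ℂ) := by
  simp only [kap, kapBar, Sig]
  push_cast
  linear_combination (-(a : ℂ) ^ 2 * Complex.cos (q 2) ^ 2) * Complex.I_sq

theorem kapBar_ne_zero (hM : 0 < M) (hq : M ≤ q 1) : kapBar a q ≠ 0 := by
  have h : (Sig a q : ℂ) ≠ 0 := by exact_mod_cast (Sig_pos hM hq).ne'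
  rw [← kap_mul_kapBar] at h
  exact right_ne_zero_of_mul h

theorem kap_ne_zero (hM : 0 < M) (hq : M ≤ q 1) : kap a q ≠ 0 := by
  have h : (Sig a q : ℂ) ≠ 0 := by exact_mod_cast (Sig_pos hM hq).ne'
  rw [← kap_mul_kapBar] at h
  exact left_ne_zero_of_mul h

/-- `√2 κ̄ Δ⁻¹ α^{[-1]} = F_{rθ} + i (a sin θ F_{vr} - F_{rφ} / sin θ)`. -/
def extreme (a : ℝ) (F : TwoForm) (q : Fin 4 → ℝ) : ℂ :=
  (lower F 1 2 q : ℂ) + Complex.I * ((a * sin (q 2) * lower F 0 1 q - regular F 1 3 q : ℝ) : ℂ)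

/-- `Σ (-ρ + i σ)`. -/
def middle (a : ℝ) (F : TwoForm) (q : Fin 4 → ℝ) : ℂ :=
  ((-(q 1 ^ 2 + a ^ 2) * lower F 0 1 q + a * sin (q 2) * regular F 1 3 q : ℝ) : ℂ)
    + Complex.I * ((-(a * sin (q 2)) * lower F 0 2 q + regular F 2 3 q : ℝ) : ℂ)

/-- `Υ^{[0]}`, regular on the axis. -/
def upsReg (a : ℝ) (F : TwoForm) (q : Fin 4 → ℝ) : ℂ := kap a q * (kapBar a q)⁻¹ * middle a F q

/-- `φ̃₀^{[-1]}`, regular on the axis. -/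
def phiReg (a : ℝ) (F : TwoForm) (q : Fin 4 → ℝ) : ℂ :=
  ((√(q 1 ^ 2 + a ^ 2) / √2 : ℝ) : ℂ) * ((kapBar a q)⁻¹ * extreme a F q)

theorem regular_three (hs : sin (q 2) ≠ 0) {i : Fin 4} (hi : i ≠ 3) :
    regular F i 3 q = lower F i 3 q / sin (q 2) := by
  rw [lower_three F hi]; field_simp

theorem extreme_eq (hs : sin (q 2) ≠ 0) :
    extreme a F q = (lower F 1 2 q : ℂ) + Complex.I * (axial a F q : ℂ) := by
  rw [extreme, axial, regular_three hs (by decide)]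

theorem middle_eq (hs : sin (q 2) ≠ 0) :
    middle a F q = (elec a F q : ℂ) + Complex.I * (magn a F q : ℂ) := by
  rw [middle, elec, magn, regular_three hs (by decide), regular_three hs (by decide)]
  congr 3
  field_simp

theorem contDiff_kap : ContDiff ℝ ∞ (kap a) := by
  have h1 : ContDiff ℝ ∞ (fun q : Fin 4 → ℝ => ((q 1 : ℝ) : ℂ)) :=
    Complex.ofRealCLM.contDiff.comp (by fun_prop)
  have h0 : ContDiff ℝ ∞ (fun q : Fin 4 → ℝ => cos (q 2)) := by fun_prop
  have h2 : ContDiff ℝ ∞ (fun q : Fin 4 → ℝ => ((cos (q 2) : ℝ) : ℂ)) := Complex.ofRealCLM.contDiff.comp h0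
  exact h1.sub (contDiff_const.mul h2)

theorem contDiff_kapBar : ContDiff ℝ ∞ (kapBar a) := by
  have h1 : ContDiff ℝ ∞ (fun q : Fin 4 → ℝ => ((q 1 : ℝ) : ℂ)) :=
    Complex.ofRealCLM.contDiff.comp (by fun_prop)
  have h0 : ContDiff ℝ ∞ (fun q : Fin 4 → ℝ => cos (q 2)) := by fun_prop
  have h2 : ContDiff ℝ ∞ (fun q : Fin 4 → ℝ => ((cos (q 2) : ℝ) : ℂ)) := Complex.ofRealCLM.contDiff.comp h0
  exact h1.add (contDiff_const.mul h2)

theorem Smooth.ofReal {f : (Fin 4 → ℝ) → ℝ} (hf : Smooth M W f) : Smooth M W fun q => (f q : ℂ) :=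
  Complex.ofRealCLM.contDiff.comp_contDiffOn hf

theorem Smooth.mul {𝔸 : Type*} [NormedRing 𝔸] [NormedAlgebra ℝ 𝔸] {f g : (Fin 4 → ℝ) → 𝔸}
    (hf : Smooth M W f) (hg : Smooth M W g) : Smooth M W fun q => f q * g q := ContDiffOn.mul hf hg

theorem Smooth.add {E : Type*} [NormedAddCommGroup E] [NormedSpace ℝ E] {f g : (Fin 4 → ℝ) → E}
    (hf : Smooth M W f) (hg : Smooth M W g) : Smooth M W fun q => f q + g q := ContDiffOn.add hf hg

theorem smooth_of_contDiff {E : Type*} [NormedAddCommGroup E] [NormedSpace ℝ E] {f : (Fin 4 → ℝ) → E}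
    (hf : ContDiff ℝ ∞ f) : Smooth M W f := hf.contDiffOn

theorem smooth_kapBar_inv (hM : 0 < M) : Smooth M W fun q => (kapBar a q)⁻¹ :=
  contDiff_kapBar.contDiffOn.inv fun _ hq => kapBar_ne_zero hM hq.1

theorem smooth_extreme (hM : 0 < M) (hF : IsMaxwellField M a W F) : Smooth M W (extreme a F) := by
  have h12 := smooth_lower hM hF.smooth 1 2
  have h01 : ContDiffOn ℝ ∞ _ _ := smooth_lower hM hF.smooth 0 1
  have h13 : ContDiffOn ℝ ∞ _ _ := smooth_regular hM hF.smooth 1 3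
  have h : Smooth M W fun q => a * sin (q 2) * lower F 0 1 q - regular F 1 3 q := by
    unfold Smooth; fun_prop
  exact h12.ofReal.add ((smooth_of_contDiff contDiff_const).mul h.ofReal)

theorem smooth_middle (hM : 0 < M) (hF : IsMaxwellField M a W F) : Smooth M W (middle a F) := by
  have h01 : ContDiffOn ℝ ∞ _ _ := smooth_lower hM hF.smooth 0 1
  have h02 : ContDiffOn ℝ ∞ _ _ := smooth_lower hM hF.smooth 0 2
  have h13 : ContDiffOn ℝ ∞ _ _ := smooth_regular hM hF.smooth 1 3
  have h23 : ContDiffOn ℝ ∞ _ _ := smooth_regular hM hF.smooth 2 3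
  have h1 : Smooth M W fun q => -(q 1 ^ 2 + a ^ 2) * lower F 0 1 q + a * sin (q 2) * regular F 1 3 q := by
    unfold Smooth; fun_prop
  have h2 : Smooth M W fun q => -(a * sin (q 2)) * lower F 0 2 q + regular F 2 3 q := by
    unfold Smooth; fun_prop
  exact h1.ofReal.add ((smooth_of_contDiff contDiff_const).mul h2.ofReal)

theorem smooth_upsReg (hM : 0 < M) (hF : IsMaxwellField M a W F) : Smooth M W (upsReg a F) :=
  ((smooth_of_contDiff contDiff_kap).mul (smooth_kapBar_inv hM)).mul (smooth_middle hM hF)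

theorem radial_pos (hM : 0 < M) (hq : M ≤ q 1) : 0 < q 1 ^ 2 + a ^ 2 := by
  have : 0 < q 1 ^ 2 := pow_pos (hM.trans_le hq) 2
  positivity

theorem smooth_sqrt (hM : 0 < M) : Smooth M W fun q => √(q 1 ^ 2 + a ^ 2) / √2 := by
  refine ContDiffOn.div_const (ContDiffOn.sqrt (by fun_prop) fun q hq => (radial_pos hM hq.1).ne') _

theorem smooth_phiReg (hM : 0 < M) (hF : IsMaxwellField M a W F) : Smooth M W (phiReg a F) :=
  (smooth_sqrt hM).ofReal.mul ((smooth_kapBar_inv hM).mul (smooth_extreme hM hF))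

theorem evalOn_eq_sum (X Y : Fin 4 → ℝ) : evalOn F q X Y = ∑ i, ∑ j, X i * Y j * lower F i j q := by
  unfold evalOn lower
  have e : ∀ (x y : Fin 4 → ℝ) z, update ![x, y] 0 z = ![z, y] := by
    intro x y z; funext k; fin_cases k <;> rfl
  have hl : ∀ (c : ℝ) (x y : Fin 4 → ℝ), F (pt q) ![c • x, y] = c * F (pt q) ![x, y] := by
    intro c x y
    have h := (F (pt q)).map_update_smul ![x, y] 0 c x
    rwa [e, e] at h
  have ha : ∀ x x' y : Fin 4 → ℝ, F (pt q) ![x + x', y] = F (pt q) ![x, y] + F (pt q) ![x', y] := by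
    intro x x' y
    have h := (F (pt q)).map_update_add ![x, y] 0 x x'
    rwa [e, e, e] at h
  have e' : ∀ (x y : Fin 4 → ℝ) z, update ![x, y] 1 z = ![x, z] := by
    intro x y z; funext k; fin_cases k <;> rfl
  have ha' : ∀ x y y' : Fin 4 → ℝ, F (pt q) ![x, y + y'] = F (pt q) ![x, y] + F (pt q) ![x, y'] := by
    intro x y y'
    have h := (F (pt q)).map_update_add ![x, y] 1 y y'
    rwa [e', e', e'] at h
  simp only [Fin.sum_univ_four, ha, ha', hl, map_vec_smul_right]
  ring

theorem rho_eq (hS : Sig a q ≠ 0) : rho M a F q = -elec a F q / Sig a q := by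
  simp only [rho, evalOn_eq_sum, Fin.sum_univ_four, e3, e4, Matrix.cons_val, lower_self, elec]
  rw [lower_swap F 0 1]
  field_simp
  ring

theorem sigma_eq (hS : Sig a q ≠ 0) (hs : sin (q 2) ≠ 0) : sigma a F q = magn a F q / Sig a q := by
  simp only [sigma, evalOn_eq_sum, Fin.sum_univ_four, e1, e2, Matrix.cons_val, lower_self, magn]
  rw [lower_swap F 0 2, lower_swap F 0 3, lower_swap F 2 3]
  field_simp
  simp only [Sig]
  ring

/-- The hatted components are real and imaginary parts of a rotation: Υ = κ²(-ρ + iσ), and κ² / Σ =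
κ / κ̄. -/
theorem Ups_eq (hM : 0 < M) : EqOn (Ups M a F) (upsReg a F) (chart M W) := fun q hq => by
  have hS := (Sig_pos (a := a) hM hq.1).ne'
  have hs := (sin_pos_of_mem_chart hq).ne'
  rw [Ups, rhoHat, sigmaHat, rho_eq hS, sigma_eq hS hs, upsReg, middle_eq hs]
  have hS' : (Sig a q : ℂ) ≠ 0 := by exact_mod_cast hS
  have hk := kapBar_ne_zero (a := a) hM hq.1
  have hkk := kap_mul_kapBar a q
  have e : kap a q * (kapBar a q)⁻¹ = kap a q ^ 2 / Sig a q := by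
    rw [← hkk]; field_simp
  rw [e]
  simp only [kap]
  push_cast [-Complex.ofReal_cos]
  field_simp
  linear_combination (-(a : ℂ) ^ 2 * (cos (q 2) : ℂ) ^ 2 * elec a F q
    + 2 * a * q 1 * (cos (q 2) : ℂ) * magn a F q
    - Complex.I * (a : ℂ) ^ 2 * (cos (q 2) : ℂ) ^ 2 * magn a F q) * Complex.I_sq

/-- Contraction with e₁ - ie₂ produces the factor κ̄ / Σ; together with κ² / Σ it leaves 1 / κ̄,
because Σ = κκ̄. -/
theorem phi0_eq (hM : 0 < M) : EqOn (phi0 a F) (phiReg a F) (chart M W) := fun q hq => by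
  have hS := (Sig_pos (a := a) hM hq.1).ne'
  have hs := (sin_pos_of_mem_chart hq).ne'
  have hS' : (Sig a q : ℂ) ≠ 0 := by exact_mod_cast hS
  have hs' : (sin (q 2) : ℂ) ≠ 0 := by exact_mod_cast hs
  have hk := kapBar_ne_zero (a := a) hM hq.1
  have h2 : ((√2 : ℝ) : ℂ) ≠ 0 := by simp
  have e : (evalOn F q (e1 a q) (e3 q) : ℂ) - Complex.I * evalOn F q (e2 a q) (e3 q)
      = kapBar a q / Sig a q * (lower F 1 2 q + Complex.I * axial a F q) := by
    simp only [evalOn_eq_sum, Fin.sum_univ_four, e1, e2, e3, Matrix.cons_val, lower_self, axial, kapBar]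
    rw [lower_swap F 1 2, lower_swap F 1 3]
    push_cast [-Complex.ofReal_cos, -Complex.ofReal_sin]
    field_simp
    linear_combination (-(a : ℂ) ^ 2 * (cos (q 2) : ℂ) * (sin (q 2) : ℂ) ^ 2 * lower F 0 1 q
      + a * (cos (q 2) : ℂ) * lower F 1 3 q) * Complex.I_sq
  rw [phi0, alphaNeg, phiReg, extreme_eq hs, e]
  have hk' := kap_ne_zero (a := a) hM hq.1
  push_cast [-Complex.ofReal_cos, -Complex.ofReal_sin]
  rw [← kap_mul_kapBar]
  field_simp

end KerrMaxwell
end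

noncomputable section

namespace KerrMaxwell

open Function (update)
open scoped ContDiff

variable {M a : ℝ} {W : Set (ℝ × ℝ)} {F : TwoForm} {q : Fin 4 → ℝ}

/-! ### The complex Maxwell equations -/

theorem HasPartial.inv {k : Fin 4} {f : (Fin 4 → ℝ) → ℂ} {f' : ℂ} (hf : HasPartial M k f f' q) (h : f q ≠ 0) :
    HasPartial M k (fun p => (f p)⁻¹) (-f' / f q ^ 2) q := by
  have := HasDerivWithinAt.fun_inv hf (by simpa using h)
  simp only [Function.update_eq_self] at this
  exact this

theorem hasPartial_radius : HasPartial M 1 (fun p => ((p 1 : ℝ) : ℂ)) 1 q :=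
  (HasPartial.ofReal (hasPartial_coord_self (g := fun t : ℝ => t) (hasDerivAt_id (q 1)))).congr_deriv (by simp)

theorem hasPartial_radius_of_ne {k : Fin 4} (hk : k ≠ 1) : HasPartial M k (fun p => ((p 1 : ℝ) : ℂ)) 0 q :=
  hasPartial_coord_of_ne (fun t : ℝ => (t : ℂ)) hk

theorem hasPartial_kapBar_one : HasPartial M 1 (kapBar a) 1 q :=
  (hasPartial_radius.add (hasPartial_theta_of_ne (fun t => Complex.I * a * (cos t : ℂ)) (by decide))).congr_deriv
    (by simp)

theorem hasPartial_kapBar_two : HasPartial M 2 (kapBar a) (-(Complex.I * a * sin (q 2))) q :=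
  ((hasPartial_radius_of_ne (by decide)).add (hasPartial_cos.ofReal.const_mul (Complex.I * a))).congr_deriv
    (by push_cast; ring)

theorem hasPartial_kapBar_of_ne {k : Fin 4} (h1 : k ≠ 1) (h2 : k ≠ 2) : HasPartial M k (kapBar a) 0 q :=
  ((hasPartial_radius_of_ne h1).add
    (hasPartial_theta_of_ne (fun t => Complex.I * a * (cos t : ℂ)) h2)).congr_deriv (by simp)

theorem hasPartial_kap_one : HasPartial M 1 (kap a) 1 q :=
  (hasPartial_radius.sub (hasPartial_theta_of_ne (fun t => Complex.I * a * (cos t : ℂ)) (by decide))).congr_deriv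
    (by simp)

theorem hasPartial_kap_two : HasPartial M 2 (kap a) (Complex.I * a * sin (q 2)) q :=
  ((hasPartial_radius_of_ne (by decide)).sub (hasPartial_cos.ofReal.const_mul (Complex.I * a))).congr_deriv
    (by push_cast; ring)

theorem hasPartial_kap_of_ne {k : Fin 4} (h1 : k ≠ 1) (h2 : k ≠ 2) : HasPartial M k (kap a) 0 q :=
  ((hasPartial_radius_of_ne h1).sub
    (hasPartial_theta_of_ne (fun t => Complex.I * a * (cos t : ℂ)) h2)).congr_deriv (by simp)

/-- `κ / κ̄`. -/
def phase (a : ℝ) (q : Fin 4 → ℝ) : ℂ := kap a q * (kapBar a q)⁻¹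

/-- The logarithmic derivatives of κ / κ̄ in r and θ are exactly opposite to the zeroth-order
coefficients of the middle components in the Maxwell equations. Hence Υ appears below only
differentiated. -/
theorem hasPartial_phase_one (hM : 0 < M) (hq : M ≤ q 1) :
    HasPartial M 1 (phase a) (phase a q * (2 * Complex.I * a * cos (q 2) / Sig a q)) q := by
  have hk := kapBar_ne_zero (a := a) hM hq
  have hk' := kap_ne_zero (a := a) hM hq
  refine (hasPartial_kap_one.mul (hasPartial_kapBar_one.inv hk)).congr_deriv ?_
  rw [phase, ← kap_mul_kapBar]
  field_simp
  simp only [kap, kapBar]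
  ring

theorem hasPartial_phase_two (hM : 0 < M) (hq : M ≤ q 1) :
    HasPartial M 2 (phase a) (phase a q * (2 * Complex.I * a * sin (q 2) * q 1 / Sig a q)) q := by
  have hk := kapBar_ne_zero (a := a) hM hq
  have hk' := kap_ne_zero (a := a) hM hq
  refine (hasPartial_kap_two.mul (hasPartial_kapBar_two.inv hk)).congr_deriv ?_
  rw [phase, ← kap_mul_kapBar]
  field_simp
  simp only [kap, kapBar]
  ring

theorem hasPartial_phase_of_ne (hM : 0 < M) (hq : M ≤ q 1) {k : Fin 4} (h1 : k ≠ 1) (h2 : k ≠ 2) :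
    HasPartial M k (phase a) 0 q :=
  ((hasPartial_kap_of_ne h1 h2).mul ((hasPartial_kapBar_of_ne h1 h2).inv
    (kapBar_ne_zero (a := a) hM hq))).congr_deriv (by simp)

theorem upsReg_eq_phase_mul : upsReg a F = fun q => phase a q * middle a F q := rfl

section Complex

variable (hM : 0 < M) (hW : IsOpen W) (hF : IsMaxwellField M a W F)
include hM hW hF

theorem pd_extreme (hq : q ∈ chart M W) (k : Fin 4) :
    pd M k (extreme a F) q = ((pd M k (lower F 1 2) q : ℝ) : ℂ) + Complex.I * ((pd M k (axial a F) q : ℝ) : ℂ) :=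
  (hasPartial_congr hW (fun _ hp => extreme_eq (sin_pos_of_mem_chart hp).ne') hq
    ((hasPartial_lower hM hW hF hq 1 2 k).ofReal.add
      ((hasPartial_axial hM hW hF hq k).ofReal.const_mul Complex.I))).pd_eq hq.1

theorem pd_middle (hq : q ∈ chart M W) (k : Fin 4) :
    pd M k (middle a F) q = ((pd M k (elec a F) q : ℝ) : ℂ) + Complex.I * ((pd M k (magn a F) q : ℝ) : ℂ) :=
  (hasPartial_congr hW (fun _ hp => middle_eq (sin_pos_of_mem_chart hp).ne') hq
    ((hasPartial_elec hM hW hF hq k).ofReal.add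
      ((hasPartial_magn hM hW hF hq k).ofReal.const_mul Complex.I))).pd_eq hq.1

theorem hasPartial_extreme (hq : q ∈ dom M W) (k : Fin 4) :
    HasPartial M k (extreme a F) (pd M k (extreme a F) q) q := (smooth_extreme hM hF).hasPartial hW hq

theorem hasPartial_middle (hq : q ∈ dom M W) (k : Fin 4) :
    HasPartial M k (middle a F) (pd M k (middle a F) q) q := (smooth_middle hM hF).hasPartial hW hq

/-- Axisymmetry is assumed for α alone; it passes to `extreme` because the two differ by a nowhere
vanishing factor independent of φ. -/
theorem pd_three_extreme (hZ : ∀ q ∈ chart M W, pd M 3 (alphaNeg a F) q = 0) :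
    EqOn (pd M 3 (extreme a F)) (fun _ => 0) (chart M W) := fun q hq => by
  have h2 : ((√2 : ℝ) : ℂ) ≠ 0 := by simp
  have hk := kapBar_ne_zero (a := a) hM hq.1
  have e : EqOn (alphaNeg a F) (fun p => ((√2 : ℝ) : ℂ)⁻¹ * ((kapBar a p)⁻¹ * extreme a F p)) (chart M W) :=
    fun p hp => by
      have h := phi0_eq (F := F) (a := a) hM hp
      rw [phi0, phiReg] at h
      have hR : ((√(p 1 ^ 2 + a ^ 2) : ℝ) : ℂ) ≠ 0 := by
        have := (Real.sqrt_pos.2 (radial_pos (a := a) hM hp.1)).ne'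
        exact_mod_cast this
      refine mul_left_cancel₀ hR (h.trans ?_)
      push_cast
      ring
  have h1 := hZ q hq
  have h3 := (((hasPartial_kapBar_of_ne (by decide : (3 : Fin 4) ≠ 1) (by decide)).inv hk).mul
    (hasPartial_extreme hM hW hF (chart_subset_dom hq) 3)).const_mul ((√2 : ℝ) : ℂ)⁻¹
  rw [(hasPartial_congr hW e hq h3).pd_eq hq.1] at h1
  simpa [hk] using h1

/-- The angular operator acting on `extreme` in the transversal Maxwell equation. -/
def angular (M a : ℝ) (F : TwoForm) (q : Fin 4 → ℝ) : ℂ :=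
  pd M 2 (extreme a F) q + ((cos (q 2) / sin (q 2) : ℝ) : ℂ) * extreme a F q
    + 2 * (a : ℂ) ^ 2 * (((sin (q 2) * cos (q 2)) / Sig a q : ℝ) : ℂ) * extreme a F q
    + Complex.I * a * ((sin (q 2) : ℂ) * pd M 0 (extreme a F) q)

/-- `sin_mul_pd_elec` plus i times `sin_mul_pd_magn`. The undifferentiated `middle` cancels against
the derivative of the phase, and the ∂_φ term vanishes by axisymmetry. -/
theorem pd_one_upsReg (hZ : ∀ q ∈ chart M W, pd M 3 (alphaNeg a F) q = 0) :
    EqOn (pd M 1 (upsReg a F)) (fun q => -(phase a q * angular M a F q)) (chart M W) := fun q hq => by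
  have hs := (sin_pos_of_mem_chart hq).ne'
  have hs' : (sin (q 2) : ℂ) ≠ 0 := by exact_mod_cast hs
  have hS' : (Sig a q : ℂ) ≠ 0 := by exact_mod_cast (Sig_pos (a := a) hM hq.1).ne'
  have h := ((hasPartial_phase_one (a := a) hM hq.1).mul
    (hasPartial_middle hM hW hF (chart_subset_dom hq) 1)).pd_eq hq.1
  rw [upsReg_eq_phase_mul, h, pd_middle hM hW hF hq, middle_eq hs]
  have h3 := pd_three_extreme hM hW hF hZ hq
  simp only [pd_extreme hM hW hF hq] at h3
  simp only [angular, pd_extreme hM hW hF hq, extreme_eq hs]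
  have c1 := congrArg (fun x : ℝ => (x : ℂ)) (sin_mul_pd_elec hM hW hF hq)
  have c2 := congrArg (fun x : ℝ => (x : ℂ)) (sin_mul_pd_magn hM hW hF hq)
  push_cast [-Complex.ofReal_cos, -Complex.ofReal_sin] at c1 c2 ⊢
  field_simp at c1 c2 ⊢
  linear_combination (phase a q) * (c1 + Complex.I * c2) - Complex.I * phase a q * Sig a q * h3
    + phase a q * (2 * (sin (q 2) : ℂ) * (cos (q 2) : ℂ) * a * magn a F q
      + a * (sin (q 2) : ℂ) ^ 2 * Sig a q * (pd M 0 (axial a F) q : ℝ)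
      + Sig a q * (pd M 3 (axial a F) q : ℝ)) * Complex.I_sq

/-- `pd_two_elec` plus i times `pd_two_magn`, with the same two cancellations. -/
theorem pd_two_upsReg (hZ : ∀ q ∈ chart M W, pd M 3 (alphaNeg a F) q = 0) :
    EqOn (fun q => pd M 2 (upsReg a F) q - Complex.I * (a * ((sin (q 2) : ℂ) * pd M 0 (upsReg a F) q)
        + ((sin (q 2))⁻¹ : ℝ) * pd M 3 (upsReg a F) q))
      (fun q => phase a q * (2 * ((q 1 ^ 2 + a ^ 2 : ℝ) : ℂ) * pd M 0 (extreme a F) q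
        + ((2 * q 1 - 2 * M : ℝ) : ℂ) * extreme a F q + (Del M a q : ℂ) * pd M 1 (extreme a F) q
        - ((Del M a q * (2 * q 1) : ℝ) : ℂ) * (((Sig a q : ℝ) : ℂ)⁻¹ * extreme a F q))) (chart M W) := fun q hq => by
  have hs := (sin_pos_of_mem_chart hq).ne'
  have hs' : (sin (q 2) : ℂ) ≠ 0 := by exact_mod_cast hs
  have hS' : (Sig a q : ℂ) ≠ 0 := by exact_mod_cast (Sig_pos (a := a) hM hq.1).ne'
  have h := fun k => hasPartial_middle hM hW hF (chart_subset_dom hq) k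
  have u0 := ((hasPartial_phase_of_ne (a := a) hM hq.1 (by decide : (0 : Fin 4) ≠ 1) (by decide)).mul (h 0)).pd_eq hq.1
  have u3 := ((hasPartial_phase_of_ne (a := a) hM hq.1 (by decide : (3 : Fin 4) ≠ 1) (by decide)).mul (h 3)).pd_eq hq.1
  have u2 := ((hasPartial_phase_two (a := a) hM hq.1).mul (h 2)).pd_eq hq.1
  have h3 := pd_three_extreme hM hW hF hZ hq
  simp only [upsReg_eq_phase_mul, u0, u2, u3]
  simp only [pd_extreme hM hW hF hq] at h3
  simp only [pd_middle hM hW hF hq, middle_eq hs, pd_extreme hM hW hF hq, extreme_eq hs]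
  have c1 := congrArg (fun x : ℝ => (x : ℂ)) (pd_two_elec hM hW hF hq)
  have c2 := congrArg (fun x : ℝ => (x : ℂ)) (pd_two_magn hM hW hF hq)
  push_cast [-Complex.ofReal_cos, -Complex.ofReal_sin] at c1 c2 ⊢
  field_simp at c1 c2 ⊢
  linear_combination (phase a q) * (c1 + Complex.I * c2) + 2 * a * (sin (q 2) : ℂ) * phase a q * Sig a q * h3
    + phase a q * (2 * (sin (q 2) : ℂ) ^ 2 * a * q 1 * magn a F q
      - a * (sin (q 2) : ℂ) ^ 2 * Sig a q * (pd M 0 (magn a F) q : ℝ)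
      - Sig a q * (pd M 3 (magn a F) q : ℝ)) * Complex.I_sq

end Complex

end KerrMaxwell
end

noncomputable section

namespace KerrMaxwell

open Function (update)
open scoped ContDiff

variable {M a : ℝ} {W : Set (ℝ × ℝ)} {F : TwoForm} {q : Fin 4 → ℝ}

/-! ### The Teukolsky equation on the horizon -/

theorem hasPartial_cot (hs : sin (q 2) ≠ 0) :
    HasPartial M 2 (fun p => ((cos (p 2) / sin (p 2) : ℝ) : ℂ)) (((-1 / sin (q 2) ^ 2 : ℝ) : ℂ)) q := by
  have h : HasDerivAt (fun t => cos t / sin t) (-1 / sin (q 2) ^ 2) (q 2) := by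
    refine ((hasDerivAt_cos (q 2)).div (hasDerivAt_sin (q 2)) hs).congr_deriv ?_
    have := sin_sq_add_cos_sq (q 2)
    field_simp
    linear_combination -this
  exact (hasPartial_coord_self (g := fun t => cos t / sin t) h).ofReal

/-- `√2 Δ⁻¹ α^{[-1]}`, regular on the axis. -/
def core (a : ℝ) (F : TwoForm) (q : Fin 4 → ℝ) : ℂ := (kapBar a q)⁻¹ * extreme a F q

theorem smooth_core (hM : 0 < M) (hF : IsMaxwellField M a W F) : Smooth M W (core a F) :=
  (smooth_kapBar_inv hM).mul (smooth_extreme hM hF)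

theorem extreme_eq_mul (hM : 0 < M) : EqOn (extreme a F) (fun q => kapBar a q * core a F q) (dom M W) :=
  fun q hq => by
    have := kapBar_ne_zero (a := a) hM hq.1
    simp only [core]
    field_simp

/-- `e₃ Υ^{[0]}` in terms of `core`. -/
def transversal (M a : ℝ) (F : TwoForm) (q : Fin 4 → ℝ) : ℂ :=
  kap a q * (pd M 2 (core a F) q + ((cos (q 2) / sin (q 2) : ℝ) : ℂ) * core a F q
    + Complex.I * a * ((sin (q 2) : ℂ) * pd M 0 (core a F) q))
    - Complex.I * a * ((sin (q 2) : ℂ) * core a F q)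

section Complex

variable (hM : 0 < M) (hW : IsOpen W) (hF : IsMaxwellField M a W F)
include hM hW hF

theorem hasPartial_core (hq : q ∈ dom M W) (k : Fin 4) :
    HasPartial M k (core a F) (pd M k (core a F) q) q := (smooth_core hM hF).hasPartial hW hq

theorem hasPartial_pd_core (hq : q ∈ dom M W) (k l : Fin 4) :
    HasPartial M k (pd M l (core a F)) (pd M k (pd M l (core a F)) q) q :=
  ((smooth_core hM hF).pd hW l).hasPartial hW hq

theorem pd_one_extreme (hq : q ∈ dom M W) :
    pd M 1 (extreme a F) q = core a F q + kapBar a q * pd M 1 (core a F) q :=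
  ((hasPartial_congr_dom hW (extreme_eq_mul hM) hq (hasPartial_kapBar_one.mul
    (hasPartial_core hM hW hF hq 1))).congr_deriv (by ring)).pd_eq hq.1

theorem pd_two_extreme (hq : q ∈ dom M W) : pd M 2 (extreme a F) q =
    -(Complex.I * a * sin (q 2)) * core a F q + kapBar a q * pd M 2 (core a F) q :=
  (hasPartial_congr_dom hW (extreme_eq_mul hM) hq (hasPartial_kapBar_two.mul
    (hasPartial_core hM hW hF hq 2))).pd_eq hq.1

theorem pd_extreme_of_ne (hq : q ∈ dom M W) {k : Fin 4} (h1 : k ≠ 1) (h2 : k ≠ 2) :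
    pd M k (extreme a F) q = kapBar a q * pd M k (core a F) q :=
  ((hasPartial_congr_dom hW (extreme_eq_mul hM) hq ((hasPartial_kapBar_of_ne h1 h2).mul
    (hasPartial_core hM hW hF hq k))).congr_deriv (by ring)).pd_eq hq.1

/-- Since `transversal` is -∂_r Υ, its derivatives in θ, v and φ are the mixed derivatives of Υ
needed to cross-differentiate in `core_teukolsky`. -/
theorem pd_two_transversal (hq : q ∈ chart M W) : HasPartial M 2 (transversal M a F)
    (kap a q * (pd M 2 (pd M 2 (core a F)) q + ((cos (q 2) / sin (q 2) : ℝ) : ℂ) * pd M 2 (core a F) q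
      + ((-1 / sin (q 2) ^ 2 : ℝ) : ℂ) * core a F q
      + Complex.I * a * ((cos (q 2) : ℂ) * pd M 0 (core a F) q + (sin (q 2) : ℂ) * pd M 2 (pd M 0 (core a F)) q))
      + Complex.I * a * sin (q 2) * (Complex.I * a * ((sin (q 2) : ℂ) * pd M 0 (core a F) q))) q := by
  have hs := (sin_pos_of_mem_chart hq).ne'
  have hs' : (sin (q 2) : ℂ) ≠ 0 := by exact_mod_cast hs
  have hd := chart_subset_dom hq
  have hc := hasPartial_core hM hW hF hd
  have hc2 := hasPartial_pd_core hM hW hF hd 2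
  have hsin : HasPartial M 2 (fun p => (sin (p 2) : ℂ)) (cos (q 2) : ℂ) q := hasPartial_sin.ofReal
  refine ((hasPartial_kap_two.mul (((hc2 2).add ((hasPartial_cot hs).mul (hc 2))).add
    ((hsin.mul (hc2 0)).const_mul (Complex.I * a)))).sub
    ((hsin.mul (hc 2)).const_mul (Complex.I * a))).congr_deriv ?_
  push_cast [-Complex.ofReal_cos, -Complex.ofReal_sin]
  field_simp
  ring

theorem pd_zero_transversal (hq : q ∈ chart M W) : HasPartial M 0 (transversal M a F)
    (kap a q * (pd M 0 (pd M 2 (core a F)) q + ((cos (q 2) / sin (q 2) : ℝ) : ℂ) * pd M 0 (core a F) q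
      + Complex.I * a * ((sin (q 2) : ℂ) * pd M 0 (pd M 0 (core a F)) q))
      - Complex.I * a * ((sin (q 2) : ℂ) * pd M 0 (core a F) q)) q := by
  have hd := chart_subset_dom hq
  have hc := hasPartial_core hM hW hF hd
  have hc2 := hasPartial_pd_core hM hW hF hd 0
  have ht : ∀ g : ℝ → ℂ, HasPartial M 0 (fun p => g (p 2)) 0 q := fun g => hasPartial_theta_of_ne g (by decide)
  refine (((hasPartial_kap_of_ne (by decide) (by decide)).mul (((hc2 2).add
    ((ht fun t => ((cos t / sin t : ℝ) : ℂ)).mul (hc 0))).add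
    (((ht fun t => (sin t : ℂ)).mul (hc2 0)).const_mul (Complex.I * a)))).sub
    (((ht fun t => (sin t : ℂ)).mul (hc 0)).const_mul (Complex.I * a))).congr_deriv ?_
  ring

variable (hZ : ∀ q ∈ chart M W, pd M 3 (alphaNeg a F) q = 0)
include hZ

theorem pd_three_core : EqOn (pd M 3 (core a F)) (fun _ => 0) (chart M W) := fun q hq => by
  have h := pd_three_extreme hM hW hF hZ hq
  rw [pd_extreme_of_ne hM hW hF (chart_subset_dom hq) (by decide) (by decide)] at h
  exact (mul_eq_zero.1 h).resolve_left (kapBar_ne_zero hM hq.1)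

theorem pd_one_upsReg_eq_transversal :
    EqOn (pd M 1 (upsReg a F)) (fun q => -transversal M a F q) (chart M W) := fun q hq => by
  have hs := (sin_pos_of_mem_chart hq).ne'
  have hs' : (sin (q 2) : ℂ) ≠ 0 := by exact_mod_cast hs
  have hk := kapBar_ne_zero (a := a) hM hq.1
  have hk' := kap_ne_zero (a := a) hM hq.1
  have hd := chart_subset_dom hq
  simp only [pd_one_upsReg hM hW hF hZ hq, angular, transversal, phase, pd_two_extreme hM hW hF hd,
    pd_extreme_of_ne hM hW hF hd (by decide : (0 : Fin 4) ≠ 1) (by decide), extreme_eq_mul hM hd]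
  push_cast [-Complex.ofReal_cos, -Complex.ofReal_sin]
  rw [← kap_mul_kapBar]
  field_simp
  simp only [kap, kapBar]
  ring_nf
  simp only [Complex.I_sq]
  ring

theorem pd_two_upsReg_eq :
    EqOn (fun q => pd M 2 (upsReg a F) q - Complex.I * (a * ((sin (q 2) : ℂ) * pd M 0 (upsReg a F) q)
        + ((sin (q 2))⁻¹ : ℝ) * pd M 3 (upsReg a F) q))
      (fun q => kap a q * (2 * ((q 1 ^ 2 + a ^ 2 : ℝ) : ℂ) * pd M 0 (core a F) q
        + ((2 * q 1 - 2 * M : ℝ) : ℂ) * core a F q + (Del M a q : ℂ) * pd M 1 (core a F) q)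
        - (Del M a q : ℂ) * core a F q) (chart M W) := fun q hq => by
  have hk := kapBar_ne_zero (a := a) hM hq.1
  have hk' := kap_ne_zero (a := a) hM hq.1
  have hd := chart_subset_dom hq
  refine (pd_two_upsReg hM hW hF hZ hq).trans ?_
  simp only [phase, pd_one_extreme hM hW hF hd,
    pd_extreme_of_ne hM hW hF hd (by decide : (0 : Fin 4) ≠ 1) (by decide), extreme_eq_mul hM hd]
  push_cast [-Complex.ofReal_cos, -Complex.ofReal_sin]
  rw [← kap_mul_kapBar]
  field_simp
  simp only [kap, kapBar]
  ring

theorem pd_three_transversal (hq : q ∈ chart M W) : HasPartial M 3 (transversal M a F) 0 q := by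
  have hd := chart_subset_dom hq
  have hc := hasPartial_core hM hW hF hd
  have hc2 := hasPartial_pd_core hM hW hF hd 3
  have h0 := pd_three_core hM hW hF hZ
  have z : ∀ k, pd M 3 (pd M k (core a F)) q = 0 := fun k => by
    rw [pd_comm (smooth_core hM hF) hW hd, pd_congr hW h0 k hq]
    exact (hasPartial_const 0).pd_eq hq.1
  have ht : ∀ g : ℝ → ℂ, HasPartial M 3 (fun p => g (p 2)) 0 q := fun g => hasPartial_theta_of_ne g (by decide)
  refine (((hasPartial_kap_of_ne (by decide) (by decide)).mul (((hc2 2).add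
    ((ht fun t => ((cos t / sin t : ℝ) : ℂ)).mul (hc 3))).add
    (((ht fun t => (sin t : ℂ)).mul (hc2 0)).const_mul (Complex.I * a)))).sub
    (((ht fun t => (sin t : ℂ)).mul (hc 3)).const_mul (Complex.I * a))).congr_deriv ?_
  simp only [z, h0 hq]
  ring

/-- Apply ∂_r to `pd_two_upsReg_eq`, commute derivatives of Υ, and insert ∂_r Υ = -`transversal`: Υ
disappears and a second-order equation for ψ remains. -/
theorem core_teukolsky (ha : |a| = M) (hq : q ∈ horizon M W) :
    pd M 2 (pd M 2 (core a F)) q + ((cos (q 2) / sin (q 2) : ℝ) : ℂ) * pd M 2 (core a F) q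
      + ((-1 / sin (q 2) ^ 2 : ℝ) : ℂ) * core a F q
      + (a : ℂ) ^ 2 * (sin (q 2) : ℂ) ^ 2 * pd M 0 (pd M 0 (core a F)) q
      + 2 * kapBar a q * pd M 0 (core a F) q + 4 * M * pd M 0 (core a F) q
      + 4 * (M : ℂ) ^ 2 * pd M 1 (pd M 0 (core a F)) q + 2 * core a F q = 0 := by
  have hq' := horizon_subset_chart hq
  have hd := chart_subset_dom hq'
  have hs := (sin_pos_of_mem_chart hq').ne'
  have hs' : (sin (q 2) : ℂ) ≠ 0 := by exact_mod_cast hs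
  have hk' := kap_ne_zero (a := a) hM hq'.1
  have ha2 : a ^ 2 = M ^ 2 := by rw [← ha, sq_abs]
  -- Extremality makes r = M a double root of Δ. The terms with Δ vanish by `hΔ`, and those with ∂_r
  -- Δ = 2r - 2M vanish once r = M is substituted, so no second radial derivative survives.
  have hΔ : Del M a q = 0 := by rw [Del, hq.1, ha2]; ring
  have hu := smooth_upsReg (a := a) hM hF
  have hup : ∀ k, HasPartial M 1 (pd M k (upsReg a F)) (pd M k (pd M 1 (upsReg a F)) q) q := fun k =>
    ((hu.pd hW k).hasPartial hW hd).congr_deriv (pd_comm hu hW hd 1 k)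
  have hv := fun k => pd_congr hW (pd_one_upsReg_eq_transversal hM hW hF hZ) k hq'
  have ht : ∀ g : ℝ → ℂ, HasPartial M 1 (fun p => g (p 2)) 0 q := fun g => hasPartial_theta_of_ne g (by decide)
  have hl := (hup 2).sub (((((ht fun t => (sin t : ℂ)).mul (hup 0)).const_mul (a : ℂ)).add
    ((ht fun t => (((sin t)⁻¹ : ℝ) : ℂ)).mul (hup 3))).const_mul Complex.I)
  have hc := hasPartial_core hM hW hF hd 1
  have hc2 := hasPartial_pd_core hM hW hF hd 1
  have hR : HasPartial M 1 (fun p => ((p 1 ^ 2 + a ^ 2 : ℝ) : ℂ)) ((2 * q 1 : ℝ) : ℂ) q :=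
    (hasPartial_coord_self (g := fun t : ℝ => t ^ 2 + a ^ 2)
      (by simpa using (hasDerivAt_pow 2 (q 1)).add_const (a ^ 2))).ofReal
  have hL : HasPartial M 1 (fun p => ((2 * p 1 - 2 * M : ℝ) : ℂ)) ((2 : ℝ) : ℂ) q :=
    (hasPartial_coord_self (g := fun t : ℝ => 2 * t - 2 * M)
      (by simpa using ((hasDerivAt_id (q 1)).const_mul 2).sub_const (2 * M))).ofReal
  have hDel : HasPartial M 1 (fun p => (Del M a p : ℂ)) _ q := (hasPartial_Del (a := a)).ofReal
  have hr := ((hasPartial_kap_one (a := a)).mul ((((hR.const_mul 2).mul (hc2 0)).add (hL.mul hc)).add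
    (hDel.mul (hc2 1)))).sub (hDel.mul hc)
  have key := (hl.pd_eq hq'.1).symm.trans ((hasPartial_congr hW (pd_two_upsReg_eq hM hW hF hZ) hq' hr).pd_eq hq'.1)
  rw [hv, hv, hv, (pd_two_transversal hM hW hF hq').neg.pd_eq hq'.1,
    (pd_zero_transversal hM hW hF hq').neg.pd_eq hq'.1,
    (pd_three_transversal hM hW hF hZ hq').neg.pd_eq hq'.1, hΔ, hq.1, ha2,
    pd_comm (smooth_core hM hF) hW hd 0 2] at key
  -- The cross-differentiated equation is κ times the claimed one; the terms without a visible κ are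
  -- brought to this form by κκ̄ = Σ and a² = M².
  refine mul_left_cancel₀ hk' ?_
  have ha2' : (a : ℂ) ^ 2 = (M : ℂ) ^ 2 := by exact_mod_cast ha2
  have hkk := kap_mul_kapBar a q
  have hsc : (sin (q 2) : ℂ) ^ 2 + (cos (q 2) : ℂ) ^ 2 = 1 := by exact_mod_cast sin_sq_add_cos_sq (q 2)
  rw [Sig, hq.1] at hkk
  have hcs : (sin (q 2) : ℂ) * ((cos (q 2) / sin (q 2) : ℝ) : ℂ) = cos (q 2) := by
    push_cast [-Complex.ofReal_cos, -Complex.ofReal_sin]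
    field_simp
  simp only [Complex.ofReal_add, Complex.ofReal_sub, Complex.ofReal_mul, Complex.ofReal_pow,
    Complex.ofReal_ofNat, Complex.ofReal_zero] at key hkk
  linear_combination -key + 2 * pd M 0 (core a F) q * hkk + 2 * (a : ℂ) ^ 2 * pd M 0 (core a F) q * hsc
    + 2 * pd M 0 (core a F) q * ha2' + kap a q * a * pd M 0 (core a F) q * Complex.I * hcs
    + (kap a q * (a : ℂ) ^ 2 * (sin (q 2) : ℂ) ^ 2 * pd M 0 (pd M 0 (core a F)) q
      - 2 * (a : ℂ) ^ 2 * (sin (q 2) : ℂ) ^ 2 * pd M 0 (core a F) q) * Complex.I_sq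

end Complex

end KerrMaxwell
end

noncomputable section

namespace KerrMaxwell

open Function (update)
open scoped ContDiff

variable {M a : ℝ} {W : Set (ℝ × ℝ)} {F : TwoForm} {q : Fin 4 → ℝ}

/-! ### The transformed field on the horizon -/

/-- `√((r² + a²) / 2)`. -/
def weight (a : ℝ) (q : Fin 4 → ℝ) : ℂ := ((√(q 1 ^ 2 + a ^ 2) / √2 : ℝ) : ℂ)

theorem phiReg_eq : phiReg a F = fun q => weight a q * core a F q := rfl

theorem hasPartial_weight_of_ne {k : Fin 4} (hk : k ≠ 1) : HasPartial M k (weight a) 0 q :=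
  hasPartial_coord_of_ne (fun t : ℝ => ((√(t ^ 2 + a ^ 2) / √2 : ℝ) : ℂ)) hk

theorem hasPartial_weight_one (hM : 0 < M) (hq : M ≤ q 1) :
    HasPartial M 1 (weight a) ((q 1 / (q 1 ^ 2 + a ^ 2) : ℝ) * weight a q) q := by
  have hR := radial_pos (a := a) hM hq
  have h : HasDerivAt (fun t : ℝ => √(t ^ 2 + a ^ 2) / √2) (q 1 / √(q 1 ^ 2 + a ^ 2) / √2) (q 1) := by
    have h1 : HasDerivAt (fun t : ℝ => t ^ 2 + a ^ 2) (2 * q 1) (q 1) := by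
      simpa using (hasDerivAt_pow 2 (q 1)).add_const (a ^ 2)
    exact ((h1.sqrt hR.ne').div_const _).congr_deriv (by rw [mul_div_mul_left _ _ two_ne_zero])
  refine (hasPartial_coord_self (g := fun t : ℝ => √(t ^ 2 + a ^ 2) / √2) h).ofReal.congr_deriv ?_
  rw [weight, ← Complex.ofReal_mul]
  congr 1
  have hs := Real.sq_sqrt hR.le
  have := (Real.sqrt_pos.2 hR).ne'
  field_simp
  rw [hs]

theorem weight_horizon (hM : 0 < M) (ha : a ^ 2 = M ^ 2) (hq : q 1 = M) : weight a q = M := by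
  have : √(M ^ 2 + M ^ 2) = √2 * M := by
    rw [← two_mul, Real.sqrt_mul (by norm_num), Real.sqrt_sq hM.le]
  rw [weight, hq, ha, this]
  have : √2 ≠ 0 := by simp
  field_simp

/-- `Φ^{[-1]}`, regular on the axis. -/
def PhiReg (M a : ℝ) (F : TwoForm) : (Fin 4 → ℝ) → ℂ := transform M a (phiReg a F)

theorem Phi_eq (hM : 0 < M) (hW : IsOpen W) : EqOn (Phi M a F) (PhiReg M a F) (chart M W) := fun q hq => by
  simp only [Phi, PhiReg, transform, along_congr hW (phi0_eq hM) _ hq, phi0_eq hM hq]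

theorem transform_apply (hS : Sig a q ≠ 0) (f : (Fin 4 → ℝ) → ℂ) : transform M a f q =
    2 * ((q 1 ^ 2 + a ^ 2 : ℝ) : ℂ) * pd M 0 f q + (Del M a q : ℂ) * pd M 1 f q + 2 * a * pd M 3 f q
      + ((2 * (q 1 - M) - Del M a q * (2 * q 1 / (q 1 ^ 2 + a ^ 2)) : ℝ) : ℂ) * f q := by
  have hS' : (Sig a q : ℂ) ≠ 0 := by exact_mod_cast hS
  simp only [transform, along, Fin.sum_univ_four, e4, Matrix.cons_val, Complex.real_smul]
  push_cast
  field_simp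
  ring

theorem smooth_transform (hM : 0 < M) (hW : IsOpen W) {f : (Fin 4 → ℝ) → ℂ} (hf : Smooth M W f) :
    Smooth M W (transform M a f) := by
  have h1 : Smooth M W fun q => 2 * (q 1 ^ 2 + a ^ 2) := by unfold Smooth; fun_prop
  have h2 : Smooth M W fun q => 2 * (q 1 - M) - Del M a q * (2 * q 1 / (q 1 ^ 2 + a ^ 2)) := by
    refine ContDiffOn.sub (by fun_prop) (contDiff_Del.contDiffOn.mul (ContDiffOn.div (by fun_prop) (by fun_prop)
      fun q hq => (radial_pos hM hq.1).ne'))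
  have h := (((h1.ofReal.mul (hf.pd hW 0)).add ((smooth_of_contDiff (contDiff_Del (M := M) (a := a))).ofReal.mul (hf.pd hW 1))).add
    ((smooth_of_contDiff (contDiff_const (c := (2 * a : ℂ)))).mul (hf.pd hW 3))).add (h2.ofReal.mul hf)
  refine ContDiffOn.congr h fun q hq => ?_
  rw [transform_apply (Sig_pos hM hq.1).ne']
  push_cast
  ring

theorem smooth_PhiReg (hM : 0 < M) (hW : IsOpen W) (hF : IsMaxwellField M a W F) : Smooth M W (PhiReg M a F) :=
  smooth_transform hM hW (smooth_phiReg hM hF)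

theorem along_e3 {E : Type*} [NormedAddCommGroup E] [NormedSpace ℝ E] (f : (Fin 4 → ℝ) → E) :
    along M e3 f = fun q => -pd M 1 f q := by
  funext q
  simp [along, Fin.sum_univ_four, e3]

theorem Del_horizon (ha : |a| = M) (hq : q ∈ horizon M W) : Del M a q = 0 := by
  have ha2 : a ^ 2 = M ^ 2 := by rw [← ha, sq_abs]
  rw [Del, hq.1, ha2]; ring

section Horizon

variable (hM : 0 < M) (hW : IsOpen W) (hF : IsMaxwellField M a W F)
  (hZ : ∀ q ∈ chart M W, pd M 3 (alphaNeg a F) q = 0)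

include hM hW hF

theorem hasPartial_phiReg (hq : q ∈ dom M W) (k : Fin 4) :
    HasPartial M k (phiReg a F) (pd M k (phiReg a F) q) q := (smooth_phiReg hM hF).hasPartial hW hq

theorem hasPartial_pd_phiReg (hq : q ∈ dom M W) (k l : Fin 4) :
    HasPartial M k (pd M l (phiReg a F)) (pd M k (pd M l (phiReg a F)) q) q :=
  ((smooth_phiReg hM hF).pd hW l).hasPartial hW hq

theorem pd_phiReg_of_ne {k : Fin 4} (hk : k ≠ 1) :
    EqOn (pd M k (phiReg a F)) (fun q => weight a q * pd M k (core a F) q) (dom M W) := fun _ hq =>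
  (((hasPartial_weight_of_ne hk).mul (hasPartial_core hM hW hF hq k)).congr_deriv (by ring)).pd_eq hq.1

theorem pd_pd_phiReg_of_ne {k l : Fin 4} (hk : k ≠ 1) (hl : l ≠ 1) :
    EqOn (pd M l (pd M k (phiReg a F))) (fun q => weight a q * pd M l (pd M k (core a F)) q) (dom M W) :=
  fun _ hq => ((hasPartial_congr_dom hW (pd_phiReg_of_ne hM hW hF hk) hq ((hasPartial_weight_of_ne hl).mul
    (hasPartial_pd_core hM hW hF hq l k))).congr_deriv (by ring)).pd_eq hq.1

theorem pd_one_pd_zero_phiReg_horizon (ha : |a| = M) (hq : q ∈ horizon M W) : pd M 1 (pd M 0 (phiReg a F)) q =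
    M * pd M 1 (pd M 0 (core a F)) q + 1 / 2 * pd M 0 (core a F) q := by
  have hq' := horizon_subset_chart hq
  have hd := chart_subset_dom hq'
  have ha2 : a ^ 2 = M ^ 2 := by rw [← ha, sq_abs]
  rw [(hasPartial_congr_dom hW (pd_phiReg_of_ne hM hW hF (by decide)) hd
    ((hasPartial_weight_one hM hq'.1).mul (hasPartial_pd_core hM hW hF hd 1 0))).pd_eq hq'.1,
    weight_horizon hM ha2 hq.1, hq.1, ha2]
  have : (M : ℂ) ≠ 0 := by exact_mod_cast hM.ne'
  push_cast
  field_simp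
  ring

include hZ

theorem pd_three_phiReg : EqOn (pd M 3 (phiReg a F)) (fun _ => 0) (chart M W) := fun q hq => by
  refine (pd_phiReg_of_ne hM hW hF (by decide) (chart_subset_dom hq)).trans ?_
  simp only [pd_three_core hM hW hF hZ hq, mul_zero]

theorem pd_pd_three_phiReg (k : Fin 4) : EqOn (pd M k (pd M 3 (phiReg a F))) (fun _ => 0) (chart M W) :=
  fun q hq => by
    rw [pd_congr hW (pd_three_phiReg hM hW hF hZ) k hq]
    exact (hasPartial_const 0).pd_eq hq.1

theorem pd_three_PhiReg (hq : q ∈ chart M W) : pd M 3 (PhiReg M a F) q = 0 := by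
  have hd := chart_subset_dom hq
  have e : EqOn (PhiReg M a F) _ (chart M W) := fun p hp => transform_apply (Sig_pos hM hp.1).ne' (phiReg a F)
  have hr : ∀ g : ℝ → ℂ, HasPartial M 3 (fun p => g (p 1)) 0 q := fun g => hasPartial_coord_of_ne g (by decide)
  have h2 := hasPartial_pd_phiReg hM hW hF hd 3
  have z : ∀ k, pd M 3 (pd M k (phiReg a F)) q = 0 := fun k => by
    rw [pd_comm (smooth_phiReg hM hF) hW hd]; exact pd_pd_three_phiReg hM hW hF hZ k hq
  have h := ((((((hr fun t => ((t ^ 2 + a ^ 2 : ℝ) : ℂ)).const_mul 2).mul (h2 0)).add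
    ((hr fun t => ((t ^ 2 - 2 * M * t + a ^ 2 : ℝ) : ℂ)).mul (h2 1))).add ((h2 3).const_mul (2 * (a : ℂ)))).add
    ((hr fun t => ((2 * (t - M) - (t ^ 2 - 2 * M * t + a ^ 2) * (2 * t / (t ^ 2 + a ^ 2)) : ℝ) : ℂ)).mul
      (hasPartial_phiReg hM hW hF hd 3)))
  rw [(hasPartial_congr hW e hq h).pd_eq hq.1]
  simp only [z, pd_three_phiReg hM hW hF hZ hq]
  ring

variable (ha : |a| = M)
include ha

/-- The radial and zeroth-order coefficients of `transform` vanish at r = M and Z drops out by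
axisymmetry, so on the horizon Φ is a purely tangential derivative of φ̃₀. -/
theorem PhiReg_horizon (hq : q ∈ horizon M W) : PhiReg M a F q = 4 * (M : ℂ) ^ 2 * pd M 0 (phiReg a F) q := by
  have hq' := horizon_subset_chart hq
  have ha2 : a ^ 2 = M ^ 2 := by rw [← ha, sq_abs]
  rw [PhiReg, transform_apply (Sig_pos hM hq'.1).ne', pd_three_phiReg hM hW hF hZ hq',
    Del_horizon ha hq, hq.1, ha2]
  push_cast
  ring

theorem pd_zero_PhiReg_horizon (hq : q ∈ horizon M W) :
    pd M 0 (PhiReg M a F) q = 4 * (M : ℂ) ^ 2 * pd M 0 (pd M 0 (phiReg a F)) q := by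
  have hq' := horizon_subset_chart hq
  have hd := chart_subset_dom hq'
  have ha2 : a ^ 2 = M ^ 2 := by rw [← ha, sq_abs]
  have e : EqOn (PhiReg M a F) _ (chart M W) := fun p hp => transform_apply (Sig_pos hM hp.1).ne' (phiReg a F)
  have hr : ∀ g : ℝ → ℂ, HasPartial M 0 (fun p => g (p 1)) 0 q := fun g => hasPartial_coord_of_ne g (by decide)
  have h2 := hasPartial_pd_phiReg hM hW hF hd 0
  have h := ((((((hr fun t => ((t ^ 2 + a ^ 2 : ℝ) : ℂ)).const_mul 2).mul (h2 0)).add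
    ((hr fun t => ((t ^ 2 - 2 * M * t + a ^ 2 : ℝ) : ℂ)).mul (h2 1))).add ((h2 3).const_mul (2 * (a : ℂ)))).add
    ((hr fun t => ((2 * (t - M) - (t ^ 2 - 2 * M * t + a ^ 2) * (2 * t / (t ^ 2 + a ^ 2)) : ℝ) : ℂ)).mul
      (hasPartial_phiReg hM hW hF hd 0)))
  rw [(hasPartial_congr hW e hq' h).pd_eq hq'.1]
  rw [pd_pd_three_phiReg hM hW hF hZ 0 hq', hq.1, ha2]
  push_cast
  ring

/-- The last term comes from differentiating the coefficient 2(r - M). Its constant 2 is the L = 1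
eigenvalue, which is the origin of the conservation law. -/
theorem pd_one_PhiReg_horizon (hq : q ∈ horizon M W) :
    pd M 1 (PhiReg M a F) q = 4 * M * pd M 0 (phiReg a F) q
      + 4 * (M : ℂ) ^ 2 * pd M 1 (pd M 0 (phiReg a F)) q + 2 * phiReg a F q := by
  have hq' := horizon_subset_chart hq
  have hd := chart_subset_dom hq'
  have ha2 : a ^ 2 = M ^ 2 := by rw [← ha, sq_abs]
  have e : EqOn (PhiReg M a F) _ (chart M W) := fun p hp => transform_apply (Sig_pos hM hp.1).ne' (phiReg a F)
  have h2 := hasPartial_pd_phiReg hM hW hF hd 1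
  have hR : HasPartial M 1 (fun p => ((p 1 ^ 2 + a ^ 2 : ℝ) : ℂ)) ((2 * q 1 : ℝ) : ℂ) q :=
    (hasPartial_coord_self (g := fun t : ℝ => t ^ 2 + a ^ 2)
      (by simpa using (hasDerivAt_pow 2 (q 1)).add_const (a ^ 2))).ofReal
  have hd1 : HasDerivAt (fun t : ℝ => 2 * t / (t ^ 2 + a ^ 2))
      ((2 * (q 1 ^ 2 + a ^ 2) - 2 * q 1 * (2 * q 1)) / (q 1 ^ 2 + a ^ 2) ^ 2) (q 1) := by
    have h1 : HasDerivAt (fun t : ℝ => 2 * t) 2 (q 1) := by simpa using (hasDerivAt_id (q 1)).const_mul 2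
    have h2 : HasDerivAt (fun t : ℝ => t ^ 2 + a ^ 2) (2 * q 1) (q 1) := by
      simpa using (hasDerivAt_pow 2 (q 1)).add_const (a ^ 2)
    exact h1.div h2 (radial_pos hM hq'.1).ne'
  have hd2 : HasDerivAt (fun t : ℝ => 2 * (t - M)) 2 (q 1) := by
    simpa using ((hasDerivAt_id (q 1)).sub_const M).const_mul 2
  have hL := (HasPartial.sub (M := M) (hasPartial_coord_self hd2)
    ((hasPartial_Del (a := a)).mul (hasPartial_coord_self hd1))).ofReal
  have h := ((((hR.const_mul 2).mul (h2 0)).add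
    ((hasPartial_Del (a := a)).ofReal.mul (h2 1))).add ((h2 3).const_mul (2 * (a : ℂ)))).add
    (hL.mul (hasPartial_phiReg hM hW hF hd 1))
  rw [(hasPartial_congr hW e hq' h).pd_eq hq'.1]
  rw [pd_pd_three_phiReg hM hW hF hZ 1 hq', Del_horizon ha hq, hq.1, ha2]
  push_cast
  ring

theorem along_e4_PhiReg_horizon (hq : q ∈ horizon M W) : along M (e4 M a) (PhiReg M a F) q =
    4 / (1 + (cos (q 2) : ℂ) ^ 2) * pd M 0 (PhiReg M a F) q := by
  have hq' := horizon_subset_chart hq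
  have ha2 : a ^ 2 = M ^ 2 := by rw [← ha, sq_abs]
  have hS : Sig a q = M ^ 2 * (1 + cos (q 2) ^ 2) := by rw [Sig, hq.1, ha2]; ring
  have hc : (1 + (cos (q 2) : ℂ) ^ 2) ≠ 0 := by
    have : 1 + cos (q 2) ^ 2 ≠ 0 := by positivity
    exact_mod_cast this
  have hM' : (M : ℂ) ≠ 0 := by exact_mod_cast hM.ne'
  simp only [along, Fin.sum_univ_four, e4, Matrix.cons_val, Complex.real_smul, pd_three_PhiReg hM hW hF hZ hq',
    Del_horizon ha hq, hS, hq.1, ha2]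
  push_cast [-Complex.ofReal_cos]
  field_simp
  ring

/-- `core_teukolsky` multiplied by the weight and rewritten in Φ: ∂_r Φ carries the mixed ∂_r T
derivative, and the left-over T-derivative of φ̃₀ is the one with coefficient i a cos θ. -/
theorem phiReg_teukolsky (hq : q ∈ horizon M W) :
    -pd M 2 (pd M 2 (phiReg a F)) q - ((cos (q 2) / sin (q 2) : ℝ) : ℂ) * pd M 2 (phiReg a F) q
      + ((1 / sin (q 2) ^ 2 : ℝ) : ℂ) * phiReg a F q =
    pd M 1 (PhiReg M a F) q + 1 / 4 * (sin (q 2) : ℂ) ^ 2 * pd M 0 (PhiReg M a F) q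
      + Complex.I * a * cos (q 2) / (2 * (M : ℂ) ^ 2) * PhiReg M a F q := by
  have hq' := horizon_subset_chart hq
  have hd := chart_subset_dom hq'
  have ha2 : a ^ 2 = M ^ 2 := by rw [← ha, sq_abs]
  have ha2' : (a : ℂ) ^ 2 = (M : ℂ) ^ 2 := by exact_mod_cast ha2
  have hM' : (M : ℂ) ≠ 0 := by exact_mod_cast hM.ne'
  have key := core_teukolsky hM hW hF hZ ha hq
  rw [pd_one_PhiReg_horizon hM hW hF hZ ha hq, pd_zero_PhiReg_horizon hM hW hF hZ ha hq,
    PhiReg_horizon hM hW hF hZ ha hq, pd_one_pd_zero_phiReg_horizon hM hW hF ha hq,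
    pd_pd_phiReg_of_ne hM hW hF (by decide) (by decide) hd, pd_pd_phiReg_of_ne hM hW hF (by decide) (by decide) hd,
    pd_phiReg_of_ne hM hW hF (by decide) hd, pd_phiReg_of_ne hM hW hF (by decide) hd]
  simp only [phiReg_eq, weight_horizon hM ha2 hq.1]
  rw [kapBar, hq.1, neg_div] at key
  rw [Complex.ofReal_neg] at key
  rw [← sub_eq_zero]
  field_simp
  linear_combination (-2 * (M : ℂ)) * key + 2 * (M : ℂ) * (sin (q 2) : ℂ) ^ 2 * pd M 0 (pd M 0 (core a F)) q * ha2'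

end Horizon

end KerrMaxwell
end

noncomputable section

namespace KerrMaxwell

open Function (update)
open scoped ContDiff

variable {M a : ℝ} {W : Set (ℝ × ℝ)} {F : TwoForm} {q : Fin 4 → ℝ}

/-! ### The pointwise identities on the horizon -/

section Pointwise

variable (hM : 0 < M) (hW : IsOpen W) (hF : IsMaxwellField M a W F)
  (hZ : ∀ q ∈ chart M W, pd M 3 (alphaNeg a F) q = 0)

include hM hW hF hZ

/-- The first complex equation at r = M. Because a² = M², iaκ = M(M cos θ + ia), which turns its
T-term into the stated coefficient of Φ. -/
theorem along_e3_Ups (ha : |a| = M) (hq : q ∈ horizon M W) :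
    along M e3 (Ups M a F) q =
      1 / M * (pd M 2 (fun p => (M - Complex.I * a * cos (p 2)) * phi0 a F p) q
        + (-(2 * Complex.I * a * sin (q 2) / (M - Complex.I * a * cos (q 2)))
            + (cos (q 2) : ℂ) / sin (q 2)) * ((M - Complex.I * a * cos (q 2)) * phi0 a F q))
      + (M * cos (q 2) + Complex.I * a) * sin (q 2) / (4 * (M : ℂ) ^ 2) * Phi M a F q := by
  have hq' := horizon_subset_chart hq
  have hd := chart_subset_dom hq'
  have ha2 : a ^ 2 = M ^ 2 := by rw [← ha, sq_abs]
  have ha2' : (a : ℂ) ^ 2 = (M : ℂ) ^ 2 := by exact_mod_cast ha2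
  have hM' : (M : ℂ) ≠ 0 := by exact_mod_cast hM.ne'
  have hs' : (sin (q 2) : ℂ) ≠ 0 := by exact_mod_cast (sin_pos_of_mem_chart hq').ne'
  have hk : kap a q = M - Complex.I * a * cos (q 2) := by rw [kap, hq.1]
  have hk' := kap_ne_zero (a := a) hM hq'.1
  have e : EqOn (fun p => ((M : ℂ) - Complex.I * a * cos (p 2)) * phi0 a F p)
      (fun p => ((M : ℂ) - Complex.I * a * cos (p 2)) * phiReg a F p) (chart M W) := fun p hp => by
    simp only [phi0_eq hM hp]
  have hc : HasPartial M 2 (fun p => (M : ℂ) - Complex.I * a * cos (p 2)) (Complex.I * a * sin (q 2)) q :=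
    ((hasPartial_const (M : ℂ)).sub (hasPartial_cos.ofReal.const_mul (Complex.I * a))).congr_deriv
      (by push_cast; ring)
  rw [along_congr hW (Ups_eq hM) _ hq', along_e3]
  simp only [pd_one_upsReg_eq_transversal hM hW hF hZ hq']
  rw [pd_congr hW e 2 hq', (hc.mul (hasPartial_phiReg hM hW hF hd 2)).pd_eq hq'.1, Phi_eq hM hW hq',
    PhiReg_horizon hM hW hF hZ ha hq, phi0_eq hM hq', pd_phiReg_of_ne hM hW hF (by decide) hd,
    pd_phiReg_of_ne hM hW hF (by decide) hd]
  simp only [phiReg_eq, weight_horizon hM ha2 hq.1, transversal]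
  rw [← hk]
  push_cast [-Complex.ofReal_cos, -Complex.ofReal_sin]
  field_simp
  rw [hk]
  linear_combination (-(sin (q 2) : ℂ) ^ 2 * (cos (q 2) : ℂ) * pd M 0 (core a F) q) * 
    (Complex.I_sq * (a : ℂ) ^ 2 - ha2')

/-- The Z-terms vanish and cot²θ + 1 = 1 / sin²θ. -/
theorem lapNegAddOne_phi0 (hq : q ∈ chart M W) : lapNegAddOne M (phi0 a F) q =
    -pd M 2 (pd M 2 (phiReg a F)) q - ((cos (q 2) / sin (q 2) : ℝ) : ℂ) * pd M 2 (phiReg a F) q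
      + ((1 / sin (q 2) ^ 2 : ℝ) : ℂ) * phiReg a F q := by
  have hd := chart_subset_dom hq
  have hs' : (sin (q 2) : ℂ) ≠ 0 := by exact_mod_cast (sin_pos_of_mem_chart hq).ne'
  have e := phi0_eq (a := a) (F := F) (W := W) hM
  have e2 : EqOn (fun p => (sin (p 2) : ℂ) * pd M 2 (phi0 a F) p) (fun p => (sin (p 2) : ℂ) * pd M 2 (phiReg a F) p)
      (chart M W) := fun p hp => by simp only [pd_congr hW e 2 hp]
  have h3 : EqOn (pd M 3 (phi0 a F)) (fun _ => 0) (chart M W) :=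
    (pd_congr hW e 3).trans (pd_three_phiReg hM hW hF hZ)
  have hsin : HasPartial M 2 (fun p => (sin (p 2) : ℂ)) (cos (q 2) : ℂ) q := hasPartial_sin.ofReal
  have hsc : (sin (q 2) : ℂ) ^ 2 + (cos (q 2) : ℂ) ^ 2 = 1 := by exact_mod_cast sin_sq_add_cos_sq (q 2)
  rw [lapNegAddOne, pd_congr hW e2 2 hq, (hsin.mul (hasPartial_pd_phiReg hM hW hF hd 2 2)).pd_eq hq.1,
    pd_congr hW h3 3 hq, (hasPartial_const (0 : ℂ)).pd_eq hq.1, h3 hq, e hq]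
  push_cast [-Complex.ofReal_cos, -Complex.ofReal_sin]
  field_simp
  linear_combination phiReg a F q * hsc

theorem teukolsky_horizon (ha : |a| = M) (hq : q ∈ horizon M W) :
    lapNegAddOne M (phi0 a F) q =
      -along M e3 (Phi M a F) q
        + 1 / 16 * (sin (q 2) : ℂ) ^ 2 * (1 + (cos (q 2) : ℂ) ^ 2) * along M (e4 M a) (Phi M a F) q
        + Complex.I * a * cos (q 2) / (2 * (M : ℂ) ^ 2) * Phi M a F q := by
  have hq' := horizon_subset_chart hq
  have hc : (1 + (cos (q 2) : ℂ) ^ 2) ≠ 0 := by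
    have : 1 + cos (q 2) ^ 2 ≠ 0 := by positivity
    exact_mod_cast this
  have hM' : (M : ℂ) ≠ 0 := by exact_mod_cast hM.ne'
  rw [lapNegAddOne_phi0 hM hW hF hZ hq', phiReg_teukolsky hM hW hF hZ ha hq,
    along_congr hW (Phi_eq hM hW) _ hq', along_congr hW (Phi_eq hM hW) _ hq', Phi_eq hM hW hq', along_e3,
    along_e4_PhiReg_horizon hM hW hF hZ ha hq]
  field_simp
  ring

end Pointwise

end KerrMaxwell
end

noncomputable section

namespace KerrMaxwell

open Function (update)
open scoped ContDiff
open MeasureTheory (volume)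

/-! ### Integrals over the spheres of constant `(v, r)` -/

/-- One-sided differentiation under the integral sign over a compact set. -/
theorem hasDerivWithinAt_setIntegral_of_continuousOn {X E : Type*} [TopologicalSpace X] [MeasurableSpace X]
    [OpensMeasurableSpace X] [T2Space X] {μ : MeasureTheory.Measure X} [MeasureTheory.IsFiniteMeasureOnCompacts μ]
    [NormedAddCommGroup E] [NormedSpace ℝ E] {S : Set ℝ} {K : Set X} {f f' : ℝ → X → E} {t : ℝ}
    [SecondCountableTopologyEither X E]
    (hS : Convex ℝ S) (hSc : IsCompact S) (hK : IsCompact K) (ht : t ∈ S)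
    (hf : ∀ s ∈ S, ContinuousOn (f s) K) (hf' : ContinuousOn (fun p : ℝ × X => f' p.1 p.2) (S ×ˢ K))
    (h : ∀ s ∈ S, ∀ x ∈ K, HasDerivWithinAt (fun s => f s x) (f' s x) S s) :
    HasDerivWithinAt (fun s => ∫ x in K, f s x ∂μ) (∫ x in K, f' t x ∂μ) S t := by
  obtain ⟨C, hC⟩ := (hSc.prod hK).exists_bound_of_continuousOn hf'
  have hint : ∀ s ∈ S, MeasureTheory.IntegrableOn (f s) K μ := fun s hs =>
    (hf s hs).integrableOn_compact hK
  rw [hasDerivWithinAt_iff_tendsto_slope]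
  have hmem : ∀ᶠ s in nhdsWithin t (S \ {t}), s ∈ S ∧ s ≠ t := by
    filter_upwards [self_mem_nhdsWithin] with s hs using ⟨hs.1, hs.2⟩
  have key : Filter.Tendsto (fun s => ∫ x in K, slope (fun s => f s x) t s ∂μ) (nhdsWithin t (S \ {t}))
      (nhds (∫ x in K, f' t x ∂μ)) := by
    -- The difference quotients are dominated by a bound C for f' on the compact S × K, by the mean
    -- value inequality on the convex set S.
    refine MeasureTheory.tendsto_integral_filter_of_dominated_convergence (fun _ => C) ?_ ?_ ?_ ?_
    · filter_upwards [hmem] with s hs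
      simp only [slope_def_module]
      exact (((hint s hs.1).sub (hint t ht)).smul _).aestronglyMeasurable
    · filter_upwards [hmem] with s hs
      refine (MeasureTheory.ae_restrict_mem hK.measurableSet).mono fun x hx => ?_
      have := hS.norm_image_sub_le_of_norm_hasDerivWithin_le (C := C) (fun u hu => h u hu x hx)
        (fun u hu => hC (u, x) ⟨hu, hx⟩) ht hs.1
      rw [slope_def_module, norm_smul, norm_inv]
      rw [inv_mul_le_iff₀ (norm_pos_iff.2 (sub_ne_zero.2 hs.2)), mul_comm]
      exact this
    · exact MeasureTheory.integrableOn_const (hK.measure_lt_top.ne)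
    · refine (MeasureTheory.ae_restrict_mem hK.measurableSet).mono fun x hx => ?_
      exact hasDerivWithinAt_iff_tendsto_slope.1 (h t ht x hx)
  refine key.congr' ?_
  filter_upwards [hmem] with s hs
  simp only [slope_def_module]
  rw [MeasureTheory.integral_smul, MeasureTheory.integral_sub (hint s hs.1) (hint t ht)]

/-- The angles `(φ, θ)`. -/
def angles : Set (ℝ × ℝ) := Icc 0 (2 * π) ×ˢ Icc 0 π

theorem isCompact_angles : IsCompact angles := isCompact_Icc.prod isCompact_Icc

variable {M : ℝ} {W : Set (ℝ × ℝ)} {q : Fin 4 → ℝ} {f g : (Fin 4 → ℝ) → ℂ}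

/-- The point with angles `x = (φ, θ)` on the sphere through `q`. -/
def onSphere (q : Fin 4 → ℝ) (x : ℝ × ℝ) : Fin 4 → ℝ := ![q 0, q 1, x.2, x.1]

theorem onSphere_mem_dom (hq : q ∈ dom M W) (x : ℝ × ℝ) : onSphere q x ∈ dom M W := hq

theorem continuous_onSphere : Continuous fun p : (Fin 4 → ℝ) × (ℝ × ℝ) => onSphere p.1 p.2 := by
  refine continuous_pi fun i => ?_
  fin_cases i <;> simp only [onSphere] <;> dsimp <;> fun_prop

theorem continuous_onSphere_right (q : Fin 4 → ℝ) : Continuous (onSphere q) :=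
  continuous_onSphere.comp (Continuous.prodMk_right q)

theorem onSphere_update {i : Fin 4} (hi : i = 0 ∨ i = 1) (s : ℝ) (x : ℝ × ℝ) :
    onSphere (update q i s) x = update (onSphere q x) i s := by
  funext k
  rcases hi with rfl | rfl <;> fin_cases k <;> simp [onSphere, update]

theorem sphereInt_congr (h : ∀ θ ∈ Ioo 0 π, ∀ φ, f ![q 0, q 1, θ, φ] = g ![q 0, q 1, θ, φ]) :
    sphereInt f q = sphereInt g q := by
  unfold sphereInt
  congr 1
  funext φ
  exact intervalIntegral.integral_congr_Ioo_of_le pi_nonneg fun θ hθ => by simp only [h θ hθ φ]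

theorem sphereInt_congr_chart (h : EqOn f g (chart M W)) (hq : q ∈ dom M W) : sphereInt f q = sphereInt g q :=
  sphereInt_congr fun _ hθ _ => h ⟨hq.1, hq.2, hθ⟩

theorem continuousOn_sphere (hf : ContinuousOn f (dom M W)) (hq : q ∈ dom M W) :
    ContinuousOn (fun x : ℝ × ℝ => f (onSphere q x) * (sin x.2 : ℂ)) angles :=
  (hf.comp (continuous_onSphere_right q).continuousOn fun x _ => onSphere_mem_dom hq x).mul (by fun_prop)

theorem integrableOn_sphere (hf : ContinuousOn f (dom M W)) (hq : q ∈ dom M W) :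
    MeasureTheory.IntegrableOn (fun x : ℝ × ℝ => f (onSphere q x) * (sin x.2 : ℂ)) angles :=
  (continuousOn_sphere hf hq).integrableOn_compact isCompact_angles

theorem sphereInt_eq_setIntegral (hf : ContinuousOn f (dom M W)) (hq : q ∈ dom M W) :
    sphereInt f q = ∫ x in angles, f (onSphere q x) * (sin x.2 : ℂ) := by
  have h := MeasureTheory.setIntegral_prod (μ := volume) (ν := volume) (s := Icc 0 (2 * π)) (t := Icc 0 π)
    (fun x : ℝ × ℝ => f (onSphere q x) * (sin x.2 : ℂ)) (integrableOn_sphere hf hq)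
  rw [← MeasureTheory.Measure.volume_eq_prod] at h
  unfold sphereInt
  rw [angles, h, intervalIntegral.integral_of_le (by positivity), MeasureTheory.integral_Icc_eq_integral_Ioc]
  congr 1
  funext φ
  rw [intervalIntegral.integral_of_le pi_nonneg, MeasureTheory.integral_Icc_eq_integral_Ioc]
  rfl

theorem sphereInt_add (hf : ContinuousOn f (dom M W)) (hg : ContinuousOn g (dom M W)) (hq : q ∈ dom M W) :
    sphereInt (fun p => f p + g p) q = sphereInt f q + sphereInt g q := by
  rw [sphereInt_eq_setIntegral hf hq, sphereInt_eq_setIntegral hg hq, sphereInt_eq_setIntegral (f := fun p => f p + g p) (hf.add hg) hq,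
    ← MeasureTheory.integral_add (integrableOn_sphere hf hq) (integrableOn_sphere hg hq)]
  simp only [add_mul]

theorem sphereInt_const_mul (c : ℂ) : sphereInt (fun p => c * f p) q = c * sphereInt f q := by
  simp only [sphereInt, mul_assoc, intervalIntegral.integral_const_mul]

theorem hasPartial_sphereInt (hW : IsOpen W) (hf : Smooth M W f) (hq : q ∈ dom M W) {i : Fin 4}
    (hi : i = 0 ∨ i = 1) : HasPartial M i (sphereInt f) (sphereInt (pd M i f) q) q := by
  obtain ⟨ε, hε, hsub⟩ := Metric.mem_nhdsWithin_iff.1 (slice_mem_dom (i := i) hW hq)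
  have hconv : Convex ℝ {s : ℝ | M ≤ update q i s 1} ∧ IsClosed {s : ℝ | M ≤ update q i s 1} := by
    by_cases h : i = 1
    · subst h; rw [slice_one]; exact ⟨convex_Ici M, isClosed_Ici⟩
    · rw [slice_of_ne h hq.1]; exact ⟨convex_univ, isClosed_univ⟩
  -- A compact convex neighbourhood of the point in its coordinate line, one-sided if i = 1 and r =
  -- M, and small enough to stay over `W`.
  set S := Metric.closedBall (q i) (ε / 2) ∩ {s : ℝ | M ≤ update q i s 1} with hSdef
  have hS : ∀ s ∈ S, update q i s ∈ dom M W := fun s hs =>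
    hsub ⟨Metric.closedBall_subset_ball (by linarith) hs.1, hs.2⟩
  have hmem : q i ∈ S := ⟨Metric.mem_closedBall_self (by linarith), mem_slice hq.1⟩
  have hnhds : S ∈ nhdsWithin (q i) {s : ℝ | M ≤ update q i s 1} :=
    Filter.inter_mem (mem_nhdsWithin_of_mem_nhds (Metric.closedBall_mem_nhds _ (by linarith))) self_mem_nhdsWithin
  have hc := ContDiffOn.continuousOn hf
  have hd := ContDiffOn.continuousOn (hf.pd hW i)
  have key := hasDerivWithinAt_setIntegral_of_continuousOn (μ := (volume : MeasureTheory.Measure (ℝ × ℝ)))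
    (f := fun s x => f (onSphere (update q i s) x) * (sin x.2 : ℂ))
    (f' := fun s x => pd M i f (onSphere (update q i s) x) * (sin x.2 : ℂ)) (S := S) (t := q i)
    ((convex_closedBall _ _).inter hconv.1) ((isCompact_closedBall _ _).inter_right hconv.2)
    isCompact_angles hmem (fun s hs => continuousOn_sphere hc (hS s hs)) ?_ ?_
  · simp only [Function.update_eq_self] at key
    rw [← sphereInt_eq_setIntegral hd hq] at key
    refine (HasDerivWithinAt.congr key (fun s hs => sphereInt_eq_setIntegral hc (hS s hs)) ?_).mono_of_mem_nhdsWithin hnhds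
    simpa using sphereInt_eq_setIntegral hc hq
  · refine ContinuousOn.mul (hd.comp ?_ fun x hx => onSphere_mem_dom (hS x.1 hx.1) x.2) (by fun_prop)
    exact (continuous_onSphere.comp ((continuous_const.update i continuous_fst).prodMk continuous_snd)).continuousOn
  · intro s hs x _
    have h := hf.hasPartial hW (onSphere_mem_dom (hS s hs) x) (i := i)
    have e : ∀ u, f (onSphere (update q i u) x) = f (update (onSphere (update q i s) x) i u) := fun u => by
      rw [onSphere_update hi, onSphere_update hi, Function.update_idem]
    have e2 : onSphere (update q i s) x i = s := by
      rw [onSphere_update hi, Function.update_self]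
    have e3 : ∀ u, update (onSphere (update q i s) x) i u 1 = update q i u 1 := fun u => by
      rw [← onSphere_update hi, Function.update_idem]; rfl
    unfold HasPartial at h
    simp only [e2, e3, ← e] at h
    exact (h.mono fun u hu => hu.2).mul_const _

/-- The integral of a derivative in `θ` vanishes when the primitive vanishes on the axis. -/
theorem sphereInt_eq_zero {k : (Fin 4 → ℝ) → ℂ} (hW : IsOpen W) (hk : Smooth M W k) (hq : q ∈ dom M W)
    (h0 : ∀ p, sin (p 2) = 0 → k p = 0)
    (h : ∀ θ ∈ Ioo 0 π, ∀ φ, f ![q 0, q 1, θ, φ] * (sin θ : ℂ) = pd M 2 k ![q 0, q 1, θ, φ]) :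
    sphereInt f q = 0 := by
  have inner : ∀ φ, ∫ θ in (0 : ℝ)..π, f ![q 0, q 1, θ, φ] * (sin θ : ℂ) = 0 := fun φ => by
    have hm : ∀ θ, onSphere q (φ, θ) ∈ dom M W := fun θ => onSphere_mem_dom hq _
    have hderiv : ∀ θ ∈ uIcc 0 π, HasDerivAt (fun θ => k (onSphere q (φ, θ))) (pd M 2 k (onSphere q (φ, θ))) θ := by
      intro θ _
      have h := hk.hasPartial hW (hm θ) (i := 2)
      unfold HasPartial at h
      rw [slice_of_ne (by decide) (hm θ).1, hasDerivWithinAt_univ] at h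
      have e : (fun s => k (update (onSphere q (φ, θ)) 2 s)) = fun s => k (onSphere q (φ, s)) := by
        funext s
        congr 1
        funext j
        fin_cases j <;> simp [onSphere, update]
      rw [e] at h
      exact h
    have hcont : Continuous fun θ => pd M 2 k (onSphere q (φ, θ)) := by
      have hd := ContDiffOn.continuousOn (hk.pd hW 2)
      exact hd.comp_continuous ((continuous_onSphere_right q).comp (by fun_prop)) hm
    rw [intervalIntegral.integral_congr_Ioo_of_le pi_nonneg
      (g := fun θ => pd M 2 k (onSphere q (φ, θ))) fun θ hθ => h θ hθ φ,
      intervalIntegral.integral_eq_sub_of_hasDerivAt hderiv (hcont.intervalIntegrable _ _),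
      h0 _ (by simp [onSphere]), h0 _ (by simp [onSphere]), sub_zero]
  simp only [sphereInt, inner, intervalIntegral.integral_zero]

end KerrMaxwell
end

noncomputable section

namespace KerrMaxwell

open Function (update)
open scoped ContDiff
open Polynomial (X C derivative)

/-! ### Legendre polynomials -/

section Legendre

theorem iterate_derivative_succ_X_mul (n : ℕ) (p : Polynomial ℝ) :
    derivative^[n + 1] (X * p) = X * derivative^[n + 1] p + ((n : Polynomial ℝ) + 1) * derivative^[n] p := by
  rw [mul_comm, Polynomial.iterate_derivative_mul_X]
  simp only [nsmul_eq_mul, Nat.add_sub_cancel]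
  push_cast
  ring

theorem iterate_derivative_quadratic_mul (n : ℕ) (p : Polynomial ℝ) :
    derivative^[n + 2] ((X ^ 2 - 1) * p) = (X ^ 2 - 1) * derivative^[n + 2] p
      + 2 * ((n : Polynomial ℝ) + 2) * X * derivative^[n + 1] p
      + ((n : Polynomial ℝ) + 2) * ((n : Polynomial ℝ) + 1) * derivative^[n] p := by
  have e : (X ^ 2 - 1) * p = X * (X * p) - p := by ring
  rw [e, Polynomial.iterate_derivative_sub, show n + 2 = (n + 1) + 1 from rfl, iterate_derivative_succ_X_mul,
    iterate_derivative_succ_X_mul, iterate_derivative_succ_X_mul]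
  push_cast
  ring

/-- The polynomial `D^k (X² - 1)^n`. -/
def rodrigues (k n : ℕ) : Polynomial ℝ := derivative^[k] ((X ^ 2 - 1) ^ n)

theorem derivative_rodrigues (k n : ℕ) : derivative (rodrigues k n) = rodrigues (k + 1) n := by
  rw [rodrigues, rodrigues, Function.iterate_succ_apply']

theorem derivative_quadratic_pow (n : ℕ) : derivative ((X ^ 2 - 1 : Polynomial ℝ) ^ (n + 1)) =
    ((2 * (n + 1) : ℕ) : Polynomial ℝ) * (X * (X ^ 2 - 1) ^ n) := by
  rw [Polynomial.derivative_pow_succ]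
  simp only [Polynomial.derivative_sub, Polynomial.derivative_X_pow, Polynomial.derivative_one]
  push_cast
  simp only [map_add, map_one, map_natCast, map_ofNat]
  ring

theorem rodrigues_succ_succ (k n : ℕ) : rodrigues (k + 2) (n + 1) =
    2 * ((n : Polynomial ℝ) + 1) * (X * rodrigues (k + 1) n + ((k : Polynomial ℝ) + 1) * rodrigues k n) := by
  simp only [rodrigues]
  rw [Function.iterate_succ_apply, derivative_quadratic_pow, Polynomial.iterate_derivative_natCast_mul,
    iterate_derivative_succ_X_mul]
  push_cast
  ring

/-- Leibniz' rule applied to (X² - 1) y' = 2nX y with y = (X² - 1)^n. For k = n this is Legendre's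
equation. -/
theorem rodrigues_step (k n : ℕ) : (X ^ 2 - 1) * rodrigues (k + 2) n =
    2 * ((n : Polynomial ℝ) - (k : Polynomial ℝ) - 1) * X * rodrigues (k + 1) n
      + ((k : Polynomial ℝ) + 1) * (2 * (n : Polynomial ℝ) - (k : Polynomial ℝ)) * rodrigues k n := by
  cases n with
  | zero =>
    have h : ∀ m, rodrigues (m + 1) 0 = 0 := fun m => by simp [rodrigues]
    rw [h, h]
    cases k with
    | zero => simp
    | succ m => rw [h]; simp
  | succ n =>
    -- The Leibniz formula used in the general case requires at least two derivatives; k = 0 needs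
    -- only one and is done by hand.
    cases k with
    | zero =>
      have h1 : rodrigues 1 (n + 1) = 2 * ((n : Polynomial ℝ) + 1) * (X * rodrigues 0 n) := by
        simp only [rodrigues, Function.iterate_one, derivative_quadratic_pow, Function.iterate_zero, id]
        push_cast; ring
      have h2 := rodrigues_succ_succ 0 n
      have h0 : rodrigues 0 (n + 1) = (X ^ 2 - 1) * rodrigues 0 n := by
        simp only [rodrigues, Function.iterate_zero, id]; ring
      have hd : (X ^ 2 - 1) * rodrigues 1 n = 2 * (n : Polynomial ℝ) * X * rodrigues 0 n := by
        cases n with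
        | zero => simp [rodrigues]
        | succ m =>
          simp only [rodrigues, Function.iterate_one, derivative_quadratic_pow, Function.iterate_zero, id]
          push_cast; ring
      rw [h2, h1, h0]
      push_cast
      simp only [zero_add]
      linear_combination (2 * ((n : Polynomial ℝ) + 1) * X) * hd
    | succ k =>
      have e : (X ^ 2 - 1) * derivative ((X ^ 2 - 1 : Polynomial ℝ) ^ (n + 1)) =
          ((2 * (n + 1) : ℕ) : Polynomial ℝ) * (X * (X ^ 2 - 1) ^ (n + 1)) := by
        rw [derivative_quadratic_pow]; ring
      have h := congrArg (derivative^[k + 2]) e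
      rw [iterate_derivative_quadratic_mul, Polynomial.iterate_derivative_natCast_mul,
        iterate_derivative_succ_X_mul] at h
      simp only [← Function.iterate_succ_apply] at h
      simp only [rodrigues, Nat.succ_eq_add_one] at h ⊢
      push_cast at h ⊢
      linear_combination h

theorem legendre_eq (n : ℕ) : legendre n = C (1 / (2 ^ n * (n.factorial : ℝ))) * rodrigues n n := rfl

theorem natCast_eq_C (n : ℕ) : (n : Polynomial ℝ) = C (n : ℝ) := by simp

/-- One derivative in Rodrigues' formula lowers (X² - 1)^(n+1) to 2(n+1) X (X² - 1)^n, and the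
factor 2(n+1) is absorbed by the normalisation (`hc`). -/
theorem derivative_legendre_succ (n : ℕ) : derivative (legendre (n + 1)) =
    X * derivative (legendre n) + ((n : Polynomial ℝ) + 1) * legendre n := by
  have hc : C (1 / (2 ^ (n + 1) * ((n + 1).factorial : ℝ))) * (2 * ((n : Polynomial ℝ) + 1)) =
      C (1 / (2 ^ n * (n.factorial : ℝ))) := by
    rw [natCast_eq_C, ← Polynomial.C_1, ← map_add, show (2 : Polynomial ℝ) = C 2 from rfl, ← map_mul, ← map_mul,
      Nat.factorial_succ]
    congr 1
    have := Nat.factorial_ne_zero n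
    push_cast
    field_simp
    ring
  simp only [legendre_eq, Polynomial.derivative_C_mul, derivative_rodrigues, rodrigues_succ_succ]
  rw [← hc]
  ring

theorem legendre_succ (n : ℕ) : ((n : Polynomial ℝ) + 1) * legendre (n + 1) =
    (X ^ 2 - 1) * derivative (legendre n) + ((n : Polynomial ℝ) + 1) * X * legendre n := by
  have hc : ((n : Polynomial ℝ) + 1) * C (1 / (2 ^ (n + 1) * ((n + 1).factorial : ℝ))) * 2 =
      C (1 / (2 ^ n * (n.factorial : ℝ))) := by
    rw [natCast_eq_C, ← Polynomial.C_1, ← map_add, show (2 : Polynomial ℝ) = C 2 from rfl, ← map_mul, ← map_mul,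
      Nat.factorial_succ]
    congr 1
    have := Nat.factorial_ne_zero n
    push_cast
    field_simp
    ring
  have hr : rodrigues (n + 1) (n + 1) =
      2 * ((X ^ 2 - 1) * rodrigues (n + 1) n + ((n : Polynomial ℝ) + 1) * X * rodrigues n n) := by
    cases n with
    | zero =>
      simp [rodrigues]
      ring
    | succ m =>
      have h1 := rodrigues_succ_succ m (m + 1)
      have h2 := rodrigues_step m (m + 1)
      rw [h1]
      push_cast at h2 ⊢
      linear_combination (-2 : Polynomial ℝ) * h2
  simp only [legendre_eq, Polynomial.derivative_C_mul, derivative_rodrigues]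
  rw [← hc, hr]
  ring

theorem legendre_ode (n : ℕ) : (X ^ 2 - 1) * derivative (derivative (legendre n)) + 2 * X * derivative (legendre n)
    = (n : Polynomial ℝ) * ((n : Polynomial ℝ) + 1) * legendre n := by
  have h := rodrigues_step n n
  simp only [legendre_eq, Polynomial.derivative_C_mul, derivative_rodrigues]
  linear_combination C (1 / (2 ^ n * (n.factorial : ℝ))) * h

/-- The three-term recurrence for P_L'. Multiplied by sin θ it describes multiplication of the spin
-1 harmonics by cos θ. -/
theorem legendre_recurrence (n : ℕ) : (2 * (n : Polynomial ℝ) + 3) * X * derivative (legendre (n + 1)) =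
    ((n : Polynomial ℝ) + 1) * derivative (legendre (n + 2)) + ((n : Polynomial ℝ) + 2) * derivative (legendre n) := by
  have h1 := derivative_legendre_succ n
  have h2 := derivative_legendre_succ (n + 1)
  have h3 := legendre_succ n
  rw [h2]
  push_cast
  linear_combination ((n : Polynomial ℝ) + 2) * X * h1 - ((n : Polynomial ℝ) + 2) * h3

theorem legendre_zero : legendre 0 = 1 := by simp [legendre]

theorem legendre_one : legendre 1 = X := by
  have := legendre_succ 0
  simpa [legendre_zero] using this

end Legendre

/-! ### The spin-weighted harmonics -/

/-- `sin θ P_L'(cos θ)`. -/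
def zonal (L : ℕ) (θ : ℝ) : ℝ := sin θ * (derivative (legendre L)).eval (cos θ)

/-- The normalisation `√((2 L + 1) / (4 π)) / √(L (L + 1))`. -/
def norming (L : ℕ) : ℝ := √((2 * L + 1) / (4 * π)) / √(L * (L + 1))

theorem hasDerivAt_eval_cos (p : Polynomial ℝ) (θ : ℝ) :
    HasDerivAt (fun θ => p.eval (cos θ)) (-(sin θ * (derivative p).eval (cos θ))) θ :=
  ((p.hasDerivAt (cos θ)).comp θ (Real.hasDerivAt_cos θ)).congr_deriv (by ring)

theorem harmNeg_eq (L : ℕ) : harmNeg L = fun θ => -norming L * zonal L θ := by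
  funext θ
  rw [harmNeg, norming, zonal]
  have : HasDerivAt (harm L) (√((2 * L + 1) / (4 * π)) * -(sin θ * (derivative (legendre L)).eval (cos θ))) θ :=
    (hasDerivAt_eval_cos _ θ).const_mul _
  rw [this.deriv]
  ring

theorem contDiff_zonal (L : ℕ) : ContDiff ℝ ∞ (zonal L) :=
  Real.contDiff_sin.mul ((Polynomial.contDiff_aeval _ _).comp Real.contDiff_cos)

theorem zonal_zero : zonal 0 = 0 := by funext θ; simp [zonal, legendre_zero]

theorem zonal_one (θ : ℝ) : zonal 1 θ = sin θ := by simp [zonal, legendre_one]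

theorem cos_mul_zonal (L : ℕ) (θ : ℝ) : (2 * (L : ℝ) + 3) * (cos θ * zonal (L + 1) θ) =
    (L + 1) * zonal (L + 2) θ + (L + 2) * zonal L θ := by
  have h := congrArg (Polynomial.eval (cos θ)) (legendre_recurrence L)
  simp only [Polynomial.eval_mul, Polynomial.eval_add, Polynomial.eval_X, Polynomial.eval_natCast,
    Polynomial.eval_ofNat, Polynomial.eval_one] at h
  simp only [zonal]
  linear_combination sin θ * h

/-- The derivative of `zonal L`. -/
def zonalDeriv (L : ℕ) (θ : ℝ) : ℝ :=
  cos θ * (derivative (legendre L)).eval (cos θ) - sin θ ^ 2 * (derivative (derivative (legendre L))).eval (cos θ)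

theorem contDiff_zonalDeriv (L : ℕ) : ContDiff ℝ ∞ (zonalDeriv L) :=
  (Real.contDiff_cos.mul ((Polynomial.contDiff_aeval _ _).comp Real.contDiff_cos)).sub
    ((Real.contDiff_sin.pow 2).mul ((Polynomial.contDiff_aeval _ _).comp Real.contDiff_cos))

theorem hasDerivAt_zonal (L : ℕ) (θ : ℝ) : HasDerivAt (zonal L) (zonalDeriv L θ) θ :=
  ((Real.hasDerivAt_sin θ).mul (hasDerivAt_eval_cos _ θ)).congr_deriv (by rw [zonalDeriv]; ring)

/-- Legendre's equation differentiated once and evaluated at cos θ: the associated equation of order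
one. It says that `zonal L` is an eigenfunction, with eigenvalue L(L+1), of the axisymmetric part of
the spin -1 Laplacian plus one. -/
theorem hasDerivAt_sin_mul_zonalDeriv (L : ℕ) {θ : ℝ} (hs : sin θ ≠ 0) :
    HasDerivAt (fun θ => sin θ * zonalDeriv L θ) (zonal L θ / sin θ - L * (L + 1) * (sin θ * zonal L θ)) θ := by
  have h := (Real.hasDerivAt_sin θ).mul (((Real.hasDerivAt_cos θ).mul (hasDerivAt_eval_cos (derivative (legendre L)) θ)).sub
    (((Real.hasDerivAt_sin θ).pow 2).mul (hasDerivAt_eval_cos (derivative (derivative (legendre L))) θ)))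
  refine HasDerivAt.congr_deriv h ?_
  have o := congrArg (Polynomial.eval (cos θ)) (congrArg derivative (legendre_ode L))
  simp only [Polynomial.derivative_mul, Polynomial.derivative_add, Polynomial.derivative_sub, Polynomial.derivative_X,
    Polynomial.derivative_X_sq, Polynomial.derivative_one, Polynomial.derivative_natCast, Polynomial.derivative_ofNat,
    Polynomial.eval_mul, Polynomial.eval_add, Polynomial.eval_sub, Polynomial.eval_pow, Polynomial.eval_X,
    Polynomial.eval_natCast, Polynomial.eval_ofNat, Polynomial.eval_one, Polynomial.eval_zero, Polynomial.eval_C] at o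
  have hsc : cos θ ^ 2 = 1 - sin θ ^ 2 := by rw [← sin_sq_add_cos_sq θ]; ring
  simp only [Pi.mul_apply, Pi.sub_apply, Pi.pow_apply, zonal, Nat.cast_ofNat, Nat.add_one_sub_one, pow_one]
  generalize Polynomial.eval (cos θ) (derivative (legendre L)) = p1 at *
  generalize Polynomial.eval (cos θ) (derivative (derivative (legendre L))) = p2 at *
  generalize Polynomial.eval (cos θ) (derivative (derivative (derivative (legendre L)))) = p3 at *
  field_simp
  rw [hsc] at o
  linear_combination (-(sin θ ^ 2)) * o + p1 * hsc

end KerrMaxwell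
end

noncomputable section

namespace KerrMaxwell

open Function (update)
open scoped ContDiff
open Polynomial (derivative)

variable {M a : ℝ} {W : Set (ℝ × ℝ)} {F : TwoForm} {q : Fin 4 → ℝ} {f g : (Fin 4 → ℝ) → ℂ} {w u : ℝ → ℝ} {L : ℕ}

/-! ### Moments in the polar angle -/

/-- `∫ f w(θ) dΩ`. -/
def moment (w : ℝ → ℝ) (f : (Fin 4 → ℝ) → ℂ) : (Fin 4 → ℝ) → ℂ := sphereInt fun p => f p * (w (p 2) : ℂ)

theorem mode_eq : mode L f = moment (harmNeg L) f := rfl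

theorem mean_eq : mean f = fun q => ((1 / √(4 * π) : ℝ) : ℂ) * moment (fun _ => 1) f q := by
  funext q
  simp [mean, moment]

theorem Smooth.mul_angle (hf : Smooth M W f) (hw : ContDiff ℝ ∞ w) : Smooth M W fun p => f p * (w (p 2) : ℂ) :=
  hf.mul (smooth_of_contDiff (hw.comp (contDiff_apply ℝ ℝ (2 : Fin 4)))).ofReal

theorem continuousOn_mul_angle (hf : Smooth M W f) (hw : Continuous w) :
    ContinuousOn (fun p => f p * (w (p 2) : ℂ)) (dom M W) :=
  (ContDiffOn.continuousOn hf).mul (by fun_prop)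

theorem moment_congr_chart (h : EqOn f g (chart M W)) : EqOn (moment w f) (moment w g) (dom M W) := fun _ hq =>
  sphereInt_congr_chart (fun p hp => by simp only [h hp]) hq

theorem moment_congr_horizon (h : EqOn f g (horizon M W)) : EqOn (moment w f) (moment w g) (horizon M W) :=
  fun q hq => sphereInt_congr fun θ hθ φ => by
    have : (![q 0, q 1, θ, φ] : Fin 4 → ℝ) ∈ horizon M W := ⟨hq.1, hq.2.1, hθ⟩
    simp only [h this]

theorem moment_mul_angle : moment w (fun p => (u (p 2) : ℂ) * f p) = moment (fun θ => u θ * w θ) f := by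
  unfold moment
  congr 1
  funext p
  push_cast
  ring

theorem moment_const_mul_weight (c : ℝ) : moment (fun θ => c * w θ) f q = c * moment w f q := by
  rw [moment, moment, ← sphereInt_const_mul]
  congr 1
  funext p
  push_cast
  ring

theorem moment_add_weight (hf : Smooth M W f) (hw : Continuous w) (hu : Continuous u) (hq : q ∈ dom M W) :
    moment (fun θ => w θ + u θ) f q = moment w f q + moment u f q := by
  rw [moment, moment, moment, ← sphereInt_add (continuousOn_mul_angle hf hw) (continuousOn_mul_angle hf hu) hq]
  congr 1
  funext p
  push_cast
  ring

theorem sphereInt_add_const_mul (hf : ContinuousOn f (dom M W)) (hg : ContinuousOn g (dom M W)) (hq : q ∈ dom M W)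
    (c : ℂ) : sphereInt (fun p => f p + c * g p) q = sphereInt f q + c * sphereInt g q := by
  rw [sphereInt_add (g := fun p => c * g p) hf (continuousOn_const.mul hg) hq, sphereInt_const_mul]

theorem moment_const_mul (c : ℂ) : moment w (fun p => c * f p) q = c * moment w f q := by
  rw [moment, moment, ← sphereInt_const_mul]
  simp only [mul_assoc]

theorem moment_add (hf : Smooth M W f) (hg : Smooth M W g) (hw : Continuous w) (hq : q ∈ dom M W) :
    moment w (fun p => f p + g p) q = moment w f q + moment w g q := by
  rw [moment, moment, moment, ← sphereInt_add (continuousOn_mul_angle hf hw) (continuousOn_mul_angle hg hw) hq]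
  simp only [add_mul]

theorem hasPartial_moment (hW : IsOpen W) (hf : Smooth M W f) (hw : ContDiff ℝ ∞ w) (hq : q ∈ dom M W) {i : Fin 4}
    (hi : i = 0 ∨ i = 1) : HasPartial M i (moment w f) (moment w (pd M i f) q) q := by
  have h := hasPartial_sphereInt hW (hf.mul_angle hw) hq hi
  have hi2 : i ≠ 2 := by rcases hi with rfl | rfl <;> decide
  have e : EqOn (pd M i fun p => f p * (w (p 2) : ℂ)) (fun p => pd M i f p * (w (p 2) : ℂ)) (dom M W) := fun p hp =>
    (((hf.hasPartial hW hp).mul (hasPartial_coord_of_ne (fun t => (w t : ℂ)) hi2)).congr_deriv (by ring)).pd_eq hp.1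
  exact h.congr_deriv (sphereInt_congr fun θ hθ φ => e ⟨hq.1, hq.2⟩)

/-- The modes of the spin `-1` Laplacian. -/
theorem moment_zonal_laplacian (hW : IsOpen W) (hf : Smooth M W f) (hq : q ∈ dom M W)
    {l : (Fin 4 → ℝ) → ℂ} (hl : Smooth M W l)
    (h : ∀ θ ∈ Ioo 0 π, ∀ φ, l ![q 0, q 1, θ, φ] = -pd M 2 (pd M 2 f) ![q 0, q 1, θ, φ]
      - ((cos θ / sin θ : ℝ) : ℂ) * pd M 2 f ![q 0, q 1, θ, φ] + ((1 / sin θ ^ 2 : ℝ) : ℂ) * f ![q 0, q 1, θ, φ]) :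
    moment (zonal L) l q = L * (L + 1) * moment (zonal L) f q := by
  -- With Z = `zonal L`, the next two functions add up to the Green primitive f sin θ Z' - (∂_θ f)
  -- sin θ Z. Its θ-derivative is sin θ (l - L(L+1) f) Z, and it vanishes at both poles. The smooth
  -- function l stands for the Laplacian of f because the separate cot θ and 1 / sin²θ terms are
  -- singular there.
  have hs : Smooth M W fun p => f p * ((sin (p 2) * zonalDeriv L (p 2) : ℝ) : ℂ) :=
    hf.mul_angle (w := fun θ => sin θ * zonalDeriv L θ) (Real.contDiff_sin.mul (contDiff_zonalDeriv L))
  have hs' : Smooth M W fun p => pd M 2 f p * ((-(sin (p 2) * zonal L (p 2)) : ℝ) : ℂ) :=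
    (hf.pd hW 2).mul_angle (w := fun θ => -(sin θ * zonal L θ)) (Real.contDiff_sin.mul (contDiff_zonal L)).neg
  have hc := (contDiff_zonal L).continuous
  have key : sphereInt (fun p => l p * (zonal L (p 2) : ℂ)
      + (-(L * (L + 1)) : ℂ) * (f p * (zonal L (p 2) : ℂ))) q = 0 := by
    refine sphereInt_eq_zero hW (hs.add hs') hq ?_ ?_
    · intro p hp; simp [hp]
    · intro θ hθ φ
      have hm : (![q 0, q 1, θ, φ] : Fin 4 → ℝ) ∈ dom M W := ⟨hq.1, hq.2⟩
      have hθ' : sin θ ≠ 0 := (sin_pos_of_mem_Ioo hθ).ne'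
      have hθ2 : (sin θ : ℂ) ≠ 0 := by exact_mod_cast hθ'
      have d1 := hasPartial_coord_self (M := M) (i := 2) (q := ![q 0, q 1, θ, φ])
        (hasDerivAt_sin_mul_zonalDeriv L hθ')
      have d2 := hasPartial_coord_self (M := M) (i := 2) (q := ![q 0, q 1, θ, φ])
        (((Real.hasDerivAt_sin θ).mul (hasDerivAt_zonal L θ)).neg)
      have d := ((hf.hasPartial hW hm).mul d1.ofReal).add (((hf.pd hW 2).hasPartial hW hm).mul d2.ofReal)
      refine Eq.trans ?_ (d.pd_eq hm.1).symm
      rw [h θ hθ φ]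
      simp only [Matrix.cons_val, Pi.mul_apply, Pi.neg_apply]
      push_cast [-Complex.ofReal_cos, -Complex.ofReal_sin]
      field_simp
      ring
  rw [sphereInt_add_const_mul (continuousOn_mul_angle hl hc) (continuousOn_mul_angle hf hc) hq] at key
  unfold moment
  linear_combination key

theorem zonal_two (θ : ℝ) : zonal 2 θ = 3 * (cos θ * sin θ) := by
  have h := cos_mul_zonal 0 θ
  rw [zonal_zero, zero_add, zonal_one] at h
  simp only [Nat.cast_zero, Pi.zero_apply] at h
  linear_combination -h

theorem zonal_three (θ : ℝ) : 2 * zonal 3 θ = (15 * cos θ ^ 2 - 3) * sin θ := by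
  have h := cos_mul_zonal 1 θ
  rw [show 1 + 1 = 2 from rfl, zonal_two, zonal_one] at h
  norm_num at h
  linear_combination -h

/-! ### The spherical mean of Υ and its transversal derivatives. -/

section Mean

variable (hM : 0 < M) (hW : IsOpen W) (hF : IsMaxwellField M a W F)
include hM hW hF

/-- In the integral of κ(∂_θ + cot θ)ψ, integration by parts moves ∂_θ onto κ, and ∂_θ κ = ia sin θ
doubles the term -ia sin θ ψ already present. For the T-term, κ sin θ is r `zonal 1` - (ia/3) `zonal
2`. -/
theorem moment_pd_one_upsReg (hZ : ∀ q ∈ chart M W, pd M 3 (alphaNeg a F) q = 0) (hq : q ∈ dom M W) :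
    moment (fun _ => 1) (pd M 1 (upsReg a F)) q = -(Complex.I * a) * (q 1 * moment (zonal 1) (pd M 0 (core a F)) q
      - Complex.I * a / 3 * moment (zonal 2) (pd M 0 (core a F)) q - 2 * moment (zonal 1) (core a F) q) := by
  have hB := smooth_core (W := W) hM hF
  have hT := hB.pd hW 0
  have hU := (smooth_upsReg (W := W) hM hF).pd hW 1
  -- The primitive -κψ sin θ, zero at both poles.
  have hk : Smooth M W fun p => (kap a p * core a F p) * ((-sin (p 2) : ℝ) : ℂ) :=
    ((smooth_of_contDiff contDiff_kap).mul hB).mul_angle (w := fun θ => -sin θ) Real.contDiff_sin.neg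
  have c1 := continuousOn_mul_angle (w := fun _ => 1) hU continuous_const
  have c2 := continuousOn_mul_angle (w := zonal 1) hT (contDiff_zonal 1).continuous
  have c3 := continuousOn_mul_angle (w := zonal 2) hT (contDiff_zonal 2).continuous
  have c4 := continuousOn_mul_angle (w := zonal 1) hB (contDiff_zonal 1).continuous
  have key : sphereInt (fun p => pd M 1 (upsReg a F) p * ((1 : ℝ) : ℂ)
      + Complex.I * a * q 1 * (pd M 0 (core a F) p * (zonal 1 (p 2) : ℂ))
      + -(Complex.I * a * (Complex.I * a / 3)) * (pd M 0 (core a F) p * (zonal 2 (p 2) : ℂ))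
      + -(2 * (Complex.I * a)) * (core a F p * (zonal 1 (p 2) : ℂ))) q = 0 := by
    refine sphereInt_eq_zero hW hk hq ?_ ?_
    · intro p hp; simp [hp]
    · intro θ hθ φ
      have hm : (![q 0, q 1, θ, φ] : Fin 4 → ℝ) ∈ chart M W := ⟨hq.1, hq.2, hθ⟩
      have hθ2 : (sin θ : ℂ) ≠ 0 := by exact_mod_cast (sin_pos_of_mem_Ioo hθ).ne'
      have d := ((hasPartial_kap_two (a := a)).mul (hasPartial_core hM hW hF (chart_subset_dom hm) 2)).mul
        (hasPartial_coord_self (M := M) (i := 2) (q := ![q 0, q 1, θ, φ]) (Real.hasDerivAt_sin θ).neg).ofReal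
      refine Eq.trans ?_ (d.pd_eq hm.1).symm
      simp only [pd_one_upsReg_eq_transversal hM hW hF hZ hm, transversal, kap, zonal_one, zonal_two, Matrix.cons_val,
        Pi.neg_apply]
      push_cast [-Complex.ofReal_cos, -Complex.ofReal_sin]
      field_simp
      ring
  rw [sphereInt_add_const_mul ((c1.fun_add (continuousOn_const.fun_mul c2)).fun_add (continuousOn_const.fun_mul c3)) c4 hq,
    sphereInt_add_const_mul (c1.fun_add (continuousOn_const.fun_mul c2)) c3 hq, sphereInt_add_const_mul c1 c2 hq] at key
  unfold moment
  linear_combination key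

omit hM hW hF in
theorem moment_weight_mul (hq : q ∈ dom M W) (h : EqOn f (fun p => weight a p * g p) (dom M W)) :
    moment w f q = weight a q * moment w g q := by
  rw [moment, moment, ← sphereInt_const_mul]
  refine sphereInt_congr fun θ hθ φ => ?_
  have hm : (![q 0, q 1, θ, φ] : Fin 4 → ℝ) ∈ dom M W := ⟨hq.1, hq.2⟩
  simp only [h hm, mul_assoc]
  rfl

omit hM hW hF in
theorem weight_ne_zero (hM : 0 < M) (hq : M ≤ q 1) : weight a q ≠ 0 := by
  have : √(q 1 ^ 2 + a ^ 2) / √2 ≠ 0 := by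
    have := Real.sqrt_pos.2 (radial_pos (a := a) hM hq)
    positivity
  rw [weight]; exact_mod_cast this

/-- The transversal derivative of the spherical mean, at any radius. -/
def meanFlux (M a : ℝ) (F : TwoForm) (q : Fin 4 → ℝ) : ℂ :=
  ((1 / √(4 * π) : ℝ) : ℂ) * (Complex.I * a) * ((weight a q)⁻¹ * (q 1 * moment (zonal 1) (pd M 0 (phiReg a F)) q
    - Complex.I * a / 3 * moment (zonal 2) (pd M 0 (phiReg a F)) q - 2 * moment (zonal 1) (phiReg a F) q))

theorem hasPartial_mean (hq : q ∈ dom M W) :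
    HasPartial M 1 (mean (Ups M a F)) (((1 / √(4 * π) : ℝ) : ℂ) * moment (fun _ => 1) (pd M 1 (upsReg a F)) q) q := by
  have hU := smooth_upsReg (W := W) hM hF
  refine hasPartial_congr_dom hW (g := fun q => ((1 / √(4 * π) : ℝ) : ℂ) * moment (fun _ => 1) (upsReg a F) q) ?_ hq
    ((hasPartial_moment hW hU contDiff_const hq (Or.inr rfl)).const_mul _)
  intro p hp
  rw [mean_eq]
  simp only [moment_congr_chart (Ups_eq hM) hp]

/-- The formula is needed on all of `dom`: an identity restricted to the horizon could not be
differentiated again in r to reach e₃e₃Υ₀. -/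
theorem along_e3_mean (hZ : ∀ q ∈ chart M W, pd M 3 (alphaNeg a F) q = 0) :
    EqOn (along M e3 (mean (Ups M a F))) (meanFlux M a F) (dom M W) := fun q hq => by
  have hp := smooth_phiReg (W := W) hM hF
  have hw := weight_ne_zero (a := a) hM hq.1
  have e := pd_phiReg_of_ne hM hW hF (a := a) (k := 0) (by decide)
  simp only [along_e3]
  rw [(hasPartial_mean hM hW hF hq).pd_eq hq.1, moment_pd_one_upsReg hM hW hF hZ hq, meanFlux,
    moment_weight_mul (f := phiReg a F) (g := core a F) hq (fun _ _ => rfl), moment_weight_mul hq e,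
    moment_weight_mul hq e]
  field_simp

theorem hasPartial_meanFlux (hq : q ∈ dom M W) : HasPartial M 1 (meanFlux M a F)
    (((1 / √(4 * π) : ℝ) : ℂ) * (Complex.I * a) * ((weight a q)⁻¹ * (moment (zonal 1) (pd M 0 (phiReg a F)) q
      + q 1 * moment (zonal 1) (pd M 1 (pd M 0 (phiReg a F))) q
      - Complex.I * a / 3 * moment (zonal 2) (pd M 1 (pd M 0 (phiReg a F))) q
      - 2 * moment (zonal 1) (pd M 1 (phiReg a F)) q)
      - (q 1 / (q 1 ^ 2 + a ^ 2) : ℝ) * (weight a q)⁻¹ * (q 1 * moment (zonal 1) (pd M 0 (phiReg a F)) q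
    - Complex.I * a / 3 * moment (zonal 2) (pd M 0 (phiReg a F)) q - 2 * moment (zonal 1) (phiReg a F) q))) q := by
  have hp := smooth_phiReg (W := W) hM hF
  have hw := weight_ne_zero (a := a) hM hq.1
  have h0 := hp.pd hW 0
  have d1 := hasPartial_moment hW h0 (contDiff_zonal 1) hq (Or.inr rfl)
  have d2 := hasPartial_moment hW h0 (contDiff_zonal 2) hq (Or.inr rfl)
  have d3 := hasPartial_moment hW hp (contDiff_zonal 1) hq (Or.inr rfl)
  refine ((((hasPartial_weight_one hM hq.1).inv hw).mul (((hasPartial_radius.mul d1).sub (d2.const_mul _)).sub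
    (d3.const_mul _))).const_mul _).congr_deriv ?_
  field_simp
  ring

end Mean

end KerrMaxwell
end

noncomputable section

namespace KerrMaxwell

open Function (update)
open scoped ContDiff
open Polynomial (derivative)

variable {M a : ℝ} {W : Set (ℝ × ℝ)} {F : TwoForm} {q : Fin 4 → ℝ} {w : ℝ → ℝ} {L : ℕ}

/-! ### Modes on the horizon -/

section HorizonModes

variable (hM : 0 < M) (hW : IsOpen W) (hF : IsMaxwellField M a W F)
include hM

theorem mode_phi0 : EqOn (mode L (phi0 a F)) (fun q => -(norming L : ℂ) * moment (zonal L) (phiReg a F) q)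
    (dom M W) := fun q hq => by
  rw [mode_eq, moment_congr_chart (phi0_eq hM) hq, harmNeg_eq, moment_const_mul_weight, Complex.ofReal_neg]

include hW

theorem mode_Phi : EqOn (mode L (Phi M a F)) (fun q => -(norming L : ℂ) * moment (zonal L) (PhiReg M a F) q)
    (dom M W) := fun q hq => by
  rw [mode_eq, moment_congr_chart (Phi_eq hM hW) hq, harmNeg_eq, moment_const_mul_weight, Complex.ofReal_neg]

include hF

theorem hasPartial_mode_phi0 (hq : q ∈ dom M W) {i : Fin 4} (hi : i = 0 ∨ i = 1) :
    HasPartial M i (mode L (phi0 a F)) (-(norming L : ℂ) * moment (zonal L) (pd M i (phiReg a F)) q) q :=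
  hasPartial_congr_dom hW (mode_phi0 hM) hq
    ((hasPartial_moment hW (smooth_phiReg hM hF) (contDiff_zonal L) hq hi).const_mul _)

theorem hasPartial_mode_Phi (hq : q ∈ dom M W) {i : Fin 4} (hi : i = 0 ∨ i = 1) :
    HasPartial M i (mode L (Phi M a F)) (-(norming L : ℂ) * moment (zonal L) (pd M i (PhiReg M a F)) q) q :=
  hasPartial_congr_dom hW (mode_Phi hM hW) hq
    ((hasPartial_moment hW (smooth_PhiReg hM hW hF) (contDiff_zonal L) hq hi).const_mul _)

variable (hZ : ∀ q ∈ chart M W, pd M 3 (alphaNeg a F) q = 0) (ha : |a| = M)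
include hZ ha

theorem moment_PhiReg_horizon (hq : q ∈ horizon M W) :
    moment w (PhiReg M a F) q = 4 * (M : ℂ) ^ 2 * moment w (pd M 0 (phiReg a F)) q := by
  rw [moment_congr_horizon (fun p hp => PhiReg_horizon hM hW hF hZ ha hp) hq, moment_const_mul]

theorem moment_pd_one_PhiReg_horizon (hw : Continuous w) (hq : q ∈ horizon M W) :
    moment w (pd M 1 (PhiReg M a F)) q = 4 * M * moment w (pd M 0 (phiReg a F)) q
      + 4 * (M : ℂ) ^ 2 * moment w (pd M 1 (pd M 0 (phiReg a F))) q + 2 * moment w (phiReg a F) q := by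
  have hd := chart_subset_dom (horizon_subset_chart hq)
  have hp := smooth_phiReg (W := W) hM hF
  have c : ∀ c : ℂ, Smooth M W fun _ => c := fun c => smooth_of_contDiff contDiff_const
  rw [moment_congr_horizon (fun p hp => pd_one_PhiReg_horizon hM hW hF hZ ha hp) hq,
    moment_add (((c _).mul (hp.pd hW 0)).add ((c _).mul ((hp.pd hW 0).pd hW 1))) ((c _).mul hp) hw hd,
    moment_add ((c _).mul (hp.pd hW 0)) ((c _).mul ((hp.pd hW 0).pd hW 1)) hw hd, moment_const_mul,
    moment_const_mul, moment_const_mul]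

/-- The modes of the Teukolsky equation on the horizon. -/
theorem moment_teukolsky (hq : q ∈ horizon M W) :
    (L : ℂ) * (L + 1) * moment (zonal L) (phiReg a F) q = moment (zonal L) (pd M 1 (PhiReg M a F)) q
      + 1 / 4 * moment (fun θ => sin θ ^ 2 * zonal L θ) (pd M 0 (PhiReg M a F)) q
      + Complex.I * a / (2 * (M : ℂ) ^ 2) * moment (fun θ => cos θ * zonal L θ) (PhiReg M a F) q := by
  have hd := chart_subset_dom (horizon_subset_chart hq)
  have hp := smooth_phiReg (W := W) hM hF
  have hP := smooth_PhiReg hM hW hF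
  have hc := (contDiff_zonal L).continuous
  have c : ∀ c : ℂ, Smooth M W fun _ => c := fun c => smooth_of_contDiff contDiff_const
  have s1 : Smooth M W fun p => ((sin (p 2) ^ 2 : ℝ) : ℂ) * pd M 0 (PhiReg M a F) p :=
    (smooth_of_contDiff ((Real.contDiff_sin.pow 2).comp (contDiff_apply ℝ ℝ (2 : Fin 4)))).ofReal.mul (hP.pd hW 0)
  have s2 : Smooth M W fun p => ((cos (p 2) : ℝ) : ℂ) * PhiReg M a F p :=
    (smooth_of_contDiff (Real.contDiff_cos.comp (contDiff_apply ℝ ℝ (2 : Fin 4)))).ofReal.mul hP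
  have s3 := (hP.pd hW 1).add ((c (1 / 4)).mul s1)
  rw [← moment_zonal_laplacian hW hp hd (s3.add ((c (Complex.I * a / (2 * (M : ℂ) ^ 2))).mul s2)) ?_,
    moment_add s3 ((c _).mul s2) hc hd, moment_add (hP.pd hW 1) ((c _).mul s1) hc hd, moment_const_mul,
    moment_const_mul, moment_mul_angle (u := fun θ => sin θ ^ 2), moment_mul_angle (u := cos)]
  intro θ hθ φ
  have hm : (![q 0, q 1, θ, φ] : Fin 4 → ℝ) ∈ horizon M W := ⟨hq.1, hq.2.1, hθ⟩
  refine Eq.trans ?_ (phiReg_teukolsky hM hW hF hZ ha hm).symm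
  push_cast [-Complex.ofReal_cos, -Complex.ofReal_sin]
  ring

theorem moment_teukolsky_one (hq : q ∈ horizon M W) :
    2 * moment (zonal 1) (phiReg a F) q = moment (zonal 1) (pd M 1 (PhiReg M a F)) q
      + 1 / 5 * moment (zonal 1) (pd M 0 (PhiReg M a F)) q - 1 / 30 * moment (zonal 3) (pd M 0 (PhiReg M a F)) q
      + Complex.I * a / (6 * (M : ℂ) ^ 2) * moment (zonal 2) (PhiReg M a F) q := by
  have hd := chart_subset_dom (horizon_subset_chart hq)
  have hP := (smooth_PhiReg hM hW hF).pd hW 0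
  have h := moment_teukolsky hM hW hF hZ ha hq (L := 1)
  -- Expansion of sin³θ in the unnormalised harmonics; the prefactor 1/4 in the mode equation turns
  -- 4/5 and -2/15 into 1/5 and -1/30.
  have e1 : (fun θ => sin θ ^ 2 * zonal 1 θ) = fun θ => 4 / 5 * zonal 1 θ + -(2 / 15) * zonal 3 θ := by
    funext θ
    rw [zonal_one]
    linear_combination (1 / 15) * zonal_three θ + sin θ * sin_sq_add_cos_sq θ
  have e2 : (fun θ => cos θ * zonal 1 θ) = fun θ => 1 / 3 * zonal 2 θ := by
    funext θ
    rw [zonal_one, zonal_two]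
    ring
  have c1 := (contDiff_zonal 1).continuous
  have c3 := (contDiff_zonal 3).continuous
  rw [e1, e2, moment_add_weight hP (by fun_prop) (by fun_prop) hd, moment_const_mul_weight, moment_const_mul_weight,
    moment_const_mul_weight] at h
  push_cast at h
  linear_combination h

end HorizonModes

end KerrMaxwell
end

noncomputable section

namespace KerrMaxwell

open Function (update)
open scoped ContDiff
open Polynomial (derivative)

variable {M a : ℝ} {W : Set (ℝ × ℝ)} {F : TwoForm} {q : Fin 4 → ℝ} {w : ℝ → ℝ} {L : ℕ}

/-! ### Normalisation constants -/

theorem norming_eq (L : ℕ) : norming L = 1 / √(4 * π) * (√(2 * L + 1) / √(L * (L + 1))) := by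
  rw [norming, Real.sqrt_div (by positivity)]
  ring

theorem norming_one : norming 1 = √6 / 2 * (1 / √(4 * π)) := by
  have e : √6 = √2 * √3 := by rw [← Real.sqrt_mul (by norm_num)]; norm_num
  have h : √2 ^ 2 = (2 : ℝ) := Real.sq_sqrt (by norm_num)
  have h0 : √2 ≠ 0 := by simp
  rw [norming_eq, e]
  norm_num
  field_simp
  linear_combination -h

theorem norming_two : norming 2 = √5 * √6 / 6 * (1 / √(4 * π)) := by
  have h : √6 ^ 2 = (6 : ℝ) := Real.sq_sqrt (by norm_num)
  have h0 : √6 ≠ 0 := by simp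
  rw [norming_eq]
  norm_num
  field_simp
  linear_combination -h

/-- With the factor √14 the constant becomes a rational multiple of √6 / √(4π), as is `norming 1`;
this is why √14 enters the coefficient of Φ_3. -/
theorem norming_three : √14 * norming 3 = 7 * √6 / 6 * (1 / √(4 * π)) := by
  have e : √14 = √2 * √7 := by rw [← Real.sqrt_mul (by norm_num)]; norm_num
  have e6 : √6 = √2 * √3 := by rw [← Real.sqrt_mul (by norm_num)]; norm_num
  have e12 : √12 = 2 * √3 := by
    rw [show (12 : ℝ) = 2 ^ 2 * 3 by norm_num, Real.sqrt_mul (by norm_num), Real.sqrt_sq (by norm_num)]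
  have h3 : √3 ^ 2 = (3 : ℝ) := Real.sq_sqrt (by norm_num)
  have h7 : √7 ^ 2 = (7 : ℝ) := Real.sq_sqrt (by norm_num)
  have h0 : √3 ≠ 0 := by simp
  have hn : norming 3 = 1 / √(4 * π) * (√7 / √12) := by rw [norming_eq]; norm_num
  rw [hn, e, e6, e12]
  field_simp
  linear_combination 6 * h7 - 14 * h3

theorem sqrt_two_thirds : √(2 / 3) = √6 / 3 := by
  rw [show (2 / 3 : ℝ) = 6 / 3 ^ 2 by norm_num, Real.sqrt_div (by norm_num), Real.sqrt_sq (by norm_num)]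

theorem sqrt_thirty : √30 = √5 * √6 := by rw [← Real.sqrt_mul (by norm_num)]; norm_num

/-! ### Spherical means and charges -/

section Charges

variable (hM : 0 < M) (hW : IsOpen W) (hF : IsMaxwellField M a W F)
  (hZ : ∀ q ∈ chart M W, pd M 3 (alphaNeg a F) q = 0) (ha : |a| = M)
include hM hW hF hZ ha

theorem along_e3_mean_horizon (hq : q ∈ horizon M W) : along M e3 (mean (Ups M a F)) q =
    -(1 / (2 * (√30 : ℝ) * M)) *
        (Complex.I * a / M * (√5 : ℝ) * mode 1 (Phi M a F) q + mode 2 (Phi M a F) q)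
      + 2 * Complex.I * a / M * (√(2 / 3) : ℝ) * mode 1 (phi0 a F) q := by
  have hd := chart_subset_dom (horizon_subset_chart hq)
  have ha2 : a ^ 2 = M ^ 2 := by rw [← ha, sq_abs]
  have ha2' : (a : ℂ) ^ 2 = (M : ℂ) ^ 2 := by exact_mod_cast ha2
  have hM' : (M : ℂ) ≠ 0 := by exact_mod_cast hM.ne'
  have h5 : ((√5 : ℝ) : ℂ) ≠ 0 := by simp
  have h6 : ((√6 : ℝ) : ℂ) ≠ 0 := by simp
  have h66 : ((√6 : ℝ) : ℂ) ^ 2 = 6 := by exact_mod_cast Real.sq_sqrt (show (0 : ℝ) ≤ 6 by norm_num)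
  simp only [along_e3_mean hM hW hF hZ hd, meanFlux, weight_horizon hM ha2 hq.1, hq.1, mode_Phi hM hW hd,
    mode_phi0 hM hd, norming_one, norming_two, moment_PhiReg_horizon hM hW hF hZ ha hq, sqrt_two_thirds, sqrt_thirty]
  generalize (1 / √(4 * π) : ℝ) = ν
  push_cast
  generalize ((√5 : ℝ) : ℂ) = X at *
  generalize ((√6 : ℝ) : ℂ) = Y at *
  generalize moment (zonal 1) (pd M 0 (phiReg a F)) q = t1
  generalize moment (zonal 2) (pd M 0 (phiReg a F)) q = t2
  generalize moment (zonal 1) (phiReg a F) q = z1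
  field_simp
  linear_combination (-24 * (ν : ℂ) * t2 * (a : ℂ) ^ 2) * Complex.I_sq + 24 * (ν : ℂ) * t2 * ha2'
    + 24 * Complex.I * a * ν * z1 * h66

/-- The L = 1 Teukolsky mode equation is solved for φ̃_{0,1}. Its cos θ term contributes a further
multiple of Φ_2 through (ia)² = -M², which triples the coefficient of Φ_2. -/
theorem along_e3_mean_of_Phi (hq : q ∈ horizon M W) : along M e3 (mean (Ups M a F)) q =
    -(Complex.I * a / (2 * (√6 : ℝ) * (M : ℂ) ^ 2)) * mode 1 (Phi M a F) q
      - 3 / (2 * (√30 : ℝ) * M) * mode 2 (Phi M a F) q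
      + 2 * Complex.I * a / ((√6 : ℝ) * M) *
        (-along M e3 (mode 1 (Phi M a F)) q + 1 / 5 * pd M 0 (mode 1 (Phi M a F)) q
          - (√14 : ℝ) / 70 * pd M 0 (mode 3 (Phi M a F)) q) := by
  have hd := chart_subset_dom (horizon_subset_chart hq)
  have ha2 : a ^ 2 = M ^ 2 := by rw [← ha, sq_abs]
  have ha2' : (a : ℂ) ^ 2 = (M : ℂ) ^ 2 := by exact_mod_cast ha2
  have hM' : (M : ℂ) ≠ 0 := by exact_mod_cast hM.ne'
  have h5 : ((√5 : ℝ) : ℂ) ≠ 0 := by simp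
  have h6 : ((√6 : ℝ) : ℂ) ≠ 0 := by simp
  have h66 : ((√6 : ℝ) : ℂ) ^ 2 = 6 := by exact_mod_cast Real.sq_sqrt (show (0 : ℝ) ≤ 6 by norm_num)
  have n3 : ((√14 : ℝ) : ℂ) * (norming 3 : ℂ) = 7 * ((√6 : ℝ) : ℂ) / 6 * ((1 / √(4 * π) : ℝ) : ℂ) := by
    exact_mod_cast norming_three
  have key := moment_teukolsky_one hM hW hF hZ ha hq
  have m1 := moment_PhiReg_horizon hM hW hF hZ ha hq (w := zonal 1)
  simp only [along_e3_mean hM hW hF hZ hd, meanFlux, weight_horizon hM ha2 hq.1, hq.1, mode_Phi hM hW hd, along_e3,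
    (hasPartial_mode_Phi hM hW hF hd (Or.inr rfl)).pd_eq hd.1, (hasPartial_mode_Phi hM hW hF hd (Or.inl rfl)).pd_eq hd.1,
    norming_one, norming_two, sqrt_thirty]
  have m2 := moment_PhiReg_horizon hM hW hF hZ ha hq (w := zonal 2)
  rw [m2] at key ⊢
  rw [m1]
  generalize (1 / √(4 * π) : ℝ) = ν at *
  push_cast
  generalize ((√5 : ℝ) : ℂ) = X at *
  generalize ((√6 : ℝ) : ℂ) = Y at *
  generalize ((√14 : ℝ) : ℂ) = R at *
  generalize (norming 3 : ℂ) = N at *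
  generalize moment (zonal 1) (pd M 0 (phiReg a F)) q = t1 at *
  generalize moment (zonal 2) (pd M 0 (phiReg a F)) q = t2 at *
  generalize moment (zonal 1) (phiReg a F) q = z1 at *
  generalize moment (zonal 1) (pd M 0 (PhiReg M a F)) q = p1 at *
  generalize moment (zonal 3) (pd M 0 (PhiReg M a F)) q = p3 at *
  generalize moment (zonal 1) (pd M 1 (PhiReg M a F)) q = s1 at *
  have n3' : R / 70 * (-N * p3) = -(7 * Y / 6 * ν * p3 / 70) := by linear_combination (-p3 / 70) * n3
  rw [n3']
  field_simp at key ⊢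
  linear_combination (-28 * Complex.I * a * ν) * key + (-25200 * (ν : ℂ) * t2 * (a : ℂ) ^ 2) * Complex.I_sq
    + 25200 * (ν : ℂ) * t2 * ha2'

/-- The horizon charge of the spin `-1` field in terms of moments. -/
def momentCharge (M a : ℝ) (F : TwoForm) (q : Fin 4 → ℝ) : ℂ :=
  4 * (M : ℂ) ^ 2 * moment (zonal 1) (pd M 1 (phiReg a F)) q + 4 * M * moment (zonal 1) (phiReg a F) q
    + 2 * Complex.I * a / 3 * moment (zonal 2) (phiReg a F) q + 1 / 5 * moment (zonal 1) (PhiReg M a F) q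
    - 1 / 30 * moment (zonal 3) (PhiReg M a F) q

-- In unnormalised moments the square roots in the charge disappear, leaving one overall factor.
omit hZ ha in
theorem teukolskyCharge_eq (hq : q ∈ dom M W) :
    teukolskyCharge M a F q = -(norming 1 : ℂ) * momentCharge M a F q := by
  have h5 : ((√5 : ℝ) : ℂ) ≠ 0 := by simp
  have n3 : ((√14 : ℝ) : ℂ) * (norming 3 : ℂ) = 7 * ((√6 : ℝ) : ℂ) / 6 * ((1 / √(4 * π) : ℝ) : ℂ) := by
    exact_mod_cast norming_three
  simp only [teukolskyCharge, momentCharge, mode_Phi hM hW hq, mode_phi0 hM hq, along_e3,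
    (hasPartial_mode_phi0 hM hW hF hq (Or.inr rfl)).pd_eq hq.1, norming_one, norming_two]
  generalize (1 / √(4 * π) : ℝ) = ν at *
  push_cast
  have n3' : ((√14 : ℝ) : ℂ) / 70 * (-norming 3 * moment (zonal 3) (PhiReg M a F) q) =
      -(7 * ((√6 : ℝ) : ℂ) / 6 * ν * moment (zonal 3) (PhiReg M a F) q / 70) := by
    linear_combination (-moment (zonal 3) (PhiReg M a F) q / 70) * n3
  rw [n3']
  field_simp
  ring

/-- In the L = 1 mode equation the term 2φ̃₀ stands on the left as L(L+1)φ̃₀ and on the right inside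
∂_r Φ. After it cancels, and with Φ = 4M² Tφ̃₀ in the cos θ term, every remaining term is a
T-derivative, and their sum is T of the charge. -/
theorem hasPartial_momentCharge (hq : q ∈ horizon M W) : HasPartial M 0 (momentCharge M a F) 0 q := by
  have hd := chart_subset_dom (horizon_subset_chart hq)
  have hp := smooth_phiReg (W := W) hM hF
  have hP := smooth_PhiReg hM hW hF
  have hM' : (M : ℂ) ≠ 0 := by exact_mod_cast hM.ne'
  have d1 := hasPartial_moment hW (hp.pd hW 1) (contDiff_zonal 1) hd (Or.inl rfl)
  have d2 := hasPartial_moment hW hp (contDiff_zonal 1) hd (Or.inl rfl)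
  have d3 := hasPartial_moment hW hp (contDiff_zonal 2) hd (Or.inl rfl)
  have d4 := hasPartial_moment hW hP (contDiff_zonal 1) hd (Or.inl rfl)
  have d5 := hasPartial_moment hW hP (contDiff_zonal 3) hd (Or.inl rfl)
  refine (((((d1.const_mul _).add (d2.const_mul _)).add (d3.const_mul _)).add (d4.const_mul _)).sub
    (d5.const_mul _)).congr_deriv ?_
  have key := moment_teukolsky_one hM hW hF hZ ha hq
  rw [moment_PhiReg_horizon hM hW hF hZ ha hq,
    moment_pd_one_PhiReg_horizon hM hW hF hZ ha (contDiff_zonal 1).continuous hq] at key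
  rw [moment_congr_chart (fun p hp' => pd_comm hp hW (chart_subset_dom hp') 0 1) hd]
  field_simp at key ⊢
  linear_combination (-1 / 2) * key

omit hM hW hF hZ ha in
theorem moment_depends {f : (Fin 4 → ℝ) → ℂ} {q q' : Fin 4 → ℝ} (h0 : q 0 = q' 0) (h1 : q 1 = q' 1) :
    moment w f q = moment w f q' := by
  simp only [moment, sphereInt, h0, h1]

theorem teukolskyCharge_const {q' : Fin 4 → ℝ} (hq : q ∈ horizon M W) (hq' : q' ∈ horizon M W)
    (h : ∀ v ∈ uIcc (q 0) (q' 0), (v, M) ∈ W) : teukolskyCharge M a F q = teukolskyCharge M a F q' := by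
  have hd := chart_subset_dom (horizon_subset_chart hq)
  have hd' := chart_subset_dom (horizon_subset_chart hq')
  have hmem : ∀ v ∈ uIcc (q 0) (q' 0), update q 0 v ∈ horizon M W := fun v hv =>
    ⟨by simpa using hq.1, by simpa using h v hv, by simpa using hq.2.2⟩
  have hder : ∀ v ∈ uIcc (q 0) (q' 0), HasDerivWithinAt (fun v => momentCharge M a F (update q 0 v)) 0
      (uIcc (q 0) (q' 0)) v := fun v hv => by
    have d := hasPartial_momentCharge hM hW hF hZ ha (hmem v hv)
    unfold HasPartial at d
    rw [slice_of_ne (by decide) (horizon_subset_chart (hmem v hv)).1] at d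
    simp only [Function.update_idem, Function.update_self] at d
    exact d.mono (subset_univ _)
  have key := (convex_uIcc (q 0) (q' 0)).norm_image_sub_le_of_norm_hasDerivWithin_le (C := 0) hder (by simp)
    left_mem_uIcc right_mem_uIcc
  rw [zero_mul, norm_le_zero_iff, sub_eq_zero, Function.update_eq_self] at key
  -- Moments depend only on (v, r), so the angles of the two points play no role.
  have e : momentCharge M a F (update q 0 (q' 0)) = momentCharge M a F q' := by
    have e0 : update q 0 (q' 0) 0 = q' 0 := by simp
    have e1 : update q 0 (q' 0) 1 = q' 1 := by simp [hq.1, hq'.1]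
    simp only [momentCharge, moment_depends e0 e1]
  rw [teukolskyCharge_eq hM hW hF hd, teukolskyCharge_eq hM hW hF hd', ← key, e]

/-- No further field equation enters: e₃e₃Υ₀ and the bracket are all written in horizon moments of
φ̃₀, Tφ̃₀, ∂_r φ̃₀ and ∂_r Tφ̃₀. The bracket in K is what cancels those that do not occur in H; in
particular its e₃Φ_1 and e₃Φ_2 terms remove the mixed derivatives ∂_r Tφ̃₀. -/
theorem middleCharge_eq (hq : q ∈ horizon M W) : middleCharge M a F q =
    -(Complex.I * a / ((√6 : ℝ) * (M : ℂ) ^ 3)) * teukolskyCharge M a F q := by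
  have hd := chart_subset_dom (horizon_subset_chart hq)
  have ha2 : a ^ 2 = M ^ 2 := by rw [← ha, sq_abs]
  have ha2' : (a : ℂ) ^ 2 = (M : ℂ) ^ 2 := by exact_mod_cast ha2
  have hM' : (M : ℂ) ≠ 0 := by exact_mod_cast hM.ne'
  have h5 : ((√5 : ℝ) : ℂ) ≠ 0 := by simp
  have h6 : ((√6 : ℝ) : ℂ) ≠ 0 := by simp
  have n3 : ((√14 : ℝ) : ℂ) * (norming 3 : ℂ) = 7 * ((√6 : ℝ) : ℂ) / 6 * ((1 / √(4 * π) : ℝ) : ℂ) := by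
    exact_mod_cast norming_three
  -- The second transversal derivative of the mean is read off from `meanFlux`, which agrees with
  -- the first one at all radii.
  have e2 : pd M 1 (along M e3 (mean (Ups M a F))) q = _ :=
    (hasPartial_congr_dom hW (along_e3_mean hM hW hF hZ) hd (hasPartial_meanFlux hM hW hF hd)).pd_eq hd.1
  rw [teukolskyCharge_eq hM hW hF hd, middleCharge, congrFun (along_e3 (along M e3 (mean (Ups M a F)))) q, e2,
    along_e3_mean hM hW hF hZ hd, meanFlux, momentCharge]
  simp only [mode_Phi hM hW hd, mode_phi0 hM hd, along_e3, (hasPartial_mode_Phi hM hW hF hd (Or.inr rfl)).pd_eq hd.1,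
    moment_pd_one_PhiReg_horizon hM hW hF hZ ha (contDiff_zonal 1).continuous hq,
    moment_pd_one_PhiReg_horizon hM hW hF hZ ha (contDiff_zonal 2).continuous hq,
    moment_PhiReg_horizon hM hW hF hZ ha hq, weight_horizon hM ha2 hq.1, hq.1, ha2, norming_one, norming_two]
  generalize (1 / √(4 * π) : ℝ) = ν at *
  push_cast
  generalize moment (zonal 3) (pd M 0 (phiReg a F)) q = t3 at *
  have n3' : ((√14 : ℝ) : ℂ) / (140 * (M : ℂ) ^ 2) * (-norming 3 * (4 * (M : ℂ) ^ 2 * t3)) =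
      -(7 * ((√6 : ℝ) : ℂ) / 6 * ν * 4 * t3 / 140) := by
    field_simp
    linear_combination (-6 * t3) * n3
  rw [n3']
  generalize ((√5 : ℝ) : ℂ) = X at *
  generalize ((√6 : ℝ) : ℂ) = Y at *
  generalize moment (zonal 1) (pd M 0 (phiReg a F)) q = t1 at *
  generalize moment (zonal 2) (pd M 0 (phiReg a F)) q = t2 at *
  generalize moment (zonal 1) (phiReg a F) q = z1 at *
  generalize moment (zonal 2) (phiReg a F) q = z2 at *
  generalize moment (zonal 1) (pd M 1 (phiReg a F)) q = x1 at *
  generalize moment (zonal 1) (pd M 1 (pd M 0 (phiReg a F))) q = y1 at *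
  generalize moment (zonal 2) (pd M 1 (pd M 0 (phiReg a F))) q = y2 at *
  field_simp
  ring

end Charges

end KerrMaxwell
end

noncomputable section

namespace KerrMaxwell

/-! ### Wigner 3j-symbols -/

section ThreeJ

theorem fac_natCast (n : ℕ) : fac (n : ℤ) = (n.factorial : ℝ) := by simp [fac]

theorem racahTerm_symm (j₁ j₂ j₃ m₁ m₂ t : ℤ) :
    racahTerm j₁ j₂ j₃ m₁ m₂ t = racahTerm j₂ j₁ j₃ (-m₂) (-m₁) t := by
  unfold racahTerm
  have e1 : j₃ - j₁ + t + -m₂ = j₃ - j₁ + t - m₂ := by ring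
  have e2 : j₃ - j₂ + t - -m₁ = j₃ - j₂ + t + m₁ := by ring
  have e3 : j₂ + j₁ - j₃ - t = j₁ + j₂ - j₃ - t := by ring
  have e4 : j₂ - t - -m₂ = j₂ - t + m₂ := by ring
  have e5 : j₁ - t + -m₁ = j₁ - t - m₁ := by ring
  rw [e1, e2, e3, e4, e5]
  refine if_congr ?_ ?_ rfl
  · tauto
  · congr 1
    ring

/-- Exchanging two columns and reversing the lower row each cost the sign (-1)^(j₁+j₂+j₃), so
together they cost none; in Racah's sum the equality is termwise. Hence only L' ≥ L has to be
computed. -/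
theorem threeJ_symm (j₁ j₂ j₃ : ℕ) (m : ℤ) : threeJ j₁ j₂ j₃ (-m) m 0 = threeJ j₂ j₁ j₃ (-m) m 0 := by
  unfold threeJ
  refine if_congr ?_ ?_ rfl
  · simp only [abs_neg]
    constructor <;> rintro ⟨h1, h2, h3, h4, h5, h6, h7⟩ <;> refine ⟨h1, h3, h2, h4, ?_, h7, h6⟩ <;> omega
  · have hs : (-1 : ℝ) ^ ((j₁ : ℤ) - j₂ - 0) = (-1) ^ ((j₂ : ℤ) - j₁ - 0) := by
      rw [show (j₁ : ℤ) - j₂ - 0 = -((j₂ : ℤ) - j₁ - 0) by ring, zpow_neg, ← inv_zpow]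
      norm_num
    have hr : ∀ t : ℕ, racahTerm j₁ j₂ j₃ (-m) m t = racahTerm j₂ j₁ j₃ (-m) m t := fun t => by
      rw [racahTerm_symm, neg_neg]
    have e1 : (j₂ : ℤ) - j₁ + j₃ = -j₁ + j₂ + j₃ := by ring
    have e2 : -(j₂ : ℤ) + j₁ + j₃ = j₁ - j₂ + j₃ := by ring
    simp only [hr, hs, add_comm j₂ j₁, add_comm (j₂ : ℤ) j₁, e1, e2, sub_neg_eq_add, ← sub_eq_add_neg]
    congr 2
    · congr 2
      congr 1
      ring
    · congr 1
      ring

theorem threeJProd_symm (L K J : ℕ) : threeJProd L K J = threeJProd K L J := by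
  have h0 := threeJ_symm L K J 0
  rw [neg_zero] at h0
  rw [threeJProd, threeJProd, h0, threeJ_symm L K J 1]

/-- The triangle inequality fails. -/
theorem threeJProd_eq_zero {L d J : ℕ} (h : J < d ∨ 2 * L + d < J) : threeJProd L (L + d) J = 0 := by
  rw [threeJProd, threeJ, if_neg, zero_mul]
  push Not
  omega

/-- The summand of the Racah formula for `m₁ = L - A`, in the variable `u = A - t`. -/
def racahSummand (A B d J u : ℕ) : ℝ :=
  (-1) ^ u * (A.descFactorial u * B.descFactorial (J - u)) /
    (u.factorial * (u + d).factorial * (J - d - u).factorial * (J - u).factorial)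

/-- The substitution t = A - u turns the factorials that depend on L into descending factorials,
polynomial in L, over A! B!. When J - u > B both sides vanish. -/
theorem racahTerm_eq {L d J A B u : ℕ} (hAB : A + B = 2 * L + d) (hu : u ≤ A) :
    racahTerm L ((L + d : ℕ) : ℤ) J ((L : ℤ) - A) ((A : ℤ) - L) ((A - u : ℕ) : ℤ) =
      if u + d ≤ J then (-1) ^ A / (A.factorial * B.factorial) * racahSummand A B d J u else 0 := by
  unfold racahTerm
  by_cases h : u + d ≤ J
  · rw [if_pos h]
    by_cases hB : J - u ≤ B
    · rw [if_pos (by omega)]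
      have e1 : (J : ℤ) - ((L + d : ℕ) : ℤ) + ((A - u : ℕ) : ℤ) + ((L : ℤ) - A) = ((J - d - u : ℕ) : ℤ) := by omega
      have e2 : (J : ℤ) - L + ((A - u : ℕ) : ℤ) - ((A : ℤ) - L) = ((J - u : ℕ) : ℤ) := by omega
      have e3 : (L : ℤ) + ((L + d : ℕ) : ℤ) - J - ((A - u : ℕ) : ℤ) = ((B - (J - u) : ℕ) : ℤ) := by omega
      have e4 : (L : ℤ) - ((A - u : ℕ) : ℤ) - ((L : ℤ) - A) = ((u : ℕ) : ℤ) := by omega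
      have e5 : ((L + d : ℕ) : ℤ) - ((A - u : ℕ) : ℤ) + ((A : ℤ) - L) = ((u + d : ℕ) : ℤ) := by omega
      rw [e1, e2, e3, e4, e5]
      simp only [fac_natCast, racahSummand, zpow_natCast]
      have a1 : ((A - u).factorial : ℝ) * A.descFactorial u = A.factorial := by
        exact_mod_cast Nat.factorial_mul_descFactorial hu
      have a2 : ((B - (J - u)).factorial : ℝ) * B.descFactorial (J - u) = B.factorial := by
        exact_mod_cast Nat.factorial_mul_descFactorial hB
      have a3 : (-1 : ℝ) ^ A = (-1) ^ (A - u) * (-1) ^ u := by rw [← pow_add, Nat.sub_add_cancel hu]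
      have a4 : (-1 : ℝ) ^ u * (-1) ^ u = 1 := by rw [← mul_pow]; norm_num
      rw [← a1, ← a2, a3]
      have n1 : (A.descFactorial u : ℝ) ≠ 0 := by
        exact_mod_cast (Nat.descFactorial_eq_zero_iff_lt.not.2 (not_lt.2 hu))
      have n2 : (B.descFactorial (J - u) : ℝ) ≠ 0 := by
        exact_mod_cast (Nat.descFactorial_eq_zero_iff_lt.not.2 (not_lt.2 hB))
      have n3 : ((A - u).factorial : ℝ) ≠ 0 := by exact_mod_cast Nat.factorial_ne_zero _
      have n4 : ((B - (J - u)).factorial : ℝ) ≠ 0 := by exact_mod_cast Nat.factorial_ne_zero _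
      have n5 : (u.factorial : ℝ) ≠ 0 := by exact_mod_cast Nat.factorial_ne_zero _
      have n6 : ((u + d).factorial : ℝ) ≠ 0 := by exact_mod_cast Nat.factorial_ne_zero _
      have n7 : ((J - d - u).factorial : ℝ) ≠ 0 := by exact_mod_cast Nat.factorial_ne_zero _
      have n8 : ((J - u).factorial : ℝ) ≠ 0 := by exact_mod_cast Nat.factorial_ne_zero _
      rw [div_mul_div_comm, div_eq_div_iff (by positivity) (by positivity)]
      linear_combination (-((-1 : ℝ) ^ (A - u)) * ((A - u).factorial * A.descFactorial u *
        ((B - (J - u)).factorial * B.descFactorial (J - u)) * (u.factorial * (u + d).factorial *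
          (J - d - u).factorial * (J - u).factorial))) * a4
    · rw [if_neg (by omega), racahSummand, Nat.descFactorial_of_lt (not_le.1 hB)]
      simp
  · rw [if_neg h, if_neg (by omega)]

/-- After reindexing there are J - d + 1 terms whatever L is, so for fixed J and d the sum can be
written out. -/
theorem sum_racahTerm {L d J A B : ℕ} (hAB : A + B = 2 * L + d) (hd : d ≤ J) :
    ∑ t ∈ Finset.range (L + (L + d) + 1), racahTerm L ((L + d : ℕ) : ℤ) J ((L : ℤ) - A) ((A : ℤ) - L) t =
      (-1) ^ A / (A.factorial * B.factorial) * ∑ u ∈ Finset.range (J - d + 1), racahSummand A B d J u := by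
  have h1 : ∑ t ∈ Finset.range (L + (L + d) + 1), racahTerm L ((L + d : ℕ) : ℤ) J ((L : ℤ) - A) ((A : ℤ) - L) t =
      ∑ t ∈ Finset.range (A + 1), racahTerm L ((L + d : ℕ) : ℤ) J ((L : ℤ) - A) ((A : ℤ) - L) t := by
    refine (Finset.sum_subset (Finset.range_subset_range.2 (by omega)) fun t _ ht => ?_).symm
    rw [Finset.mem_range, not_lt] at ht
    rw [racahTerm, if_neg (by omega)]
  rw [h1, ← Finset.sum_range_reflect, Finset.mul_sum]
  set g : ℕ → ℝ := fun u =>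
    if u + d ≤ J then (-1) ^ A / (A.factorial * B.factorial) * racahSummand A B d J u else 0 with hg
  have h2 : ∑ u ∈ Finset.range (A + 1), racahTerm L ((L + d : ℕ) : ℤ) J ((L : ℤ) - A) ((A : ℤ) - L)
      ((A + 1 - 1 - u : ℕ) : ℤ) = ∑ u ∈ Finset.range (A + 1), g u :=
    Finset.sum_congr rfl fun u hu => racahTerm_eq hAB (Nat.lt_succ_iff.1 (Finset.mem_range.1 hu))
  have h3 : ∑ u ∈ Finset.range (J - d + 1), (-1) ^ A / (A.factorial * B.factorial) * racahSummand A B d J u =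
      ∑ u ∈ Finset.range (J - d + 1), g u :=
    Finset.sum_congr rfl fun u hu => by
      rw [Finset.mem_range] at hu
      simp only [hg]
      rw [if_pos (by omega)]
  -- Both ranges are enlarged to a common one. Terms with u > A vanish through the descending
  -- factorial of A, and in `h5` terms with u > J - d vanish by the definition of g.
  have h4 : ∑ u ∈ Finset.range (A + 1), g u = ∑ u ∈ Finset.range (A + 1 + (J - d + 1)), g u := by
    refine Finset.sum_subset (Finset.range_subset_range.2 (by omega)) fun u _ hu => ?_
    rw [Finset.mem_range, not_lt] at hu
    simp only [hg, racahSummand, Nat.descFactorial_of_lt (show A < u by omega)]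
    simp
  have h5 : ∑ u ∈ Finset.range (J - d + 1), g u = ∑ u ∈ Finset.range (A + 1 + (J - d + 1)), g u := by
    refine Finset.sum_subset (Finset.range_subset_range.2 (by omega)) fun u _ hu => ?_
    rw [Finset.mem_range, not_lt] at hu
    simp only [hg]
    rw [if_neg (by omega)]
  rw [h2, h3, h4, h5]

theorem threeJ_eq {L d J A B : ℕ} (hAB : A + B = 2 * L + d) (hd : d ≤ J) (hJ : J ≤ 2 * L + d)
    (hA : A ≤ 2 * L) :
    threeJ L (L + d) J ((L : ℤ) - A) ((A : ℤ) - L) 0 = (-1) ^ d *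
      √((2 * L + d - J).factorial * (J - d).factorial * (J + d).factorial / (2 * L + d + J + 1).factorial) *
      √((2 * L - A).factorial * A.factorial * (A + d).factorial * B.factorial * J.factorial * J.factorial) *
      ((-1) ^ A / (A.factorial * B.factorial) * ∑ u ∈ Finset.range (J - d + 1), racahSummand A B d J u) := by
  rw [threeJ, if_pos, sum_racahTerm hAB hd]
  · have e1 : (L : ℤ) + ((L + d : ℕ) : ℤ) - J = ((2 * L + d - J : ℕ) : ℤ) := by omega
    have e2 : (L : ℤ) - ((L + d : ℕ) : ℤ) + J = ((J - d : ℕ) : ℤ) := by omega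
    have e3 : -(L : ℤ) + ((L + d : ℕ) : ℤ) + J = ((J + d : ℕ) : ℤ) := by omega
    have e4 : (L : ℤ) + ((L + d : ℕ) : ℤ) + J + 1 = ((2 * L + d + J + 1 : ℕ) : ℤ) := by omega
    have e5 : (L : ℤ) + ((L : ℤ) - A) = ((2 * L - A : ℕ) : ℤ) := by omega
    have e6 : (L : ℤ) - ((L : ℤ) - A) = (A : ℤ) := by omega
    have e7 : ((L + d : ℕ) : ℤ) + ((A : ℤ) - L) = ((A + d : ℕ) : ℤ) := by omega
    have e8 : ((L + d : ℕ) : ℤ) - ((A : ℤ) - L) = (B : ℤ) := by omega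
    have e9 : (L : ℤ) - ((L + d : ℕ) : ℤ) - 0 = -(d : ℤ) := by omega
    rw [e1, e2, e3, e4, e5, e6, e7, e8, e9, add_zero, sub_zero, zpow_neg, ← inv_zpow, zpow_natCast]
    simp only [fac_natCast]
    norm_num
  · simp only [abs_le]
    omega

/-- `Δ(L, L + d, J) (J!)²` times the two Racah sums, up to sign. -/
def racahProduct (L d J : ℕ) : ℝ :=
  -((2 * L + d - J).factorial * (J - d).factorial * (J + d).factorial / (2 * L + d + J + 1).factorial *
    (J.factorial : ℝ) ^ 2 * (∑ u ∈ Finset.range (J - d + 1), racahSummand L (L + d) d J u) *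
    ∑ u ∈ Finset.range (J - d + 1), racahSummand (L + 1) (L + d - 1) d J u)

/-- The two symbols are the cases A = L and A = L + 1. They share the triangle factor, whose square
root is thereby squared, and their signs (-1)^A differ, whence the minus sign in `racahProduct`. -/
theorem threeJProd_eq {L d J : ℕ} (hL : 1 ≤ L) (hd : d ≤ J) (hJ : J ≤ 2 * L + d) :
    threeJProd L (L + d) J =
      √(L * (L + 1)) * √((L + d : ℕ) * ((L + d : ℕ) + 1)) / (L * (L + 1)) * racahProduct L d J := by
  have h0 := threeJ_eq (L := L) (d := d) (J := J) (A := L) (B := L + d) (by omega) hd hJ (by omega)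
  have h1 := threeJ_eq (L := L) (d := d) (J := J) (A := L + 1) (B := L + d - 1) (by omega) hd hJ (by omega)
  rw [sub_self] at h0
  rw [show (L : ℤ) - ((L + 1 : ℕ) : ℤ) = -1 by push_cast; ring,
    show ((L + 1 : ℕ) : ℤ) - L = 1 by push_cast; ring] at h1
  rw [threeJProd, h0, h1, racahProduct]
  generalize ∑ u ∈ Finset.range (J - d + 1), racahSummand L (L + d) d J u = P0
  generalize ∑ u ∈ Finset.range (J - d + 1), racahSummand (L + 1) (L + d - 1) d J u = P1
  have hΔ := Real.mul_self_sqrt (show (0 : ℝ) ≤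
    (2 * L + d - J).factorial * (J - d).factorial * (J + d).factorial / (2 * L + d + J + 1).factorial by positivity)
  generalize √((2 * L + d - J).factorial * (J - d).factorial * (J + d).factorial / (2 * L + d + J + 1).factorial : ℝ) = D
    at *
  obtain ⟨n, rfl⟩ := Nat.exists_eq_add_of_le' hL
  -- At m = 0 the radicand is a perfect square; at m = ∓1 (`s1`) it is one up to the factor L(L+1)
  -- L'(L'+1).
  have s0 : √(((2 * (n + 1) - (n + 1)).factorial * (n + 1).factorial * (n + 1 + d).factorial * (n + 1 + d).factorial *
      J.factorial * J.factorial : ℕ) : ℝ) = (n + 1).factorial * (n + 1 + d).factorial * J.factorial := by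
    rw [show 2 * (n + 1) - (n + 1) = n + 1 by omega, Real.sqrt_eq_iff_mul_self_eq (by positivity) (by positivity)]
    push_cast
    ring
  have s1 : √(((2 * (n + 1) - (n + 1 + 1)).factorial * (n + 1 + 1).factorial * (n + 1 + 1 + d).factorial *
      (n + 1 + d - 1).factorial * J.factorial * J.factorial : ℕ) : ℝ) =
      n.factorial * (n + d).factorial * J.factorial *
        (√((n + 1 : ℕ) * ((n + 1 : ℕ) + 1)) * √((n + 1 + d : ℕ) * ((n + 1 + d : ℕ) + 1))) := by
    rw [show 2 * (n + 1) - (n + 1 + 1) = n by omega, show n + 1 + d - 1 = n + d by omega,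
      show n + 1 + 1 + d = n + d + 1 + 1 by omega, show n + 1 + d = n + d + 1 by omega,
      Real.sqrt_eq_iff_mul_self_eq (by positivity) (by positivity)]
    have a1 := Real.mul_self_sqrt (show (0 : ℝ) ≤ (n + 1 : ℕ) * ((n + 1 : ℕ) + 1) by positivity)
    have a2 := Real.mul_self_sqrt (show (0 : ℝ) ≤ (n + d + 1 : ℕ) * ((n + d + 1 : ℕ) + 1) by positivity)
    generalize √(((n + 1 : ℕ) : ℝ) * ((n + 1 : ℕ) + 1)) = x at *
    generalize √(((n + d + 1 : ℕ) : ℝ) * ((n + d + 1 : ℕ) + 1)) = y at *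
    simp only [Nat.factorial_succ]
    push_cast at a1 a2 ⊢
    linear_combination (-(n.factorial * (n + d).factorial * J.factorial : ℝ) ^ 2 * (y * y)) * a1
      - ((n.factorial * (n + d).factorial * J.factorial : ℝ) ^ 2 * ((n + 1) * (n + 1 + 1))) * a2
  push_cast at s0 s1
  rw [s0, s1, ← hΔ, pow_succ (-1 : ℝ) (n + 1), show n + 1 + d - 1 = n + d by omega, Nat.factorial_succ (n + 1),
    Nat.factorial_succ n]
  have hd2 : ((-1 : ℝ) ^ d) ^ 2 = 1 := by rw [← pow_mul, mul_comm, pow_mul]; norm_num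
  have hn2 : ((-1 : ℝ) ^ (n + 1)) ^ 2 = 1 := by rw [← pow_mul, mul_comm, pow_mul]; norm_num
  generalize (-1 : ℝ) ^ d = e at *
  generalize (-1 : ℝ) ^ (n + 1) = s at *
  have f1 : (n.factorial : ℝ) ≠ 0 := by exact_mod_cast Nat.factorial_ne_zero _
  have f2 : ((n + d).factorial : ℝ) ≠ 0 := by exact_mod_cast Nat.factorial_ne_zero _
  have f3 : ((n + 1 + d).factorial : ℝ) ≠ 0 := by exact_mod_cast Nat.factorial_ne_zero _
  push_cast
  field_simp
  linear_combination (-(D ^ 2 * P0 * P1 * s ^ 2)) * hd2 - D ^ 2 * P0 * P1 * hn2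

/-- The matrix elements of products with Legendre polynomials in the normalised harmonics. -/
def transfer (J L K : ℕ) : ℝ := √((2 * L + 1) * (2 * K + 1)) * norming K * threeJProd L K J

/-- Multiplication by `norming K` completes every square root except those making up `norming L`;
the remaining factor is rational. -/
theorem transfer_add {L d J : ℕ} (hL : 1 ≤ L) (hd : d ≤ J) (hJ : J ≤ 2 * L + d) :
    transfer J L (L + d) = norming L * ((2 * (L + d) + 1) * racahProduct L d J) := by
  rw [transfer, threeJProd_eq hL hd hJ, norming_eq, norming_eq, Real.sqrt_mul (by positivity)]
  have a0 := Real.mul_self_sqrt (show (0 : ℝ) ≤ 2 * (L + d : ℕ) + 1 by positivity)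
  have a1 := Real.mul_self_sqrt (show (0 : ℝ) ≤ L * (L + 1) by positivity)
  have hL' : (0 : ℝ) < L := by exact_mod_cast hL
  have p1 : 0 < √((L : ℝ) * (L + 1)) := Real.sqrt_pos.2 (by positivity)
  have p2 : 0 < √(((L + d : ℕ) : ℝ) * ((L + d : ℕ) + 1)) := Real.sqrt_pos.2 (by push_cast; positivity)
  generalize √((L : ℝ) * (L + 1)) = x at *
  generalize √(((L + d : ℕ) : ℝ) * ((L + d : ℕ) + 1)) = y at *
  generalize √(2 * ((L + d : ℕ) : ℝ) + 1) = z at *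
  push_cast at a0 ⊢
  rw [← a0, ← a1]
  field_simp

theorem transfer_sub {K d J : ℕ} (hK : 1 ≤ K) (hd : d ≤ J) (hJ : J ≤ 2 * K + d) :
    transfer J (K + d) K = norming (K + d) *
      ((2 * K + 1) * ((K + d) * (K + d + 1)) / (K * (K + 1)) * racahProduct K d J) := by
  rw [transfer, threeJProd_symm, threeJProd_eq hK hd hJ, norming_eq, norming_eq, Real.sqrt_mul (by positivity)]
  have a0 := Real.mul_self_sqrt (show (0 : ℝ) ≤ 2 * (K : ℝ) + 1 by positivity)
  have a1 := Real.mul_self_sqrt (show (0 : ℝ) ≤ K * (K + 1) by positivity)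
  have a2 := Real.mul_self_sqrt (show (0 : ℝ) ≤ (K + d : ℕ) * ((K + d : ℕ) + 1) by positivity)
  have hK' : (0 : ℝ) < K := by exact_mod_cast hK
  have p1 : 0 < √((K : ℝ) * (K + 1)) := Real.sqrt_pos.2 (by positivity)
  have p2 : 0 < √(((K + d : ℕ) : ℝ) * ((K + d : ℕ) + 1)) := Real.sqrt_pos.2 (by push_cast; positivity)
  generalize √((K : ℝ) * (K + 1)) = x at *
  generalize √(((K + d : ℕ) : ℝ) * ((K + d : ℕ) + 1)) = y at *
  generalize √(2 * (K : ℝ) + 1) = z at *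
  push_cast at a2 ⊢
  rw [← a0, ← a1, ← a2]
  field_simp

end ThreeJ

end KerrMaxwell
end

noncomputable section

namespace KerrMaxwell

/-! ### The products of 3j-symbols of rank at most four -/

section Values

set_option linter.unusedSimpArgs false

theorem cast_descFactorial_succ (A u : ℕ) : (A.descFactorial (u + 1) : ℝ) = (A - u) * A.descFactorial u := by
  rw [Nat.descFactorial_succ]
  rcases le_or_gt u A with h | h
  · push_cast [Nat.cast_sub h]; ring
  · simp [Nat.descFactorial_of_lt h]

/-- Valid in ℝ without u ≤ A: beyond that range both sides are zero. Small L therefore need no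
separate treatment in the sums. -/
theorem cast_descFactorial_one (A : ℕ) : (A.descFactorial 1 : ℝ) = A := by simp

theorem cast_descFactorial_two (A : ℕ) : (A.descFactorial 2 : ℝ) = (A - 1) * A := by
  rw [cast_descFactorial_succ, cast_descFactorial_one]; simp

theorem cast_descFactorial_three (A : ℕ) : (A.descFactorial 3 : ℝ) = (A - 2) * ((A - 1) * A) := by
  rw [cast_descFactorial_succ, cast_descFactorial_two]; simp

theorem cast_descFactorial_four (A : ℕ) : (A.descFactorial 4 : ℝ) = (A - 3) * ((A - 2) * ((A - 1) * A)) := by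
  rw [cast_descFactorial_succ, cast_descFactorial_three]; simp

/-- Parity: the symbol with zero lower row vanishes when L + L' + J is odd. This and the next three
lemmas are the odd cases with J ≤ 4 and d ≤ J. -/
theorem racahProduct_zero_one (L : ℕ) : racahProduct L 0 1 = 0 := by
  have h : ∑ u ∈ Finset.range (1 - 0 + 1), racahSummand L (L + 0) 0 1 u = 0 := by
    simp only [Nat.reduceSub, Nat.reduceAdd, Finset.sum_range_succ, Finset.sum_range_zero, racahSummand,
      cast_descFactorial_one, cast_descFactorial_two, cast_descFactorial_three, cast_descFactorial_four,
      Nat.descFactorial_zero, Nat.factorial]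
    push_cast
    ring
  rw [racahProduct, h]
  ring

theorem racahProduct_one_two (L : ℕ) : racahProduct L 1 2 = 0 := by
  have h : ∑ u ∈ Finset.range (2 - 1 + 1), racahSummand L (L + 1) 1 2 u = 0 := by
    simp only [Nat.reduceSub, Nat.reduceAdd, Finset.sum_range_succ, Finset.sum_range_zero, racahSummand,
      cast_descFactorial_one, cast_descFactorial_two, cast_descFactorial_three, cast_descFactorial_four,
      Nat.descFactorial_zero, Nat.factorial]
    push_cast
    ring
  rw [racahProduct, h]
  ring

theorem racahProduct_one_four (L : ℕ) : racahProduct L 1 4 = 0 := by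
  have h : ∑ u ∈ Finset.range (4 - 1 + 1), racahSummand L (L + 1) 1 4 u = 0 := by
    simp only [Nat.reduceSub, Nat.reduceAdd, Finset.sum_range_succ, Finset.sum_range_zero, racahSummand,
      cast_descFactorial_one, cast_descFactorial_two, cast_descFactorial_three, cast_descFactorial_four,
      Nat.descFactorial_zero, Nat.factorial]
    push_cast
    ring
  rw [racahProduct, h]
  ring

theorem racahProduct_three_four (L : ℕ) : racahProduct L 3 4 = 0 := by
  have h : ∑ u ∈ Finset.range (4 - 3 + 1), racahSummand L (L + 3) 3 4 u = 0 := by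
    simp only [Nat.reduceSub, Nat.reduceAdd, Finset.sum_range_succ, Finset.sum_range_zero, racahSummand,
      cast_descFactorial_one, cast_descFactorial_two, cast_descFactorial_three, cast_descFactorial_four,
      Nat.descFactorial_zero, Nat.factorial]
    push_cast
    ring
  rw [racahProduct, h]
  ring

/-- Once L = n + 1 the factorials of size 2L are polynomial multiples of (2n)!, which cancels, and
the claim is an identity of rational functions. The following evaluations work in the same way. -/
theorem racahProduct_one_one {L : ℕ} (hL : 1 ≤ L) : racahProduct L 1 1 =
    -(L : ℝ) / ((2 * L + 1) * (2 * L + 3)) := by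
  obtain ⟨n, rfl⟩ := Nat.exists_eq_add_of_le' hL
  rw [racahProduct, show 2 * (n + 1) + 1 - 1 = 2 * n + 2 by omega,
    show 2 * (n + 1) + 1 + 1 + 1 = 2 * n + 5 by omega, show n + 1 + 1 - 1 = n + 1 by omega]
  simp only [Nat.reduceSub, Nat.reduceAdd, Finset.sum_range_succ, Finset.sum_range_zero, racahSummand,
    cast_descFactorial_one, cast_descFactorial_two, cast_descFactorial_three, cast_descFactorial_four,
    Nat.descFactorial_zero, Nat.factorial]
  have hf : ((2 * n).factorial : ℝ) ≠ 0 := by exact_mod_cast Nat.factorial_ne_zero _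
  have hn : (0 : ℝ) ≤ n := Nat.cast_nonneg n
  push_cast
  field_simp
  ring

theorem racahProduct_zero_two {L : ℕ} (hL : 1 ≤ L) : racahProduct L 0 2 =
    -((L : ℝ) ^ 2 + L - 3) / ((2 * L - 1) * (2 * L + 1) * (2 * L + 3)) := by
  obtain ⟨n, rfl⟩ := Nat.exists_eq_add_of_le' hL
  rw [racahProduct, show 2 * (n + 1) + 0 - 2 = 2 * n by omega,
    show 2 * (n + 1) + 0 + 2 + 1 = 2 * n + 5 by omega, show n + 1 + 0 - 1 = n + 0 by omega]
  simp only [Nat.reduceSub, Nat.reduceAdd, Finset.sum_range_succ, Finset.sum_range_zero, racahSummand,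
    cast_descFactorial_one, cast_descFactorial_two, cast_descFactorial_three, cast_descFactorial_four,
    Nat.descFactorial_zero, Nat.factorial]
  have hf : ((2 * n).factorial : ℝ) ≠ 0 := by exact_mod_cast Nat.factorial_ne_zero _
  have hn : (0 : ℝ) ≤ n := Nat.cast_nonneg n
  push_cast
  rw [show 2 * ((n : ℝ) + 1) - 1 = 2 * n + 1 by ring]
  field_simp
  ring

theorem racahProduct_two_two {L : ℕ} (hL : 1 ≤ L) : racahProduct L 2 2 =
    -(3 / 2) * L * (L + 1) / ((2 * L + 1) * (2 * L + 3) * (2 * L + 5)) := by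
  obtain ⟨n, rfl⟩ := Nat.exists_eq_add_of_le' hL
  rw [racahProduct, show 2 * (n + 1) + 2 - 2 = 2 * n + 2 by omega,
    show 2 * (n + 1) + 2 + 2 + 1 = 2 * n + 7 by omega, show n + 1 + 2 - 1 = n + 2 by omega]
  simp only [Nat.reduceSub, Nat.reduceAdd, Finset.sum_range_succ, Finset.sum_range_zero, racahSummand,
    cast_descFactorial_one, cast_descFactorial_two, cast_descFactorial_three, cast_descFactorial_four,
    Nat.descFactorial_zero, Nat.factorial]
  have hf : ((2 * n).factorial : ℝ) ≠ 0 := by exact_mod_cast Nat.factorial_ne_zero _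
  have hn : (0 : ℝ) ≤ n := Nat.cast_nonneg n
  push_cast
  field_simp
  ring

/-- The bound 2 ≤ L is the triangle inequality 4 ≤ 2L. -/
theorem racahProduct_zero_four {L : ℕ} (hL : 2 ≤ L) : racahProduct L 0 4 =
    -(9 / 4) * (L - 1) * (L + 2) * ((L : ℝ) ^ 2 + L - 10) / ((2 * L - 3) * (2 * L - 1) * (2 * L + 1) * (2 * L + 3) * (2 * L + 5)) := by
  obtain ⟨n, rfl⟩ := Nat.exists_eq_add_of_le' hL
  rw [racahProduct, show 2 * (n + 2) + 0 - 4 = 2 * n by omega,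
    show 2 * (n + 2) + 0 + 4 + 1 = 2 * n + 9 by omega, show n + 2 + 0 - 1 = n + 1 by omega]
  simp only [Nat.reduceSub, Nat.reduceAdd, Finset.sum_range_succ, Finset.sum_range_zero, racahSummand,
    cast_descFactorial_one, cast_descFactorial_two, cast_descFactorial_three, cast_descFactorial_four,
    Nat.descFactorial_zero, Nat.factorial]
  have hf : ((2 * n).factorial : ℝ) ≠ 0 := by exact_mod_cast Nat.factorial_ne_zero _
  have hn : (0 : ℝ) ≤ n := Nat.cast_nonneg n
  push_cast
  rw [show 2 * ((n : ℝ) + 2) - 3 = 2 * n + 1 by ring, show 2 * ((n : ℝ) + 2) - 1 = 2 * n + 3 by ring]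
  field_simp
  ring

theorem racahProduct_two_four {L : ℕ} (hL : 1 ≤ L) : racahProduct L 2 4 =
    -(5 / 2) * L * (L + 1) * ((L : ℝ) ^ 2 + 3 * L - 7) / ((2 * L - 1) * (2 * L + 1) * (2 * L + 3) * (2 * L + 5) * (2 * L + 7)) := by
  obtain ⟨n, rfl⟩ := Nat.exists_eq_add_of_le' hL
  rw [racahProduct, show 2 * (n + 1) + 2 - 4 = 2 * n by omega,
    show 2 * (n + 1) + 2 + 4 + 1 = 2 * n + 9 by omega, show n + 1 + 2 - 1 = n + 2 by omega]
  simp only [Nat.reduceSub, Nat.reduceAdd, Finset.sum_range_succ, Finset.sum_range_zero, racahSummand,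
    cast_descFactorial_one, cast_descFactorial_two, cast_descFactorial_three, cast_descFactorial_four,
    Nat.descFactorial_zero, Nat.factorial]
  have hf : ((2 * n).factorial : ℝ) ≠ 0 := by exact_mod_cast Nat.factorial_ne_zero _
  have hn : (0 : ℝ) ≤ n := Nat.cast_nonneg n
  push_cast
  rw [show 2 * ((n : ℝ) + 1) - 1 = 2 * n + 1 by ring]
  field_simp
  ring

theorem racahProduct_four_four {L : ℕ} (hL : 1 ≤ L) : racahProduct L 4 4 =
    -(35 / 8) * L * (L + 1) * (L + 2) * (L + 3) / ((2 * L + 1) * (2 * L + 3) * (2 * L + 5) * (2 * L + 7) * (2 * L + 9)) := by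
  obtain ⟨n, rfl⟩ := Nat.exists_eq_add_of_le' hL
  rw [racahProduct, show 2 * (n + 1) + 4 - 4 = 2 * n + 2 by omega,
    show 2 * (n + 1) + 4 + 4 + 1 = 2 * n + 11 by omega, show n + 1 + 4 - 1 = n + 4 by omega]
  simp only [Nat.reduceSub, Nat.reduceAdd, Finset.sum_range_succ, Finset.sum_range_zero, racahSummand,
    cast_descFactorial_one, cast_descFactorial_two, cast_descFactorial_three, cast_descFactorial_four,
    Nat.descFactorial_zero, Nat.factorial]
  have hf : ((2 * n).factorial : ℝ) ≠ 0 := by exact_mod_cast Nat.factorial_ne_zero _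
  have hn : (0 : ℝ) ≤ n := Nat.cast_nonneg n
  push_cast
  field_simp
  ring

end Values

end KerrMaxwell
end

noncomputable section

namespace KerrMaxwell

/-! ### Products of harmonics with powers of `cos θ` -/

section Coefficients

/-- A coefficient of the product of a harmonic with a Legendre polynomial. -/
def quarticUpFour (x : ℝ) : ℝ :=
  -(35 / 8) * x * (x + 1) * (x + 2) * (x + 3) / ((2 * x + 1) * (2 * x + 3) * (2 * x + 5) * (2 * x + 7))

/-- A coefficient of the product of a harmonic with a Legendre polynomial. -/
def quarticUpTwo (x : ℝ) : ℝ :=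
  -(5 / 2) * x * (x + 1) * (x ^ 2 + 3 * x - 7) / ((2 * x - 1) * (2 * x + 1) * (2 * x + 3) * (2 * x + 7))

/-- A coefficient of the product of a harmonic with a Legendre polynomial. -/
def quarticDiag (x : ℝ) : ℝ :=
  -(9 / 4) * (x - 1) * (x + 2) * (x ^ 2 + x - 10) / ((2 * x - 3) * (2 * x - 1) * (2 * x + 3) * (2 * x + 5))

/-- A coefficient of the product of a harmonic with a Legendre polynomial. -/
def quarticDownTwo (x : ℝ) : ℝ :=
  -(5 / 2) * x * (x + 1) * (x ^ 2 - x - 9) / ((2 * x - 5) * (2 * x - 1) * (2 * x + 1) * (2 * x + 3))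

/-- A coefficient of the product of a harmonic with a Legendre polynomial. -/
def quarticDownFour (x : ℝ) : ℝ :=
  -(35 / 8) * x * (x + 1) * (x - 2) * (x - 1) / ((2 * x - 5) * (2 * x - 3) * (2 * x - 1) * (2 * x + 1))

/-- A coefficient of the product of a harmonic with a Legendre polynomial. -/
def quadraticUpTwo (x : ℝ) : ℝ :=
  -(3 / 2) * x * (x + 1) / ((2 * x + 1) * (2 * x + 3))

/-- A coefficient of the product of a harmonic with a Legendre polynomial. -/
def quadraticDiag (x : ℝ) : ℝ :=
  -(x ^ 2 + x - 3) / ((2 * x - 1) * (2 * x + 3))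

/-- A coefficient of the product of a harmonic with a Legendre polynomial. -/
def quadraticDownTwo (x : ℝ) : ℝ :=
  -(3 / 2) * x * (x + 1) / ((2 * x - 1) * (2 * x + 1))

/-- A coefficient of the product of a harmonic with a Legendre polynomial. -/
def linearUp (x : ℝ) : ℝ :=
  -x / (2 * x + 1)

/-- A coefficient of the product of a harmonic with a Legendre polynomial. -/
def linearDown (x : ℝ) : ℝ :=
  -(x + 1) / (2 * x + 1)

theorem transfer_eq_zero {J L d : ℕ} (h : J < d ∨ 2 * L + d < J) :
    transfer J L (L + d) = 0 ∧ transfer J (L + d) L = 0 := by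
  simp only [transfer, threeJProd_eq_zero h, threeJProd_symm (L + d) L, mul_zero, and_self]

theorem transfer_one {L K : ℕ} (hL : 1 ≤ L) (hK : 1 ≤ K) : transfer 1 L K = norming L *
    ((if K = L + 1 then linearUp L else 0) + (if K + 1 = L then linearDown L else 0)) := by
  rcases le_total L K with h | h
  · obtain ⟨d, rfl⟩ := Nat.exists_eq_add_of_le h
    rcases Nat.lt_or_ge 1 d with hd | hd
    · rw [(transfer_eq_zero (Or.inl hd)).1, if_neg (by omega), if_neg (by omega)]; ring
    · interval_cases d
      · rw [transfer_add hL (by omega) (by omega), racahProduct_zero_one, if_neg (by omega), if_neg (by omega)]; ring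
      · rw [transfer_add hL (by omega) (by omega), racahProduct_one_one hL, if_pos rfl, if_neg (by omega), linearUp]
        congr 1
        push_cast
        field_simp
        ring
  · obtain ⟨d, rfl⟩ := Nat.exists_eq_add_of_le h
    have hp : (0 : ℝ) < K := by exact_mod_cast hK
    rcases Nat.lt_or_ge 1 d with hd | hd
    · rw [(transfer_eq_zero (Or.inl hd)).2, if_neg (by omega), if_neg (by omega)]; ring
    · interval_cases d
      · rw [transfer_sub hK (by omega) (by omega), racahProduct_zero_one, if_neg (by omega), if_neg (by omega)]; ring
      · rw [transfer_sub hK (by omega) (by omega), racahProduct_one_one hK, if_neg (by omega), if_pos rfl, linearDown]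
        congr 1
        push_cast
        field_simp
        ring

/-- Up to normalisation `transfer J` is the matrix of multiplication by -P_J(cos θ) on the spin -1
harmonics; the minus sign comes from the lower row -1, 1. It is banded, with K - L of the parity of
J, and its entries are checked separately above and below the diagonal. -/
theorem transfer_two {L K : ℕ} (hL : 1 ≤ L) (hK : 1 ≤ K) : transfer 2 L K = norming L *
    ((if K = L + 2 then quadraticUpTwo L else 0) + (if K = L + 0 then quadraticDiag L else 0)
      + (if K + 2 = L then quadraticDownTwo L else 0)) := by
  rcases le_total L K with h | h
  · obtain ⟨d, rfl⟩ := Nat.exists_eq_add_of_le h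
    have hp : (1 : ℝ) ≤ L := by exact_mod_cast hL
    have h1 : (2 * (L : ℝ) - 1) ≠ 0 := by linarith
    rcases Nat.lt_or_ge 2 d with hd | hd
    · rw [(transfer_eq_zero (Or.inl hd)).1, if_neg (by omega), if_neg (by omega), if_neg (by omega)]; ring
    · interval_cases d
      · rw [transfer_add hL (by omega) (by omega), racahProduct_zero_two hL, if_neg (by omega), if_pos rfl,
          if_neg (by omega), quadraticDiag]
        congr 1
        push_cast
        field_simp
        ring
      · rw [transfer_add hL (by omega) (by omega), racahProduct_one_two, if_neg (by omega), if_neg (by omega),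
          if_neg (by omega)]; ring
      · rw [transfer_add hL (by omega) (by omega), racahProduct_two_two hL, if_pos rfl, if_neg (by omega),
          if_neg (by omega), quadraticUpTwo]
        congr 1
        push_cast
        field_simp
        ring
  · obtain ⟨d, rfl⟩ := Nat.exists_eq_add_of_le h
    have hp : (1 : ℝ) ≤ K := by exact_mod_cast hK
    have h1 : (2 * (K : ℝ) - 1) ≠ 0 := by linarith
    have h3 : (K : ℝ) ≠ 0 := by linarith
    rcases Nat.lt_or_ge 2 d with hd | hd
    · rw [(transfer_eq_zero (Or.inl hd)).2, if_neg (by omega), if_neg (by omega), if_neg (by omega)]; ring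
    · interval_cases d
      · rw [transfer_sub hK (by omega) (by omega), racahProduct_zero_two hK, if_neg (by omega), if_pos (by omega),
          if_neg (by omega), quadraticDiag]
        congr 1
        push_cast
        simp only [add_zero]
        field_simp
        ring
      · rw [transfer_sub hK (by omega) (by omega), racahProduct_one_two, if_neg (by omega), if_neg (by omega),
          if_neg (by omega)]; ring
      · rw [transfer_sub hK (by omega) (by omega), racahProduct_two_two hK, if_neg (by omega), if_neg (by omega),
          if_pos rfl, quadraticDownTwo]
        congr 1
        push_cast
        rw [show 2 * ((K : ℝ) + 2) - 1 = 2 * K + 3 by ring]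
        field_simp
        ring

theorem transfer_four {L K : ℕ} (hL : 1 ≤ L) (hK : 1 ≤ K) : transfer 4 L K = norming L *
    ((if K = L + 4 then quarticUpFour L else 0) + (if K = L + 2 then quarticUpTwo L else 0)
      + (if K = L + 0 then quarticDiag L else 0) + (if K + 2 = L then quarticDownTwo L else 0)
      + (if K + 4 = L then quarticDownFour L else 0)) := by
  rcases le_total L K with h | h
  · obtain ⟨d, rfl⟩ := Nat.exists_eq_add_of_le h
    have hp : (1 : ℝ) ≤ L := by exact_mod_cast hL
    have h1 : (2 * (L : ℝ) - 1) ≠ 0 := by linarith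
    rcases Nat.lt_or_ge 4 d with hd | hd
    · rw [(transfer_eq_zero (Or.inl hd)).1, if_neg (by omega), if_neg (by omega), if_neg (by omega),
        if_neg (by omega), if_neg (by omega)]; ring
    · interval_cases d
      · rw [if_neg (by omega), if_neg (by omega), if_pos rfl, if_neg (by omega), if_neg (by omega)]
        -- For L = 1 the symbol vanishes by the triangle inequality, in agreement with the factor x
        -- - 1 in `quarticDiag`.
        rcases Nat.lt_or_ge L 2 with h2 | h2
        · obtain rfl : L = 1 := by omega
          rw [(transfer_eq_zero (Or.inr (by omega))).1, quarticDiag]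
          norm_num
        · have hp2 : (2 : ℝ) ≤ L := by exact_mod_cast h2
          have h3 : (2 * (L : ℝ) - 3) ≠ 0 := by linarith
          rw [transfer_add hL (by omega) (by omega), racahProduct_zero_four h2, quarticDiag]
          congr 1
          push_cast
          field_simp
          ring
      · rw [if_neg (by omega), if_neg (by omega), if_neg (by omega), if_neg (by omega), if_neg (by omega)]
        rcases Nat.lt_or_ge L 2 with h2 | h2
        · rw [(transfer_eq_zero (Or.inr (by omega))).1]; ring
        · rw [transfer_add hL (by omega) (by omega), racahProduct_one_four]; ring
      · rw [transfer_add hL (by omega) (by omega), racahProduct_two_four hL, if_neg (by omega), if_pos rfl,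
          if_neg (by omega), if_neg (by omega), if_neg (by omega), quarticUpTwo]
        congr 1
        push_cast
        field_simp
        ring
      · rw [transfer_add hL (by omega) (by omega), racahProduct_three_four, if_neg (by omega), if_neg (by omega),
          if_neg (by omega), if_neg (by omega), if_neg (by omega)]; ring
      · rw [transfer_add hL (by omega) (by omega), racahProduct_four_four hL, if_pos rfl, if_neg (by omega),
          if_neg (by omega), if_neg (by omega), if_neg (by omega), quarticUpFour]
        congr 1
        push_cast
        field_simp
        ring
  · obtain ⟨d, rfl⟩ := Nat.exists_eq_add_of_le h
    have hp : (1 : ℝ) ≤ K := by exact_mod_cast hK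
    have h1 : (2 * (K : ℝ) - 1) ≠ 0 := by linarith
    have h0 : (K : ℝ) ≠ 0 := by linarith
    rcases Nat.lt_or_ge 4 d with hd | hd
    · rw [(transfer_eq_zero (Or.inl hd)).2, if_neg (by omega), if_neg (by omega), if_neg (by omega),
        if_neg (by omega), if_neg (by omega)]; ring
    · interval_cases d
      · rw [if_neg (by omega), if_neg (by omega), if_pos (by omega), if_neg (by omega), if_neg (by omega)]
        rcases Nat.lt_or_ge K 2 with h2 | h2
        · obtain rfl : K = 1 := by omega
          rw [(transfer_eq_zero (Or.inr (by omega))).2, quarticDiag]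
          norm_num
        · have hp2 : (2 : ℝ) ≤ K := by exact_mod_cast h2
          have h3 : (2 * (K : ℝ) - 3) ≠ 0 := by linarith
          rw [transfer_sub hK (by omega) (by omega), racahProduct_zero_four h2, quarticDiag]
          congr 1
          push_cast
          simp only [add_zero]
          field_simp
          ring
      · rw [if_neg (by omega), if_neg (by omega), if_neg (by omega), if_neg (by omega), if_neg (by omega)]
        rcases Nat.lt_or_ge K 2 with h2 | h2
        · rw [(transfer_eq_zero (Or.inr (by omega))).2]; ring
        · rw [transfer_sub hK (by omega) (by omega), racahProduct_one_four]; ring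
      · rw [transfer_sub hK (by omega) (by omega), racahProduct_two_four hK, if_neg (by omega), if_neg (by omega),
          if_neg (by omega), if_pos rfl, if_neg (by omega), quarticDownTwo]
        congr 1
        push_cast
        rw [show 2 * ((K : ℝ) + 2) - 5 = 2 * K - 1 by ring, show 2 * ((K : ℝ) + 2) - 1 = 2 * K + 3 by ring]
        field_simp
        ring
      · rw [transfer_sub hK (by omega) (by omega), racahProduct_three_four, if_neg (by omega), if_neg (by omega),
          if_neg (by omega), if_neg (by omega), if_neg (by omega)]; ring
      · rw [transfer_sub hK (by omega) (by omega), racahProduct_four_four hK, if_neg (by omega), if_neg (by omega),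
          if_neg (by omega), if_neg (by omega), if_pos rfl, quarticDownFour]
        congr 1
        push_cast
        rw [show 2 * ((K : ℝ) + 4) - 5 = 2 * K + 3 by ring, show 2 * ((K : ℝ) + 4) - 3 = 2 * K + 5 by ring,
          show 2 * ((K : ℝ) + 4) - 1 = 2 * K + 7 by ring]
        field_simp
        ring

/-- The truncated L - 1 is harmless at L = 0, since `zonal 0` vanishes. -/
theorem cos_mul_zonal_eq (L : ℕ) (θ : ℝ) :
    cos θ * zonal L θ = -(linearUp L * zonal (L + 1) θ + linearDown L * zonal (L - 1) θ) := by
  cases L with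
  | zero => simp [zonal_zero, linearUp]
  | succ n =>
    have h := cos_mul_zonal n θ
    simp only [linearUp, linearDown, Nat.add_sub_cancel]
    push_cast
    field_simp
    linear_combination h

/-- The recurrence applied twice, arranged as cos² = 1/3 + (2/3) P₂. For L = 1 the index L - 2
truncates to 0, where `zonal` vanishes. -/
theorem cos_sq_mul_zonal (L : ℕ) (θ : ℝ) :
    cos θ ^ 2 * zonal L θ = 1 / 3 * zonal L θ - 2 / 3 * (quadraticUpTwo L * zonal (L + 2) θ
      + quadraticDiag L * zonal L θ + quadraticDownTwo L * zonal (L - 2) θ) := by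
  rw [pow_two, mul_assoc, cos_mul_zonal_eq, mul_neg, mul_add, mul_left_comm, mul_left_comm (cos θ), cos_mul_zonal_eq,
    cos_mul_zonal_eq]
  simp only [linearUp, linearDown, quadraticUpTwo, quadraticDiag, quadraticDownTwo]
  rcases L with _ | _ | n
  · simp [zonal_zero]
  · simp [zonal_zero]
    ring
  · simp only [Nat.add_sub_cancel, show n + 1 + 1 - 2 = n by omega, show n + 1 + 1 - 1 = n + 1 by omega]
    push_cast
    rw [show 2 * ((n : ℝ) + 1 + 1) - 1 = 2 * n + 3 by ring]
    field_simp
    ring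

section Quartic

variable {x : ℝ} (h : ∀ k : ℤ, 2 * x + (2 * k + 1) ≠ 0)
include h

/-- This and the next four lemmas compare coefficients in (1 - cos⁴)/16 = 1/20 - P₄/70 - P₂/28,
where cos⁴ is multiplication by cos² done twice: one lemma for each of the harmonics L + 4, L + 2,
L, L - 2, L - 4. -/
theorem quarticUpFour_eq : 1 / 36 * (quadraticUpTwo x * quadraticUpTwo (x + 2)) = -(1 / 70 * quarticUpFour x) := by
  have h1 : 2 * x + 1 ≠ 0 := by simpa using h 0
  have h3 : 2 * x + 3 ≠ 0 := by convert h 1 using 1; push_cast; ring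
  have h5 : 2 * x + 5 ≠ 0 := by convert h 2 using 1; push_cast; ring
  have h7 : 2 * x + 7 ≠ 0 := by convert h 3 using 1; push_cast; ring
  simp only [quadraticUpTwo, quarticUpFour]
  rw [show 2 * (x + 2) + 1 = 2 * x + 5 by ring, show 2 * (x + 2) + 3 = 2 * x + 7 by ring]
  field_simp
  ring

theorem quarticUpTwo_eq : quadraticUpTwo x * (1 / 3 - 2 / 3 * quadraticDiag x)
    + quadraticUpTwo x * (1 / 3 - 2 / 3 * quadraticDiag (x + 2)) =
      24 * (1 / 70 * quarticUpTwo x + 1 / 28 * quadraticUpTwo x) := by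
  have h1 : 2 * x + 1 ≠ 0 := by simpa using h 0
  have h3 : 2 * x + 3 ≠ 0 := by convert h 1 using 1; push_cast; ring
  have h7 : 2 * x + 7 ≠ 0 := by convert h 3 using 1; push_cast; ring
  have m1 : 2 * x - 1 ≠ 0 := by convert h (-1) using 1; push_cast; ring
  simp only [quadraticUpTwo, quadraticDiag, quarticUpTwo]
  rw [show 2 * (x + 2) - 1 = 2 * x + 3 by ring, show 2 * (x + 2) + 3 = 2 * x + 7 by ring]
  field_simp
  ring

theorem quarticDiag_eq : (1 / 3 - 2 / 3 * quadraticDiag x) ^ 2 + 4 / 9 * (quadraticUpTwo x * quadraticDownTwo (x + 2))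
    + 4 / 9 * (quadraticDownTwo x * quadraticUpTwo (x - 2)) =
      1 - 16 * (1 / 20 + 1 / 70 * quarticDiag x + 1 / 28 * quadraticDiag x) := by
  have h1 : 2 * x + 1 ≠ 0 := by simpa using h 0
  have h3 : 2 * x + 3 ≠ 0 := by convert h 1 using 1; push_cast; ring
  have h5 : 2 * x + 5 ≠ 0 := by convert h 2 using 1; push_cast; ring
  have m1 : 2 * x - 1 ≠ 0 := by convert h (-1) using 1; push_cast; ring
  have m3 : 2 * x - 3 ≠ 0 := by convert h (-2) using 1; push_cast; ring
  simp only [quadraticUpTwo, quadraticDiag, quadraticDownTwo, quarticDiag]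
  rw [show 2 * (x + 2) - 1 = 2 * x + 3 by ring, show 2 * (x + 2) + 1 = 2 * x + 5 by ring,
    show 2 * (x - 2) + 1 = 2 * x - 3 by ring, show 2 * (x - 2) + 3 = 2 * x - 1 by ring]
  field_simp
  ring

theorem quarticDownTwo_eq : quadraticDownTwo x * (1 / 3 - 2 / 3 * quadraticDiag x)
    + quadraticDownTwo x * (1 / 3 - 2 / 3 * quadraticDiag (x - 2)) =
      24 * (1 / 70 * quarticDownTwo x + 1 / 28 * quadraticDownTwo x) := by
  have h1 : 2 * x + 1 ≠ 0 := by simpa using h 0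
  have h3 : 2 * x + 3 ≠ 0 := by convert h 1 using 1; push_cast; ring
  have m1 : 2 * x - 1 ≠ 0 := by convert h (-1) using 1; push_cast; ring
  have m5 : 2 * x - 5 ≠ 0 := by convert h (-3) using 1; push_cast; ring
  simp only [quadraticDownTwo, quadraticDiag, quarticDownTwo]
  rw [show 2 * (x - 2) - 1 = 2 * x - 5 by ring, show 2 * (x - 2) + 3 = 2 * x - 1 by ring]
  field_simp
  ring

theorem quarticDownFour_eq :
    1 / 36 * (quadraticDownTwo x * quadraticDownTwo (x - 2)) = -(1 / 70 * quarticDownFour x) := by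
  have h1 : 2 * x + 1 ≠ 0 := by simpa using h 0
  have m1 : 2 * x - 1 ≠ 0 := by convert h (-1) using 1; push_cast; ring
  have m3 : 2 * x - 3 ≠ 0 := by convert h (-2) using 1; push_cast; ring
  have m5 : 2 * x - 5 ≠ 0 := by convert h (-3) using 1; push_cast; ring
  simp only [quadraticDownTwo, quarticDownFour]
  rw [show 2 * (x - 2) - 1 = 2 * x - 5 by ring, show 2 * (x - 2) + 1 = 2 * x - 3 by ring]
  field_simp
  ring

end Quartic

theorem two_mul_add_odd_ne_zero (L : ℕ) (k : ℤ) : 2 * (L : ℝ) + (2 * k + 1) ≠ 0 := by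
  have : 2 * (L : ℤ) + (2 * k + 1) ≠ 0 := by omega
  exact_mod_cast this

theorem quartic_mul_zonal {L : ℕ} (hL : 1 ≤ L) (θ : ℝ) :
    1 / 16 * (1 - cos θ ^ 4) * zonal L θ = 1 / 20 * zonal L θ
      + 1 / 70 * (quarticUpFour L * zonal (L + 4) θ + quarticUpTwo L * zonal (L + 2) θ + quarticDiag L * zonal L θ
        + quarticDownTwo L * zonal (L - 2) θ + quarticDownFour L * zonal (L - 4) θ)
      + 1 / 28 * (quadraticUpTwo L * zonal (L + 2) θ + quadraticDiag L * zonal L θ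
        + quadraticDownTwo L * zonal (L - 2) θ) := by
  have e4 := quarticUpFour_eq (two_mul_add_odd_ne_zero L)
  have e2 := quarticUpTwo_eq (two_mul_add_odd_ne_zero L)
  have e0 := quarticDiag_eq (two_mul_add_odd_ne_zero L)
  have c0 := cos_sq_mul_zonal L θ
  have c2 := cos_sq_mul_zonal (L + 2) θ
  rw [show L + 2 + 2 = L + 4 from rfl, show L + 2 - 2 = L by omega] at c2
  push_cast at c2
  obtain ⟨n, rfl⟩ := Nat.exists_eq_add_of_le' hL
  cases n with
  | zero =>
    -- For L = 1 the path down to L - 2 and back does not exist; its formal coefficient is zero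
    -- because `quadraticUpTwo` contains the factor x + 1.
    have z : quadraticUpTwo (((0 + 1 : ℕ) : ℝ) - 2) = 0 := by norm_num [quadraticUpTwo]
    rw [z] at e0
    simp only [show 0 + 1 - 2 = 0 from rfl, zonal_zero, Pi.zero_apply] at c0 ⊢
    linear_combination (-(1 / 16) * cos θ ^ 2 - 1 / 16 * (1 / 3 - 2 / 3 * quadraticDiag ((0 + 1 : ℕ) : ℝ))) * c0
      + 1 / 24 * quadraticUpTwo ((0 + 1 : ℕ) : ℝ) * c2 - zonal (0 + 1 + 4) θ * e4
      + 1 / 24 * zonal (0 + 1 + 2) θ * e2 - 1 / 16 * zonal (0 + 1) θ * e0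
  | succ n =>
    have e2' := quarticDownTwo_eq (two_mul_add_odd_ne_zero (n + 1 + 1))
    have e4' := quarticDownFour_eq (two_mul_add_odd_ne_zero (n + 1 + 1))
    have c2' := cos_sq_mul_zonal n θ
    have hn : ((n + 1 + 1 : ℕ) : ℝ) - 2 = n := by push_cast; ring
    rw [hn] at e0 e2' e4'
    rw [show n + 1 + 1 - 2 = n by omega] at c0 ⊢
    rw [show n + 1 + 1 - 4 = n - 2 by omega]
    rw [show n + 2 = n + 1 + 1 from rfl] at c2'
    linear_combination (-(1 / 16) * cos θ ^ 2 - 1 / 16 * (1 / 3 - 2 / 3 * quadraticDiag ((n + 1 + 1 : ℕ) : ℝ))) * c0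
      + 1 / 24 * quadraticUpTwo ((n + 1 + 1 : ℕ) : ℝ) * c2 - zonal (n + 1 + 1 + 4) θ * e4
      + 1 / 24 * zonal (n + 1 + 1 + 2) θ * e2 - 1 / 16 * zonal (n + 1 + 1) θ * e0
      + 1 / 24 * quadraticDownTwo ((n + 1 + 1 : ℕ) : ℝ) * c2' - zonal (n - 2) θ * e4' + 1 / 24 * zonal n θ * e2'

end Coefficients

end KerrMaxwell
end

noncomputable section

namespace KerrMaxwell

open scoped ContDiff

/-! ### The modes of the Teukolsky equation on the horizon -/

section Sums

theorem hasSum_of_eq {f g : ℕ → ℂ} {s : ℂ} (hf : HasSum f s) (h : ∀ k, g k = f k) : HasSum g s := by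
  rwa [funext h]

/-- The summation index k stands for L' = k + 1, so a single entry at L' = L + d sits at k = L + d -
1. -/
theorem hasSum_up {L d : ℕ} (hL : 1 ≤ L) (c : ℝ) (g : ℕ → ℂ) :
    HasSum (fun k : ℕ => ((if k + 1 = L + d then c else 0 : ℝ) : ℂ) * g (k + 1)) (c * g (L + d)) := by
  have h := hasSum_ite_eq (L + d - 1) ((c : ℂ) * g (L + d))
  refine hasSum_of_eq h fun k => ?_
  by_cases hk : k + 1 = L + d
  · rw [if_pos hk, if_pos (by omega), hk]
  · rw [if_neg hk, if_neg (by omega)]; simp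

/-- If L ≤ d there is no entry; then L - d truncates to 0 and the value is zero by g 0 = 0. -/
theorem hasSum_down {L d : ℕ} (c : ℝ) (g : ℕ → ℂ) (hg : g 0 = 0) :
    HasSum (fun k : ℕ => ((if k + 1 + d = L then c else 0 : ℝ) : ℂ) * g (k + 1)) (c * g (L - d)) := by
  by_cases hL : d + 1 ≤ L
  · have h := hasSum_ite_eq (L - d - 1) ((c : ℂ) * g (L - d))
    refine hasSum_of_eq h fun k => ?_
    by_cases hk : k + 1 + d = L
    · rw [if_pos hk, if_pos (by omega), show L - d = k + 1 by omega]
    · rw [if_neg hk, if_neg (by omega)]; simp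
  · rw [show L - d = 0 by omega, hg, mul_zero]
    refine hasSum_of_eq hasSum_zero fun k => ?_
    rw [if_neg (by omega)]
    simp

end Sums

variable {M a : ℝ} {W : Set (ℝ × ℝ)} {F : TwoForm} {q : Fin 4 → ℝ} {L : ℕ}

/-- The ratio of `e₄` and `∂_v` on the horizon. -/
def speed (θ : ℝ) : ℝ := 4 / (1 + cos θ ^ 2)

theorem continuous_speed_mul_zonal (L : ℕ) : Continuous fun θ => speed θ * zonal L θ := by
  have h := (contDiff_zonal L).continuous
  unfold speed
  exact (continuous_const.div (by fun_prop) fun θ => by positivity).mul h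

/-- On the horizon e₄ is `speed` times ∂_v, and sin²θ = (1/4)(1 - cos⁴θ) · `speed`, so the
coefficients are four times those of `quartic_mul_zonal`. -/
theorem sin_sq_mul_zonal (hL : 1 ≤ L) : (fun θ => sin θ ^ 2 * zonal L θ) = fun θ =>
    2 / 35 * quarticUpFour L * (speed θ * zonal (L + 4) θ)
      + (2 / 35 * quarticUpTwo L + 1 / 7 * quadraticUpTwo L) * (speed θ * zonal (L + 2) θ)
      + (1 / 5 + 2 / 35 * quarticDiag L + 1 / 7 * quadraticDiag L) * (speed θ * zonal L θ)
      + (2 / 35 * quarticDownTwo L + 1 / 7 * quadraticDownTwo L) * (speed θ * zonal (L - 2) θ)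
      + 2 / 35 * quarticDownFour L * (speed θ * zonal (L - 4) θ) := by
  funext θ
  have h := quartic_mul_zonal hL θ
  have hc : (1 : ℝ) + cos θ ^ 2 ≠ 0 := by positivity
  have hv : speed θ * (1 + cos θ ^ 2) = 4 := by rw [speed]; field_simp
  have hs : sin θ ^ 2 = 1 - cos θ ^ 2 := by rw [← sin_sq_add_cos_sq θ]; ring
  rw [hs]
  linear_combination 4 * speed θ * h - 1 / 4 * (1 - cos θ ^ 2) * zonal L θ * hv

section Modes

variable (hM : 0 < M) (hW : IsOpen W) (hF : IsMaxwellField M a W F)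
  (hZ : ∀ q ∈ chart M W, pd M 3 (alphaNeg a F) q = 0) (ha : |a| = M)
include hM hW hF hZ ha

theorem mode_along_e4 (hq : q ∈ horizon M W) : mode L (along M (e4 M a) (Phi M a F)) q =
    -(norming L : ℂ) * moment (fun θ => speed θ * zonal L θ) (pd M 0 (PhiReg M a F)) q := by
  have e : EqOn (along M (e4 M a) (Phi M a F)) (fun p => (speed (p 2) : ℂ) * pd M 0 (PhiReg M a F) p)
      (horizon M W) := fun p hp => by
    rw [along_congr hW (Phi_eq hM hW) _ (horizon_subset_chart hp), along_e4_PhiReg_horizon hM hW hF hZ ha hp]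
    simp only [speed]
    push_cast
    rfl
  rw [mode_eq, moment_congr_horizon e hq, moment_mul_angle, harmNeg_eq]
  rw [show (fun θ => speed θ * (-norming L * zonal L θ)) = fun θ => -norming L * (speed θ * zonal L θ) by
    funext θ; ring, moment_const_mul_weight, Complex.ofReal_neg]

theorem hasSum_teukolsky (hq : q ∈ horizon M W) (hL : 1 ≤ L) :
    HasSum (fun k : ℕ =>
        1 / 2 * ((√((2 * L + 1) * (2 * ((k + 1 : ℕ) : ℝ) + 1)) / (L * (L + 1)) : ℝ) : ℂ) *
          (1 / 35 * (threeJProd L (k + 1) 4 : ℂ) * mode (k + 1) (along M (e4 M a) (Phi M a F)) q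
            + 1 / 14 * (threeJProd L (k + 1) 2 : ℂ) * mode (k + 1) (along M (e4 M a) (Phi M a F)) q
            - Complex.I * a / (M : ℂ) ^ 2 * (threeJProd L (k + 1) 1 : ℂ) * mode (k + 1) (Phi M a F) q))
      (mode L (phi0 a F) q
        + 1 / ((L : ℂ) * (L + 1)) * along M e3 (mode L (Phi M a F)) q
        - 1 / (20 * (L : ℂ) * (L + 1)) * mode L (along M (e4 M a) (Phi M a F)) q) := by
  have hd := chart_subset_dom (horizon_subset_chart hq)
  have hD := (smooth_PhiReg hM hW hF).pd hW 0
  have hP := smooth_PhiReg hM hW hF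
  have hM' : (M : ℂ) ≠ 0 := by exact_mod_cast hM.ne'
  have hL' : (L : ℂ) ≠ 0 := by exact_mod_cast (by omega : L ≠ 0)
  have hL1 : (L : ℂ) + 1 ≠ 0 := by exact_mod_cast (by omega : L + 1 ≠ 0)
  set g : ℕ → ℂ := fun K => moment (fun θ => speed θ * zonal K θ) (pd M 0 (PhiReg M a F)) q with hg
  set h : ℕ → ℂ := fun K => moment (zonal K) (PhiReg M a F) q with hh
  have mz : ∀ f, moment (fun _ => 0) f q = 0 := fun f => by
    have := moment_const_mul_weight (w := fun _ => 0) (f := f) (q := q) 0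
    simpa using this
  have g0 : g 0 = 0 := by simpa [hg, zonal_zero] using mz _
  have h0 : h 0 = 0 := by
    rw [hh]
    simp only [zonal_zero]
    exact mz _
  have key := moment_teukolsky hM hW hF hZ ha hq (L := L)
  have c : ∀ K (r : ℝ), Continuous fun θ => r * (speed θ * zonal K θ) := fun K r =>
    continuous_const.mul (continuous_speed_mul_zonal K)
  have eD : moment (fun θ => sin θ ^ 2 * zonal L θ) (pd M 0 (PhiReg M a F)) q =
      2 / 35 * quarticUpFour L * g (L + 4) + (2 / 35 * quarticUpTwo L + 1 / 7 * quadraticUpTwo L) * g (L + 2)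
      + (1 / 5 + 2 / 35 * quarticDiag L + 1 / 7 * quadraticDiag L) * g L
      + (2 / 35 * quarticDownTwo L + 1 / 7 * quadraticDownTwo L) * g (L - 2) + 2 / 35 * quarticDownFour L * g (L - 4) := by
    rw [sin_sq_mul_zonal hL, moment_add_weight hD ((((c _ _).fun_add (c _ _)).fun_add (c _ _)).fun_add (c _ _)) (c _ _) hd,
      moment_add_weight hD (((c _ _).fun_add (c _ _)).fun_add (c _ _)) (c _ _) hd,
      moment_add_weight hD ((c _ _).fun_add (c _ _)) (c _ _) hd, moment_add_weight hD (c _ _) (c _ _) hd]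
    simp only [moment_const_mul_weight]
    push_cast
    rfl
  have eP : moment (fun θ => cos θ * zonal L θ) (PhiReg M a F) q =
      -(linearUp L * h (L + 1) + linearDown L * h (L - 1)) := by
    have e : (fun θ => cos θ * zonal L θ) = fun θ => -linearUp L * zonal (L + 1) θ + -linearDown L * zonal (L - 1) θ := by
      funext θ; rw [cos_mul_zonal_eq]; ring
    rw [e, moment_add_weight hP (continuous_const.fun_mul (contDiff_zonal _).continuous)
      (continuous_const.fun_mul (contDiff_zonal _).continuous) hd]
    simp only [moment_const_mul_weight]
    push_cast
    ring
  rw [eD, eP] at key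
  have s4 := ((((hasSum_up (d := 4) hL (quarticUpFour L) g).add (hasSum_up (d := 2) hL (quarticUpTwo L) g)).add
    (hasSum_up (d := 0) hL (quarticDiag L) g)).add (hasSum_down (L := L) (d := 2) (quarticDownTwo L) g g0)).add
    (hasSum_down (L := L) (d := 4) (quarticDownFour L) g g0)
  have s2 := ((hasSum_up (d := 2) hL (quadraticUpTwo L) g).add (hasSum_up (d := 0) hL (quadraticDiag L) g)).add
    (hasSum_down (L := L) (d := 2) (quadraticDownTwo L) g g0)
  have s1 := (hasSum_up (d := 1) hL (linearUp L) h).add (hasSum_down (L := L) (d := 1) (linearDown L) h h0)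
  -- The banded matrices contribute finitely many single-entry series. Their sum is compared with
  -- the mode equation in `hval`, and their terms with the 3j expression through `t4`, `t2` and
  -- `t1`.
  have s := (((s4.mul_left (1 / 35)).add (s2.mul_left (1 / 14))).sub (s1.mul_left (Complex.I * a / (M : ℂ) ^ 2))).mul_left
    (-(norming L : ℂ) * (1 / 2) * (1 / ((L : ℂ) * (L + 1))))
  suffices hval : mode L (phi0 a F) q + 1 / ((L : ℂ) * (L + 1)) * along M e3 (mode L (Phi M a F)) q
      - 1 / (20 * (L : ℂ) * (L + 1)) * mode L (along M (e4 M a) (Phi M a F)) q = _ by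
    rw [hval]
    refine hasSum_of_eq s fun k => ?_
    have t4 := congrArg (fun r : ℝ => (r : ℂ)) (transfer_four hL (Nat.succ_le_succ (Nat.zero_le k)))
    have t2 := congrArg (fun r : ℝ => (r : ℂ)) (transfer_two hL (Nat.succ_le_succ (Nat.zero_le k)))
    have t1 := congrArg (fun r : ℝ => (r : ℂ)) (transfer_one hL (Nat.succ_le_succ (Nat.zero_le k)))
    simp only [transfer, Nat.succ_eq_add_one, Complex.ofReal_mul, Complex.ofReal_add] at t4 t2 t1
    rw [mode_along_e4 hM hW hF hZ ha hq, mode_Phi hM hW hd]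
    rw [show moment (fun θ => speed θ * zonal (k + 1) θ) (pd M 0 (PhiReg M a F)) q = g (k + 1) from rfl]
    beta_reduce
    rw [show moment (zonal (k + 1)) (PhiReg M a F) q = h (k + 1) from rfl]
    rw [Complex.ofReal_div]
    generalize ((√((2 * (L : ℝ) + 1) * (2 * ((k + 1 : ℕ) : ℝ) + 1)) : ℝ) : ℂ) = R at *
    simp only [Complex.ofReal_mul, Complex.ofReal_add, Complex.ofReal_natCast, Complex.ofReal_one]
    linear_combination (-(1 / 2 * (1 / ((L : ℂ) * (L + 1)))) * g (k + 1) / 35) * t4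
      + (-(1 / 2 * (1 / ((L : ℂ) * (L + 1)))) * g (k + 1) / 14) * t2
      + (1 / 2 * (1 / ((L : ℂ) * (L + 1))) * h (k + 1) * (Complex.I * a / (M : ℂ) ^ 2)) * t1
  simp only [mode_along_e4 hM hW hF hZ ha hq, mode_phi0 hM hd, along_e3,
    (hasPartial_mode_Phi hM hW hF hd (Or.inr rfl)).pd_eq hd.1]
  rw [show moment (fun θ => speed θ * zonal L θ) (pd M 0 (PhiReg M a F)) q = g L from rfl]
  -- Since L ≥ 1, the mode equation can be divided by L(L+1).
  have e : moment (zonal L) (phiReg a F) q = ((L : ℂ) * (L + 1) * moment (zonal L) (phiReg a F) q) / (L * (L + 1)) := by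
    field_simp
  rw [e, key]
  field_simp
  ring_nf

end Modes

end KerrMaxwell
end

/-! ### Assembly of the horizon identities and conservation laws. -/

theorem mainTheorem10 (M a : ℝ) (hM : 0 < M) (ha : |a| = M) (W : Set (ℝ × ℝ)) (hW : IsOpen W)
    (F : TwoForm) (hF : IsMaxwellField M a W F)
    (hZ : ∀ q ∈ chart M W, pd M 3 (alphaNeg a F) q = 0) :
    -- the transversal and tangential derivatives that occur below exist
    (∀ q ∈ horizon M W,
      HasPd M 1 (mean (Ups M a F)) q ∧ HasPd M 1 (along M e3 (mean (Ups M a F))) q ∧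
      ∀ L : ℕ, 1 ≤ L → HasPd M 1 (mode L (phi0 a F)) q ∧ HasPd M 1 (mode L (Phi M a F)) q ∧
        HasPd M 0 (mode L (Phi M a F)) q) ∧
    -- the transversal derivative of the middle components along the horizon
    (∀ q ∈ horizon M W,
      along M e3 (Ups M a F) q =
        1 / M * (pd M 2 (fun p => (M - Complex.I * a * cos (p 2)) * phi0 a F p) q
          + (-(2 * Complex.I * a * sin (q 2) / (M - Complex.I * a * cos (q 2)))
              + (cos (q 2) : ℂ) / sin (q 2)) * ((M - Complex.I * a * cos (q 2)) * phi0 a F q))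
        + (M * cos (q 2) + Complex.I * a) * sin (q 2) / (4 * (M : ℂ) ^ 2) * Phi M a F q) ∧
    -- the transversal derivative of the spherical mean, through the mode components
    (∀ q ∈ horizon M W,
      along M e3 (mean (Ups M a F)) q =
        -(1 / (2 * (√30 : ℝ) * M)) *
            (Complex.I * a / M * (√5 : ℝ) * mode 1 (Phi M a F) q + mode 2 (Phi M a F) q)
          + 2 * Complex.I * a / M * (√(2 / 3) : ℝ) * mode 1 (phi0 a F) q) ∧
    -- the spin `-1` Teukolsky equation along the horizon
    (∀ q ∈ horizon M W,
      lapNegAddOne M (phi0 a F) q =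
        -along M e3 (Phi M a F) q
          + 1 / 16 * (sin (q 2) : ℂ) ^ 2 * (1 + (cos (q 2) : ℂ) ^ 2) * along M (e4 M a) (Phi M a F) q
          + Complex.I * a * cos (q 2) / (2 * (M : ℂ) ^ 2) * Phi M a F q) ∧
    -- its mode components
    (∀ q ∈ horizon M W, ∀ L : ℕ, 1 ≤ L →
      HasSum (fun k : ℕ =>
          1 / 2 * ((√((2 * L + 1) * (2 * ((k + 1 : ℕ) : ℝ) + 1)) / (L * (L + 1)) : ℝ) : ℂ) *
            (1 / 35 * (threeJProd L (k + 1) 4 : ℂ) * mode (k + 1) (along M (e4 M a) (Phi M a F)) q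
              + 1 / 14 * (threeJProd L (k + 1) 2 : ℂ) * mode (k + 1) (along M (e4 M a) (Phi M a F)) q
              - Complex.I * a / (M : ℂ) ^ 2 * (threeJProd L (k + 1) 1 : ℂ) * mode (k + 1) (Phi M a F) q))
        (mode L (phi0 a F) q
          + 1 / ((L : ℂ) * (L + 1)) * along M e3 (mode L (Phi M a F)) q
          - 1 / (20 * (L : ℂ) * (L + 1)) * mode L (along M (e4 M a) (Phi M a F)) q)) ∧
    -- hence the transversal derivative of the spherical mean, through `Φ^{[-1]}` alone (here `∂_v = T`)
    (∀ q ∈ horizon M W,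
      along M e3 (mean (Ups M a F)) q =
        -(Complex.I * a / (2 * (√6 : ℝ) * (M : ℂ) ^ 2)) * mode 1 (Phi M a F) q
          - 3 / (2 * (√30 : ℝ) * M) * mode 2 (Phi M a F) q
          + 2 * Complex.I * a / ((√6 : ℝ) * M) *
            (-along M e3 (mode 1 (Phi M a F)) q + 1 / 5 * pd M 0 (mode 1 (Phi M a F)) q
              - (√14 : ℝ) / 70 * pd M 0 (mode 3 (Phi M a F)) q)) ∧
    -- the conservation law for the spin `-1` Teukolsky field
    (∀ q ∈ horizon M W, ∀ q' ∈ horizon M W, (∀ v ∈ uIcc (q 0) (q' 0), (v, M) ∈ W) →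
      teukolskyCharge M a F q = teukolskyCharge M a F q') ∧
    -- the conservation law it induces for the middle components
    (∀ q ∈ horizon M W,
      middleCharge M a F q =
        -(Complex.I * a / ((√6 : ℝ) * (M : ℂ) ^ 3)) * teukolskyCharge M a F q) ∧
    (∀ q ∈ horizon M W, ∀ q' ∈ horizon M W, (∀ v ∈ uIcc (q 0) (q' 0), (v, M) ∈ W) →
      middleCharge M a F q = middleCharge M a F q') := by
  have hs : ∀ {q}, q ∈ horizon M W → q ∈ dom M W := fun hq => chart_subset_dom (horizon_subset_chart hq)
  refine ⟨fun q hq => ⟨(hasPartial_mean hM hW hF (hs hq)).hasPd,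
      (hasPartial_congr_dom hW (along_e3_mean hM hW hF hZ) (hs hq) (hasPartial_meanFlux hM hW hF (hs hq))).hasPd,
      fun L _ => ⟨(hasPartial_mode_phi0 hM hW hF (hs hq) (Or.inr rfl)).hasPd,
        (hasPartial_mode_Phi hM hW hF (hs hq) (Or.inr rfl)).hasPd,
        (hasPartial_mode_Phi hM hW hF (hs hq) (Or.inl rfl)).hasPd⟩⟩,
    fun q hq => along_e3_Ups hM hW hF hZ ha hq, fun q hq => along_e3_mean_horizon hM hW hF hZ ha hq,
    fun q hq => teukolsky_horizon hM hW hF hZ ha hq, fun q hq L hL => hasSum_teukolsky hM hW hF hZ ha hq hL,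
    fun q hq => along_e3_mean_of_Phi hM hW hF hZ ha hq,
    fun q hq q' hq' h => teukolskyCharge_const hM hW hF hZ ha hq hq' h,
    fun q hq => middleCharge_eq hM hW hF hZ ha hq, fun q hq q' hq' h => ?_⟩
  rw [middleCharge_eq hM hW hF hZ ha hq, middleCharge_eq hM hW hF hZ ha hq',
    teukolskyCharge_const hM hW hF hZ ha hq hq' h]
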